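/- For each $n$, let $\mathcal K_n$ be the complete graph on $[n]=\{1,\dots,n\}$ with i.i.d. edge lengths $E_e$, exponentially distributed with mean $n$. Let $d_w(i,j)$ be the minimum, over all paths from $i$ to $j$ in $\mathcal K_n$, of the sum of the edge lengths on the path, and let $X_{(i)}=\min_{j\ne i}E_{\{i,j\}}$ be the minimal length of an edge incident to vertex $i$. For $\alpha\in\mathbb R$ put $N_n(\alpha)=\#\{i\in[n]: X_{(i)}\ge \log n-\alpha\}$. Let $(\Lambda_i)_{1\le i\le m}$ and $(\Lambda_{ij})_{1\le i<j\le m}$ be independent standard Gumbel random variables, i.e. with distribution function $x\mapsto e^{-e^{-x}}$. **Proposition 4.7.** Fix $\alpha\in\mathbb R$ and an integer $m\ge2$. On the event $\{N_n(\alpha)=m\}$, which has positive probability for all sufficiently large $n$, let $V_1,\dots,V_m$ be the $m$ vertices $v$ with $X_{(v)}\ge\log n-\alpha$, labelled by any rule that depends only on the set of these vertices (for example in increasing order). Then, conditionally on $N_n(\alpha)=m$, as $n\to\infty$, $$\bigl(d_w(V_i,V_j)-3\log n+2\alpha\bigr)_{1\le i<j\le m}\;\longrightarrow\;\bigl(\Lambda_i+\Lambda_j-\Lambda_{ij}\bigr)_{1\le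 i<j\le m}\quad\text{in distribution.}$$ -/

import Mathlib

open MeasureTheory ProbabilityTheory Filter

/-- The length of a walk in the complete graph on `Fin n` whose edge `e` has length `w e`: the sum
of the lengths of its edges. (The value of `w` at the loops `s(i, i)` is never used.) -/
noncomputable def pathLength {n : ℕ} (w : Sym2 (Fin n) → ℝ) {i j : Fin n}
    (p : (⊤ : SimpleGraph (Fin n)).Walk i j) : ℝ :=
  (p.edges.map w).sum

/-- The distance `d_w(i, j)`: the minimum of the lengths of the (finitely many) paths from `i` to
`j` in the complete graph. -/
noncomputable def weightedDist {n : ℕ} (w : Sym2 (Fin n) → ℝ) (i j : Fin n) : ℝ :=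
  ⨅ p : (⊤ : SimpleGraph (Fin n)).Path i j, pathLength w p.1

/-- `X_(i)`, the minimum of the lengths of the edges incident to the vertex `i`. -/
noncomputable def minIncidentWeight {n : ℕ} (w : Sym2 (Fin n) → ℝ) (i : Fin n) : ℝ :=
  ⨅ j : {j : Fin n // j ≠ i}, w s(i, j.1)

open Classical in
/-- The set of vertices whose minimal incident edge length is at least `log n - α`. Its
cardinality is `N_n(α)`. -/
noncomputable def slowVertices {n : ℕ} (α : ℝ) (w : Sym2 (Fin n) → ℝ) : Finset (Fin n) :=
  {i : Fin n | Real.log n - α ≤ minIncidentWeight w i}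

/-- The pairs `(i, j)` with `i < j` of elements of `Fin m`. -/
abbrev OrderedPairs (m : ℕ) : Type := {p : Fin m × Fin m // p.1 < p.2}

open Classical in
/-- The array `(d_w(V_i, V_j) - 3 log n + 2 α)_{i < j}`, when there are exactly `m` vertices with
minimal incident edge length at least `log n - α` and `V` says how each set of `m` vertices is
labelled as `V_1, …, V_m`. (The value `0` otherwise is immaterial: the array is only
considered conditionally on there being exactly `m` such vertices.) -/
noncomputable def recenteredDistances {n m : ℕ} (α : ℝ)
    (V : (S : Finset (Fin n)) → S.card = m → (Fin m ≃ S)) (w : Sym2 (Fin n) → ℝ) :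
    OrderedPairs m → ℝ := fun p ↦
  if h : (slowVertices α w).card = m then
    weightedDist w (V _ h p.1.1 : Fin n) (V _ h p.1.2 : Fin n) - 3 * Real.log n + 2 * α
  else 0

/-- `X` is a random variable with the standard Gumbel distribution, that is, with cumulative
distribution function `x ↦ exp (-exp (-x))`. -/
def IsStdGumbel {Ω : Type*} [MeasurableSpace Ω] (X : Ω → ℝ) (μ : Measure Ω) : Prop :=
  AEMeasurable X μ ∧ ∀ x : ℝ, cdf (μ.map X) x = Real.exp (-Real.exp (-x))

/-! ### Exponential families: memorylessness and decomposition at the minimal coordinate. -/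

open scoped ENNReal Topology

set_option linter.unusedSectionVars false

/-! Put `c = log n - α`. The set of slow vertices equals `S` exactly when every edge touching `S`
has length at least `c` and no vertex outside `S` is isolated at level `c` from the rest of the
complement (`slowVertices_eq_iff`). By memorylessness the first requirement just adds `c` to fresh
independent lengths on the edges touching `S`, so a path between two points of `S` through other
vertices gains `2 c`. Since `3 log n - 2 α = log n + 2 c`, the question becomes whether the fresh
distances between `m` given vertices exceed `log n + x_ij`.

For fresh lengths, the neighbourhood of a vertex grows like a Yule process: it has `M ≈ n^(1/4)`
vertices at a time close to `log M - log y_i`, with `y_i` independent standard exponentials. What is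
left of the threshold between two such clusters is about `log n - 2 log M + x_ij + log y_i + log
y_j`. During that time the number of connections is nearly Poisson of mean `(M^2 / n) exp(remaining
time)`, which tends to `exp(x_ij) y_i y_j`. The limit is therefore the expectation of `∏
exp(-exp(x_ij) y_i y_j)` (`farLimit`), and with `Λ_i = -log y_i` this is the probability that `Λ_i +
Λ_j - Λ_ij ≥ x_ij` for all pairs.

The rigorous form consists of two one-sided bounds, both obtained by revealing the shortest edge
leaving a cluster (`iidExp_le_sum_hitAt`). Taking suprema over all configurations with given cluster
sizes (`sepBound`, `nearBound`) turns the exploration into a recursion on sizes. For the upper bound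
only paths through unused vertices count, and the second stage is `starEvent_le`. For the lower
bound moving inside a cluster is free, each pair is treated by `iidExp_freeNear_le`, and Harris'
inequality combines the pairs. The second-stage recursions are solved by explicit supersolutions
(`setLIntegral_exp_mul_le`). Both bounds converge to the same limit: `exists_tendsto_sepBound`,
`exists_tendsto_nearBound`.

It remains to condition on the absence of isolated vertices. Being far apart and being isolated are
increasing events, so Harris gives the upper bound. For the lower bound,
`le_measureReal_pi_inter_compl` uses that forcing one vertex to be isolated hardly affects the
distances, while the expected number of isolated vertices is bounded and the probability of having
none is bounded below (`exists_noIsolated_bounds`). Everything meets in `exists_conditional_bounds`,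
uniformly in `S`; convergence of upper orthant probabilities then gives weak convergence. -/

instance isProbabilityMeasure_expMeasure_of_fact {r : ℝ} [hr : Fact (0 < r)] :
    IsProbabilityMeasure (expMeasure r) := isProbabilityMeasure_expMeasure hr.out

instance nullSingletonClass_expMeasure {r : ℝ} : NullSingletonClass (expMeasure r) := by
  unfold expMeasure gammaMeasure
  infer_instance

lemma expMeasure_Iic {r : ℝ} (hr : 0 < r) (a : ℝ) :
    expMeasure r (Set.Iic a) = ENNReal.ofReal (1 - Real.exp (-(r * max a 0))) := by
  have := isProbabilityMeasure_expMeasure hr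
  have h := cdf_expMeasure_eq hr a
  rw [cdf_eq_real] at h
  rw [← ofReal_measureReal, h]
  split_ifs with h0
  · rw [max_eq_left h0]
  · rw [max_eq_right (le_of_not_ge h0)]; simp

lemma expMeasure_Ici {r : ℝ} (hr : 0 < r) (a : ℝ) :
    expMeasure r (Set.Ici a) = ENNReal.ofReal (Real.exp (-(r * max a 0))) := by
  have := isProbabilityMeasure_expMeasure hr
  rw [← Set.compl_Iio, prob_compl_eq_one_sub measurableSet_Iio,
    measure_congr (Iio_ae_eq_Iic (μ := expMeasure r)), expMeasure_Iic hr,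
    ← ENNReal.ofReal_one, ← ENNReal.ofReal_sub _ (by
      rw [sub_nonneg, Real.exp_le_one_iff, neg_nonpos]; positivity)]
  congr 1; ring

/-- Memorylessness of one exponential variable, in a form that is stable under products; it suffices
to compare masses of the half-lines `Ici a`. -/
lemma restrict_expMeasure {r : ℝ} (hr : 0 < r) {c : ℝ} (hc : 0 ≤ c) :
    (expMeasure r).restrict (Set.Ici c)
      = ENNReal.ofReal (Real.exp (-(r * c))) • (expMeasure r).map (fun x ↦ c + x) := by
  have := isProbabilityMeasure_expMeasure hr
  refine Measure.ext_of_Ici _ _ fun a ↦ ?_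
  rw [Measure.restrict_apply measurableSet_Ici, Set.Ici_inter_Ici, expMeasure_Ici hr,
    Measure.smul_apply, Measure.map_apply (by fun_prop) measurableSet_Ici]
  have : (fun x : ℝ ↦ c + x) ⁻¹' Set.Ici a = Set.Ici (a - c) := by
    ext x; simp
  rw [this, expMeasure_Ici hr, smul_eq_mul, ← ENNReal.ofReal_mul (Real.exp_pos _).le,
    ← Real.exp_add]
  congr 2
  have h1 : max (max a c) 0 = c + max (a - c) 0 := by
    rcases le_total a c with h | h
    · rw [max_eq_right h, max_eq_left hc, max_eq_right (by linarith)]; ring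
    · rw [max_eq_left h, max_eq_left (by linarith), max_eq_left (by linarith)]; ring
  change -(r * max (max a c) 0) = _
  rw [h1]; ring

/-- The law of a family of independent exponential variables of rate `r`. -/
noncomputable abbrev iidExp (ι : Type*) [Fintype ι] (r : ℝ) : Measure (ι → ℝ) :=
  Measure.pi fun _ ↦ expMeasure r

section
variable {ι : Type*} [DecidableEq ι]

/-- Add `x` to the coordinates in `K`. -/
def shiftOn (K : Finset ι) (x : ℝ) (w : ι → ℝ) : ι → ℝ :=
  fun e ↦ if e ∈ K then x + w e else w e

/-- Set the coordinate `e` to `x` and add `x` to the other coordinates in `K`. -/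
def hitAt (K : Finset ι) (e : ι) (x : ℝ) (w : ι → ℝ) : ι → ℝ :=
  Function.update (shiftOn K x w) e x

lemma measurable_shiftOn (K : Finset ι) (x : ℝ) : Measurable (shiftOn K x) := by
  unfold shiftOn
  refine measurable_pi_lambda _ fun e ↦ ?_
  split_ifs <;> fun_prop

variable [Fintype ι]

/-- Memorylessness of a family of independent exponential variables. -/
lemma restrict_iidExp {r : ℝ} [hr : Fact (0 < r)] (K : Finset ι) {c : ℝ} (hc : 0 ≤ c) :
    (iidExp ι r).restrict {w | ∀ e ∈ K, c ≤ w e}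
      = ENNReal.ofReal (Real.exp (-(r * c * K.card))) • (iidExp ι r).map (shiftOn K c) := by
  have hset : {w : ι → ℝ | ∀ e ∈ K, c ≤ w e}
      = Set.univ.pi fun e ↦ if e ∈ K then Set.Ici c else Set.univ := by
    ext w
    simp only [Set.mem_ofPred_eq, Set.mem_univ_pi]
    refine forall_congr' fun e ↦ ?_
    split_ifs with h <;> simp [h]
  have hmap : (iidExp ι r).map (shiftOn K c) = Measure.pi fun e ↦ (expMeasure r).map
      (fun x ↦ if e ∈ K then c + x else x) := by
    have hm : ∀ e, Measurable (fun x : ℝ ↦ if e ∈ K then c + x else x) := fun e ↦ by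
      split_ifs <;> fun_prop
    have : ∀ e, IsProbabilityMeasure ((expMeasure r).map
        (fun x ↦ if e ∈ K then c + x else x)) :=
      fun e ↦ Measure.isProbabilityMeasure_map (hm e).aemeasurable
    exact Measure.pi_map_pi (μ := fun _ : ι ↦ expMeasure r) fun e ↦ (hm e).aemeasurable
  have hm : ∀ e, Measurable (fun x : ℝ ↦ if e ∈ K then c + x else x) := fun e ↦ by
      split_ifs <;> fun_prop
  have : ∀ e, IsProbabilityMeasure ((expMeasure r).map
        (fun x ↦ if e ∈ K then c + x else x)) :=
      fun e ↦ Measure.isProbabilityMeasure_map (hm e).aemeasurable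
  rw [hset, Measure.restrict_pi_pi, hmap]
  refine Measure.pi_eq fun s hs ↦ ?_
  rw [Measure.smul_apply, Measure.pi_pi]
  have h1 : ∀ e, ((expMeasure r).restrict (if e ∈ K then Set.Ici c else Set.univ)) (s e)
      = (if e ∈ K then ENNReal.ofReal (Real.exp (-(r * c))) else 1)
        * ((expMeasure r).map (fun x ↦ if e ∈ K then c + x else x)) (s e) := by
    intro e
    split_ifs with h
    · rw [restrict_expMeasure hr.out hc, Measure.smul_apply, smul_eq_mul]
    · simp
  rw [Finset.prod_congr rfl fun e _ ↦ h1 e, Finset.prod_mul_distrib, smul_eq_mul]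
  congr 1
  rw [Finset.prod_ite_mem, Finset.univ_inter, Finset.prod_const, ← ENNReal.ofReal_pow
    (Real.exp_pos _).le, ← Real.exp_nat_mul]
  congr 2; ring

/-- The working form of memorylessness: forcing the coordinates in `K` to be at least `c` costs an
explicit factor, and afterwards the weights are fresh ones with `c` added on `K`. -/
lemma iidExp_inter {r : ℝ} [Fact (0 < r)] (K : Finset ι) {c : ℝ} (hc : 0 ≤ c)
    {X : Set (ι → ℝ)} (hX : MeasurableSet X) :
    iidExp ι r {w | w ∈ X ∧ ∀ e ∈ K, c ≤ w e}
      = ENNReal.ofReal (Real.exp (-(r * c * K.card))) * iidExp ι r {w | shiftOn K c w ∈ X} := by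
  have h := congrArg (fun μ ↦ μ X) (restrict_iidExp (r := r) K hc)
  simp only [Measure.smul_apply, smul_eq_mul] at h
  rw [Measure.restrict_apply hX, Measure.map_apply (measurable_shiftOn K c) hX] at h
  exact h

/-- Resampling the coordinate `e` independently preserves the law. This isolates the value of one
coordinate as an integration variable without splitting the index type. -/
lemma measurePreserving_update (r : ℝ) [Fact (0 < r)] (e : ι) :
    MeasurePreserving (fun p : ℝ × (ι → ℝ) ↦ Function.update p.2 e p.1)
      ((expMeasure r).prod (iidExp ι r)) (iidExp ι r) := by
  have hmeas : Measurable fun p : ℝ × (ι → ℝ) ↦ Function.update p.2 e p.1 := by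
    refine measurable_pi_lambda _ fun e' ↦ ?_
    by_cases h : e' = e
    · subst h; simp; fun_prop
    · simp [Function.update_of_ne h]; fun_prop
  refine ⟨hmeas, (Measure.pi_eq fun s hs ↦ ?_).symm⟩
  rw [Measure.map_apply hmeas (MeasurableSet.univ_pi hs)]
  have : (fun p : ℝ × (ι → ℝ) ↦ Function.update p.2 e p.1) ⁻¹' (Set.univ.pi s)
      = (s e) ×ˢ (Set.univ.pi (Function.update s e Set.univ)) := by
    ext ⟨x, w⟩
    simp only [Set.mem_preimage, Set.mem_univ_pi, Set.mem_prod]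
    constructor
    · intro h
      refine ⟨by simpa using h e, fun e' ↦ ?_⟩
      by_cases he : e' = e
      · subst he; simp
      · simpa [Function.update_of_ne he] using h e'
    · rintro ⟨h1, h2⟩ e'
      by_cases he : e' = e
      · subst he; simpa using h1
      · simpa [Function.update_of_ne he] using h2 e'
  rw [this, Measure.prod_prod, Measure.pi_pi, ← Finset.mul_prod_erase _ _ (Finset.mem_univ e),
    ← Finset.mul_prod_erase Finset.univ (fun i ↦ expMeasure r (s i)) (Finset.mem_univ e)]
  simp only [Function.update_self, measure_univ, one_mul]
  congr 1
  refine Finset.prod_congr rfl fun e' he' ↦ ?_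
  rw [Function.update_of_ne (Finset.ne_of_mem_erase he')]

lemma lintegral_expMeasure {r : ℝ} (f : ℝ → ℝ≥0∞) :
    ∫⁻ x, f x ∂(expMeasure r)
      = ∫⁻ x in Set.Ioi 0, ENNReal.ofReal (r * Real.exp (-(r * x))) * f x := by
  have hm : Measurable (exponentialPDF r) := (measurable_exponentialPDFReal r).ennreal_ofReal
  have h1 : expMeasure r = volume.withDensity (exponentialPDF r) := rfl
  rw [h1, lintegral_withDensity_eq_lintegral_mul_non_measurable _ hm
    (ae_of_all _ fun x ↦ by simp [exponentialPDF])]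
  rw [← setLIntegral_univ, ← Set.Iio_union_Ici (a := (0 : ℝ)),
    lintegral_union measurableSet_Ici (by
      rw [Set.disjoint_left]; intro x hx hx'; exact (Set.mem_Iio.1 hx).not_ge hx'),
    setLIntegral_congr_fun (g := fun _ ↦ 0) measurableSet_Iio (fun x hx ↦ by
      simp [exponentialPDF_of_neg hx]), lintegral_zero, zero_add,
    setLIntegral_congr Ioi_ae_eq_Ici.symm]
  refine setLIntegral_congr_fun measurableSet_Ioi fun x hx ↦ ?_
  simp [exponentialPDF_of_nonneg (le_of_lt hx)]

/-- Decomposition of an event according to which of the coordinates in `K` is minimal. -/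
lemma iidExp_le_sum_hitAt {r : ℝ} [hr : Fact (0 < r)] {K : Finset ι} (hK : K.Nonempty)
    {X : Set (ι → ℝ)} (hX : MeasurableSet X) :
    iidExp ι r X ≤ ∑ e ∈ K, ∫⁻ x in Set.Ioi 0,
      ENNReal.ofReal (r * Real.exp (-(r * K.card * x))) * iidExp ι r {w | hitAt K e x w ∈ X} := by
  have hcover : X ⊆ ⋃ e ∈ K, {w | w ∈ X ∧ ∀ e' ∈ K, w e ≤ w e'} := by
    intro w hw
    obtain ⟨e, he, hmin⟩ := K.exists_min_image w hK
    simp only [Set.mem_iUnion]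
    exact ⟨e, he, hw, hmin⟩
  refine (measure_mono hcover).trans ((measure_biUnion_finset_le _ _).trans ?_)
  refine Finset.sum_le_sum fun e he ↦ le_of_eq ?_
  have hY : MeasurableSet {w : ι → ℝ | w ∈ X ∧ ∀ e' ∈ K, w e ≤ w e'} := by
    refine hX.inter ?_
    have : {w : ι → ℝ | ∀ e' ∈ K, w e ≤ w e'} = ⋂ e' ∈ K, {w | w e ≤ w e'} := by
      ext; simp
    change MeasurableSet {w : ι → ℝ | ∀ e' ∈ K, w e ≤ w e'}
    rw [this]
    exact Finset.measurableSet_biInter _ fun e' _ ↦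
      measurableSet_le (measurable_pi_apply _) (measurable_pi_apply _)
  have hpres := measurePreserving_update (ι := ι) r e
  rw [← hpres.measure_preimage hY.nullMeasurableSet,
    Measure.prod_apply (hpres.measurable hY), lintegral_expMeasure]
  refine setLIntegral_congr_fun measurableSet_Ioi fun x hx ↦ ?_
  have hx0 : (0 : ℝ) ≤ x := le_of_lt hx
  have hX' : MeasurableSet {w : ι → ℝ | Function.update w e x ∈ X} := by
    have : Measurable fun w : ι → ℝ ↦ Function.update w e x :=
      hpres.measurable.comp (measurable_prodMk_left (x := x))
    exact this hX
  have h1 : (Prod.mk x ⁻¹' ((fun p : ℝ × (ι → ℝ) ↦ Function.update p.2 e p.1) ⁻¹'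
      {w | w ∈ X ∧ ∀ e' ∈ K, w e ≤ w e'}))
      = {w | w ∈ {w : ι → ℝ | Function.update w e x ∈ X} ∧ ∀ e' ∈ K.erase e, x ≤ w e'} := by
    ext w
    simp only [Set.mem_preimage, Set.mem_ofPred_eq, Function.update_self, Finset.mem_erase]
    refine and_congr_right fun _ ↦ ⟨fun h e' he' ↦ ?_, fun h e' he' ↦ ?_⟩
    · simpa [Function.update_of_ne he'.1] using h e' he'.2
    · by_cases hee : e' = e
      · subst hee; simp
      · simpa [Function.update_of_ne hee] using h e' ⟨hee, he'⟩
  have h2 : {w : ι → ℝ | shiftOn (K.erase e) x w ∈ {w : ι → ℝ | Function.update w e x ∈ X}}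
      = {w | hitAt K e x w ∈ X} := by
    ext w
    simp only [Set.mem_ofPred_eq]
    have : Function.update (shiftOn (K.erase e) x w) e x = hitAt K e x w := by
      ext e'
      by_cases hee : e' = e
      · subst hee; simp [hitAt]
      · simp [hitAt, shiftOn, hee]
    rw [this]
  simp only [h1]
  -- The density `r exp(-r x)` of the coordinate `e` times the cost `exp(-r x (|K| - 1))` of all
  -- others in `K` exceeding `x` gives `r exp(-r |K| x)`.
  rw [iidExp_inter (K.erase e) hx0 hX', h2, ← mul_assoc,
    ← ENNReal.ofReal_mul (by have := hr.out; positivity), mul_assoc r, ← Real.exp_add]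
  congr 4
  rw [Finset.card_erase_of_mem he, Nat.cast_sub (Finset.card_pos.2 hK)]
  push_cast; ring

end

lemma iidExp_ae_nonneg {ι : Type*} [Fintype ι] {r : ℝ} [hr : Fact (0 < r)] :
    ∀ᵐ w ∂(iidExp ι r), ∀ e, 0 ≤ w e := by
  rw [ae_all_iff]
  intro e
  have h : ∀ᵐ x ∂(expMeasure r), 0 ≤ x := by
    rw [ae_iff]
    have : {a : ℝ | ¬ 0 ≤ a} ⊆ Set.Iic 0 := fun x hx ↦ le_of_lt (not_le.1 hx)
    refine measure_mono_null this ?_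
    rw [expMeasure_Iic hr.out]; simp
  exact (measurePreserving_eval (fun _ : ι ↦ expMeasure r) e).quasiMeasurePreserving.ae h

/-- A comparison principle: a supersolution of the first-step equation dominates its right side. -/
lemma setLIntegral_exp_mul_le {R C : ℝ} {φ φ' ψ : ℝ → ℝ} (hR : 0 ≤ R)
    (hφc : Continuous φ)
    (hd : ∀ x, 0 < x → HasDerivWithinAt φ (φ' x) (Set.Ioi x) x)
    (hle : ∀ x, 0 < x → ψ x ≤ R * φ x - φ' x) (hφ : ∀ x, 0 ≤ x → 0 ≤ φ x)
    (hψ0 : ∀ x, 0 ≤ ψ x) (hψC : ∀ x, 0 < x → ψ x ≤ C) (hψ : Measurable ψ) :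
    ∫⁻ x in Set.Ioi 0, ENNReal.ofReal (Real.exp (-(R * x)) * ψ x) ≤ ENNReal.ofReal (φ 0) := by
  have hU : Set.Ioi (0 : ℝ) = ⋃ n : ℕ, Set.Ioc 0 (n : ℝ) := by
    ext x
    simp only [Set.mem_Ioi, Set.mem_iUnion, Set.mem_Ioc]
    refine ⟨fun h ↦ ?_, fun ⟨n, h, _⟩ ↦ h⟩
    obtain ⟨n, hn⟩ := exists_nat_ge x
    exact ⟨n, h, hn⟩
  rw [hU, setLIntegral_iUnion_of_directed _ (Monotone.directed_le fun a b hab ↦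
    Set.Ioc_subset_Ioc_right (by exact_mod_cast hab))]
  refine iSup_le fun n ↦ ?_
  have hb : (0 : ℝ) ≤ n := n.cast_nonneg
  have hmeas : Measurable fun x ↦ Real.exp (-(R * x)) * ψ x := by fun_prop
  have hC : ∀ x, 0 < x → ‖Real.exp (-(R * x)) * ψ x‖ ≤ C := fun x hx ↦ by
    rw [Real.norm_of_nonneg (mul_nonneg (Real.exp_pos _).le (hψ0 x))]
    calc _ ≤ 1 * ψ x := by
          gcongr
          · exact hψ0 x
          · rw [Real.exp_le_one_iff, neg_nonpos]; positivity
      _ ≤ C := by rw [one_mul]; exact hψC x hx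
  have hint : IntegrableOn (fun x ↦ Real.exp (-(R * x)) * ψ x) (Set.Ioc 0 (n : ℝ)) := by
    refine Measure.integrableOn_of_bounded (M := C) (by simp) hmeas.aestronglyMeasurable ?_
    exact (ae_restrict_iff' measurableSet_Ioc).2 (ae_of_all _ fun x hx ↦ hC x hx.1)
  rw [← ofReal_integral_eq_lintegral_ofReal hint
    (ae_of_all _ fun x ↦ mul_nonneg (Real.exp_pos _).le (hψ0 x)),
    ← intervalIntegral.integral_of_le hb]
  refine ENNReal.ofReal_le_ofReal ?_
  have hexp : ∀ x, HasDerivAt (fun x ↦ Real.exp (-(R * x))) (-R * Real.exp (-(R * x))) x := by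
    intro x
    have := ((hasDerivAt_id x).const_mul R).neg.exp
    simpa [mul_comm] using this
  -- The function `-exp(-R x) φ x` has right derivative `exp(-R x) (R φ - φ')`, which dominates the
  -- integrand; integrating leaves `φ 0` minus a nonnegative boundary term. Right derivatives
  -- suffice, which allows the kinks of truncated exponentials.
  have hkey := intervalIntegral.integral_le_sub_of_hasDeriv_right_of_le
    (g := fun x ↦ -(Real.exp (-(R * x)) * φ x))
    (g' := fun x ↦ -(-R * Real.exp (-(R * x)) * φ x + Real.exp (-(R * x)) * φ' x))
    (φ := fun x ↦ Real.exp (-(R * x)) * ψ x) hb (by fun_prop)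
    (fun x hx ↦ ((hexp x).hasDerivWithinAt.mul (hd x hx.1)).neg)
    ((integrableOn_Icc_iff_integrableOn_Ioc (by simp)).2 hint) (fun x hx ↦ by
      have := mul_le_mul_of_nonneg_left (hle x hx.1) (Real.exp_pos (-(R * x))).le
      linarith)
  refine hkey.trans ?_
  have := mul_nonneg (Real.exp_pos (-(R * n))).le (hφ n hb)
  simp only [mul_zero, neg_zero, Real.exp_zero, one_mul]
  linarith

/-! ### Yule birth times as functions of one exponential variable. -/

/-- The law of the sum of independent exponential variables of rates `q, 2 q, …, k q`. -/
noncomputable def expSum (q : ℝ) : ℕ → Measure ℝ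
  | 0 => Measure.dirac 0
  | k + 1 => (expSum q k).conv (expMeasure ((k + 1) * q))

lemma isProbabilityMeasure_expSum {q : ℝ} (hq : 0 < q) (k : ℕ) :
    IsProbabilityMeasure (expSum q k) := by
  induction k with
  | zero => unfold expSum; infer_instance
  | succ k ih =>
    have := isProbabilityMeasure_expMeasure (r := (k + 1) * q) (by positivity)
    unfold expSum; infer_instance

/-- Unrolls a one-step inequality: `u a s` stands for the bound after `a` growth steps and elapsed
time `s`, the next step takes an exponential time of rate `(a + 1) q`, and each step may lose an
error `c`. -/
lemma le_lintegral_expSum {q : ℝ} (hq : 0 < q) {c : ℝ≥0∞} {K : ℕ} (u : ℕ → ℝ → ℝ≥0∞)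
    (hu : ∀ a, Measurable (u a))
    (hstep : ∀ a < K, ∀ s, u a s ≤ c + ∫⁻ x, u (a + 1) (s + x) ∂(expMeasure ((a + 1) * q))) :
    u 0 0 ≤ K * c + ∫⁻ s, u K s ∂(expSum q K) := by
  induction K with
  | zero => simp [expSum, lintegral_dirac' _ (hu 0)]
  | succ k ih =>
    have hk := isProbabilityMeasure_expSum hq k
    have := isProbabilityMeasure_expMeasure (r := (k + 1) * q) (by positivity)
    refine (ih fun a ha ↦ hstep a (by omega)).trans ?_
    calc (k : ℝ≥0∞) * c + ∫⁻ s, u k s ∂(expSum q k)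
        ≤ k * c + ∫⁻ s, (c + ∫⁻ x, u (k + 1) (s + x) ∂(expMeasure ((k + 1) * q)))
            ∂(expSum q k) := by
          gcongr with s; exact hstep k (by omega) s
      _ = (k + 1 : ℕ) * c + ∫⁻ s, u (k + 1) s ∂(expSum q (k + 1)) := by
          rw [lintegral_add_left measurable_const, lintegral_const, measure_univ, mul_one,
            expSum, Measure.lintegral_conv (hu _), ← add_assoc]
          push_cast; ring

/-- The spacings of the order statistics of `k` independent exponentials of rate `q` have rates `q,
…, k q`. The sum is thus distributed as their maximum, whence the `k`-th power. The proof is by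
convolution. -/
lemma expSum_Iic {q : ℝ} (hq : 0 < q) (k : ℕ) (s : ℝ) :
    expSum q k (Set.Iic s)
      = if 0 ≤ s then ENNReal.ofReal ((1 - Real.exp (-(q * s))) ^ k) else 0 := by
  induction k generalizing s with
  | zero =>
    rw [expSum, Measure.dirac_apply' _ measurableSet_Iic]
    split_ifs with h <;> simp [h]
  | succ k ih =>
    have hk := isProbabilityMeasure_expSum hq k
    have hkq : 0 < (k + 1) * q := by positivity
    have := isProbabilityMeasure_expMeasure hkq
    have h1 : expSum q (k + 1) (Set.Iic s)
        = ∫⁻ x in Set.Ioi 0, ENNReal.ofReal ((k + 1) * q * Real.exp (-((k + 1) * q * x)))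
          * expSum q k (Set.Iic (s - x)) := by
      rw [expSum, Measure.conv_comm, ← lintegral_indicator_one measurableSet_Iic,
        Measure.lintegral_conv (measurable_one.indicator measurableSet_Iic),
        lintegral_expMeasure]
      refine lintegral_congr fun x ↦ ?_
      congr 1
      rw [← lintegral_indicator_one measurableSet_Iic]
      refine lintegral_congr fun y ↦ ?_
      simp only [Set.indicator, Set.mem_Iic, Pi.one_apply]
      refine if_congr ?_ rfl rfl
      constructor <;> intro h <;> linarith
    rw [h1]
    split_ifs with hs
    · have h2 : ∫⁻ x in Set.Ioi 0, ENNReal.ofReal ((k + 1) * q * Real.exp (-((k + 1) * q * x)))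
          * expSum q k (Set.Iic (s - x))
          = ∫⁻ x in Set.Ioc 0 s, ENNReal.ofReal ((k + 1) * q * Real.exp (-((k + 1) * q * x))
            * (1 - Real.exp (-(q * (s - x)))) ^ k) := by
        rw [← Set.Ioc_union_Ioi_eq_Ioi hs, lintegral_union measurableSet_Ioi
          (Set.disjoint_left.2 fun x hx hx' ↦ (Set.mem_Ioi.1 hx').not_ge hx.2)]
        rw [setLIntegral_congr_fun (g := fun _ ↦ 0) measurableSet_Ioi (fun x hx ↦ by
          have : ¬ (0 ≤ s - x) := by have := Set.mem_Ioi.1 hx; linarith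
          simp only [ih, this, if_false, mul_zero]), lintegral_zero, add_zero]
        refine setLIntegral_congr_fun measurableSet_Ioc fun x hx ↦ ?_
        have : 0 ≤ s - x := by linarith [hx.2]
        simp only [ih, this, if_true]
        rw [← ENNReal.ofReal_mul (by positivity)]
      rw [h2, ← ofReal_integral_eq_lintegral_ofReal]
      · congr 1
        rw [← intervalIntegral.integral_of_le hs]
        -- Since `exp(-q x) - exp(-q s) = exp(-q x) (1 - exp(-q (s - x)))`, the convolution
        -- integrand is the derivative of minus the `(k + 1)`-st power of this difference.
        have hd : ∀ x ∈ Set.uIcc 0 s, HasDerivAt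
            (fun x ↦ -((Real.exp (-(q * x)) - Real.exp (-(q * s))) ^ (k + 1)))
            ((k + 1) * q * Real.exp (-((k + 1) * q * x))
              * (1 - Real.exp (-(q * (s - x)))) ^ k) x := by
          intro x _
          have h3 : HasDerivAt (fun x ↦ Real.exp (-(q * x)) - Real.exp (-(q * s)))
              (-q * Real.exp (-(q * x))) x := by
            have := (((hasDerivAt_id x).const_mul q).neg.exp).sub_const (Real.exp (-(q * s)))
            simpa [mul_comm] using this
          refine (h3.pow (k + 1)).neg.congr_deriv ?_
          have h4 : Real.exp (-(q * x)) - Real.exp (-(q * s))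
              = Real.exp (-(q * x)) * (1 - Real.exp (-(q * (s - x)))) := by
            rw [mul_sub, mul_one, ← Real.exp_add]; congr 2; ring
          have h5 : Real.exp (-((k + 1) * q * x)) = Real.exp (-(q * x)) ^ (k + 1) := by
            rw [← Real.exp_nat_mul]; congr 1; push_cast; ring
          rw [h4, mul_pow, h5]; push_cast [Nat.add_sub_cancel]; ring
        rw [intervalIntegral.integral_eq_sub_of_hasDerivAt hd
          (Continuous.intervalIntegrable (by fun_prop) _ _)]
        simp
      · exact (Continuous.integrableOn_Icc (by fun_prop)).mono_set Set.Ioc_subset_Icc_self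
      · refine (ae_restrict_iff' measurableSet_Ioc).2 (ae_of_all _ fun x hx ↦ ?_)
        have : 0 ≤ 1 - Real.exp (-(q * (s - x))) := by
          rw [sub_nonneg, Real.exp_le_one_iff, neg_nonpos]
          exact mul_nonneg hq.le (by linarith [hx.2])
        simp only [Pi.zero_apply]; positivity
    · rw [setLIntegral_congr_fun (g := fun _ ↦ 0) measurableSet_Ioi (fun x hx ↦ by
          have : ¬ (0 ≤ s - x) := by have := Set.mem_Ioi.1 hx; linarith
          simp only [ih, this, if_false, mul_zero]), lintegral_zero]

/-- The time at which a pure birth process reaches size `k + 1`, as a function of a standard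
exponential variable. -/
noncomputable def birthTime (q : ℝ) (k : ℕ) (y : ℝ) : ℝ :=
  -(1 / q) * Real.log (1 - Real.exp (-(y / k)))

lemma measurable_birthTime (q : ℝ) (k : ℕ) : Measurable (birthTime q k) := by
  unfold birthTime; fun_prop

/-- A quantile transform, decreasing in `y`. It puts the birth times for all `n` on one space of
exponential variables, so that limits can be taken pointwise in `y` by dominated convergence. -/
lemma expSum_eq_map_birthTime {q : ℝ} (hq : 0 < q) {k : ℕ} (hk : k ≠ 0) :
    expSum q k = (expMeasure 1).map (birthTime q k) := by
  have := isProbabilityMeasure_expSum hq k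
  have := isProbabilityMeasure_expMeasure one_pos
  have hk0 : (0 : ℝ) < k := by positivity
  refine Measure.ext_of_Iic _ _ fun s ↦ ?_
  rw [expSum_Iic hq, Measure.map_apply (measurable_birthTime q k) measurableSet_Iic]
  have hpos : ∀ᵐ y ∂(expMeasure 1), 0 < y := by
    rw [ae_iff]
    have : {a : ℝ | ¬ 0 < a} = Set.Iic 0 := by ext; simp
    rw [this, expMeasure_Iic one_pos]; simp
  have hy1 : ∀ y : ℝ, 0 < y → 0 < 1 - Real.exp (-(y / k)) ∧ 1 - Real.exp (-(y / k)) < 1 :=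
    fun y hy ↦ ⟨by rw [sub_pos, Real.exp_lt_one_iff, neg_lt_zero]; positivity,
      by linarith [Real.exp_pos (-(y / k))]⟩
  rcases lt_or_ge 0 s with hs | hs
  · rw [if_pos hs.le]
    have hes : 0 < 1 - Real.exp (-(q * s)) := by
      rw [sub_pos, Real.exp_lt_one_iff, neg_lt_zero]; positivity
    have h1 : (birthTime q k ⁻¹' Set.Iic s : Set ℝ)
        =ᵐ[expMeasure 1] Set.Ici (-(k * Real.log (1 - Real.exp (-(q * s))))) := by
      filter_upwards [hpos] with y hy
      obtain ⟨h2, h3⟩ := hy1 y hy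
      refine propext ?_
      change birthTime q k y ≤ s ↔ -(k * Real.log (1 - Real.exp (-(q * s)))) ≤ y
      have e1 : birthTime q k y ≤ s ↔ -(q * s) ≤ Real.log (1 - Real.exp (-(y / k))) := by
        unfold birthTime
        rw [neg_mul, one_div, neg_le, inv_mul_eq_div, le_div_iff₀ hq]
        constructor <;> intro h <;> linarith
      have e2 : -(k * Real.log (1 - Real.exp (-(q * s)))) ≤ y
          ↔ -(y / k) ≤ Real.log (1 - Real.exp (-(q * s))) := by
        rw [← neg_div, div_le_iff₀ hk0]
        constructor <;> intro h <;> linarith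
      rw [e1, e2, Real.le_log_iff_exp_le h2, Real.le_log_iff_exp_le hes]
      constructor <;> intro h <;> linarith
    rw [measure_congr h1, expMeasure_Ici one_pos, max_eq_left]
    · rw [one_mul, neg_neg, Real.exp_nat_mul, Real.exp_log hes]
    · rw [neg_nonneg]
      refine mul_nonpos_of_nonneg_of_nonpos hk0.le (Real.log_nonpos hes.le ?_)
      linarith [Real.exp_pos (-(q * s))]
  · have h0 : (if 0 ≤ s then ENNReal.ofReal ((1 - Real.exp (-(q * s))) ^ k) else 0) = 0 := by
      split_ifs with h
      · have : s = 0 := le_antisymm hs h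
        subst this; simp [hk]
      · rfl
    rw [h0]
    symm
    rw [← nonpos_iff_eq_zero]
    have : birthTime q k ⁻¹' Set.Iic s ⊆ {a | ¬ 0 < a} := by
      intro y hy hy0
      obtain ⟨h2, h3⟩ := hy1 y hy0
      have : 0 < birthTime q k y := by
        unfold birthTime
        have := Real.log_neg h2 h3
        have : 0 < 1 / q := by positivity
        nlinarith
      have h4 : birthTime q k y ≤ s := hy
      linarith
    exact (measure_mono this).trans (ae_iff.1 hpos).le

/-! ### Walk costs, and the effect of revealing the shortest boundary edge of a cluster. -/

section
variable {V : Type*}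

/-- The cost of the walk from `u` to `y` with list of interior vertices `l`, when a step from `a`
to `b` costs `f a b`. -/
def walkCost (f : V → V → ℝ) : V → List V → V → ℝ
  | u, [], y => f u y
  | u, v :: l, y => f u v + walkCost f v l y

@[simp] lemma walkCost_nil (f : V → V → ℝ) (u y : V) : walkCost f u [] y = f u y := rfl

@[simp] lemma walkCost_cons (f : V → V → ℝ) (u v y : V) (l : List V) :
    walkCost f u (v :: l) y = f u v + walkCost f v l y := rfl

lemma walkCost_concat (f : V → V → ℝ) (u v y : V) (l : List V) :
    walkCost f u (l ++ [v]) y = walkCost f u l v + f v y := by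
  induction l generalizing u with
  | nil => simp
  | cons a l ih => simp [ih, add_assoc]

lemma walkCost_reverse {f : V → V → ℝ} (hf : ∀ a b, f a b = f b a) (u y : V) (l : List V) :
    walkCost f y l.reverse u = walkCost f u l y := by
  induction l generalizing u with
  | nil => simp [hf y u]
  | cons a l ih => simp [walkCost_concat, ih, hf a u, add_comm]

lemma walkCost_nonneg {f : V → V → ℝ} (hf : ∀ a b, 0 ≤ f a b) (u y : V) (l : List V) :
    0 ≤ walkCost f u l y := by
  induction l generalizing u with
  | nil => exact hf _ _
  | cons a l ih => exact add_nonneg (hf _ _) (ih _)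

lemma walkCost_mono {f g : V → V → ℝ} (h : ∀ a b, f a b ≤ g a b) (u y : V) (l : List V) :
    walkCost f u l y ≤ walkCost g u l y := by
  induction l generalizing u with
  | nil => exact h _ _
  | cons a l ih => exact add_le_add (h _ _) (ih _)

lemma measurable_walkCost {α : Type*} [MeasurableSpace α] {f : α → V → V → ℝ}
    (hf : ∀ a b, Measurable fun x ↦ f x a b) (u y : V) (l : List V) :
    Measurable fun x ↦ walkCost (f x) u l y := by
  induction l generalizing u with
  | nil => exact hf _ _
  | cons a l ih => exact (hf _ _).add (ih _)

/-- The step costs given by the lengths of the edges. -/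
def edgeCost (w : Sym2 V → ℝ) (a b : V) : ℝ := w s(a, b)

lemma edgeCost_comm (w : Sym2 V → ℝ) (a b : V) : edgeCost w a b = edgeCost w b a := by
  rw [edgeCost, edgeCost, Sym2.eq_swap]

/-- All paths from `A` to `C` with interior vertices in `O` have length at least `t`. -/
def Separated (w : Sym2 V → ℝ) (O A C : Finset V) (t : ℝ) : Prop :=
  ∀ u ∈ A, ∀ y ∈ C, ∀ l : List V, l.Nodup → (∀ v ∈ l, v ∈ O) → t ≤ walkCost (edgeCost w) u l y

lemma Separated.symm {w : Sym2 V → ℝ} {O A C : Finset V} {t : ℝ} (h : Separated w O A C t) :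
    Separated w O C A t := by
  intro u hu y hy l hl hO
  rw [← walkCost_reverse (edgeCost_comm w)]
  exact h y hy u hu _ (List.nodup_reverse.2 hl) (by simpa using hO)

lemma Separated.anti {w : Sym2 V → ℝ} {O O' A C : Finset V} {t t' : ℝ} (h : Separated w O A C t)
    (hO : O' ⊆ O) (ht : t' ≤ t) : Separated w O' A C t' :=
  fun u hu y hy l hl hlO ↦ ht.trans (h u hu y hy l hl fun v hv ↦ hO (hlO v hv))

lemma measurable_edgeCost (a b : V) : Measurable fun w : Sym2 V → ℝ ↦ edgeCost w a b :=
  measurable_pi_apply _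

lemma measurableSet_separated [Countable V] (O A C : Finset V) (t : ℝ) :
    MeasurableSet {w : Sym2 V → ℝ | Separated w O A C t} := by
  have : {w : Sym2 V → ℝ | Separated w O A C t}
      = ⋂ u ∈ A, ⋂ y ∈ C, ⋂ (l : List V) (_ : l.Nodup) (_ : ∀ v ∈ l, v ∈ O),
        {w | t ≤ walkCost (edgeCost w) u l y} := by
    ext w; simp [Separated]
  rw [this]
  refine Finset.measurableSet_biInter _ fun u _ ↦ Finset.measurableSet_biInter _ fun y _ ↦
    MeasurableSet.iInter fun l ↦ MeasurableSet.iInter fun _ ↦ MeasurableSet.iInter fun _ ↦ ?_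
  exact measurableSet_le measurable_const (measurable_walkCost measurable_edgeCost _ _ _)

variable [DecidableEq V]

/-- The edges between `A` and `D`. -/
def crossEdges (A D : Finset V) : Finset (Sym2 V) :=
  (A ×ˢ D).image fun p ↦ s(p.1, p.2)

lemma mem_crossEdges {A D : Finset V} {a b : V} :
    s(a, b) ∈ crossEdges A D ↔ (a ∈ A ∧ b ∈ D) ∨ (b ∈ A ∧ a ∈ D) := by
  simp only [crossEdges, Finset.mem_image, Finset.mem_product, Prod.exists]
  constructor
  · rintro ⟨u, v, ⟨hu, hv⟩, h⟩
    rcases Sym2.eq_iff.1 h with ⟨rfl, rfl⟩ | ⟨rfl, rfl⟩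
    · exact Or.inl ⟨hu, hv⟩
    · exact Or.inr ⟨hu, hv⟩
  · rintro (⟨h1, h2⟩ | ⟨h1, h2⟩)
    · exact ⟨a, b, ⟨h1, h2⟩, rfl⟩
    · exact ⟨b, a, ⟨h1, h2⟩, Sym2.eq_swap⟩

lemma injOn_crossEdges {A D : Finset V} (h : Disjoint A D) :
    Set.InjOn (fun p : V × V ↦ s(p.1, p.2)) (A ×ˢ D : Finset (V × V)) := by
  rintro ⟨a, b⟩ hab ⟨a', b'⟩ hab' heq
  rw [Finset.mem_coe, Finset.mem_product] at hab hab'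
  rcases Sym2.eq_iff.1 heq with ⟨h1, h2⟩ | ⟨h1, h2⟩
  · exact Prod.ext h1 h2
  · exact absurd hab'.2 (Finset.disjoint_left.1 h (h1 ▸ hab.1))

lemma card_crossEdges {A D : Finset V} (h : Disjoint A D) :
    (crossEdges A D).card = A.card * D.card := by
  rw [crossEdges, Finset.card_image_of_injOn (injOn_crossEdges h), Finset.card_product]

lemma sum_crossEdges {M : Type*} [AddCommMonoid M] {A D : Finset V} (h : Disjoint A D)
    (g : Sym2 V → M) : ∑ e ∈ crossEdges A D, g e = ∑ b ∈ A, ∑ v ∈ D, g s(b, v) := by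
  rw [crossEdges, Finset.sum_image (injOn_crossEdges h), Finset.sum_product]

lemma hitAt_of_notMem {ι : Type*} [DecidableEq ι] {K : Finset ι} {e e' : ι} {x : ℝ} {w : ι → ℝ}
    (he : e ∈ K) (he' : e' ∉ K) : hitAt K e x w e' = w e' := by
  have : e' ≠ e := fun h ↦ he' (h ▸ he)
  simp [hitAt, Function.update_of_ne this, shiftOn, he']

lemma hitAt_of_mem {ι : Type*} [DecidableEq ι] {K : Finset ι} {e e' : ι} {x : ℝ} {w : ι → ℝ}
    (he' : e' ∈ K) (hne : e' ≠ e) : hitAt K e x w e' = x + w e' := by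
  simp [hitAt, Function.update_of_ne hne, shiftOn, he']

@[simp] lemma hitAt_self {ι : Type*} [DecidableEq ι] {K : Finset ι} {e : ι} {x : ℝ} {w : ι → ℝ} :
    hitAt K e x w e = x := by
  simp [hitAt]

lemma hitAt_le_add {ι : Type*} [DecidableEq ι] {K : Finset ι} {e e' : ι} {x : ℝ} {w : ι → ℝ}
    (hx : 0 ≤ x) (hw : ∀ e, 0 ≤ w e) : hitAt K e x w e' ≤ x + w e' := by
  by_cases h : e' = e
  · subst h; simpa using hw _
  · simp only [hitAt, Function.update_of_ne h, shiftOn]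
    split_ifs <;> linarith

lemma walkCost_hitAt {A D : Finset V} {e : Sym2 V} (he : e ∈ crossEdges A D) {x : ℝ}
    {w : Sym2 V → ℝ} {u y : V} {l : List V} (hu : u ∉ A) (hy : y ∉ A) (hl : ∀ v ∈ l, v ∉ A) :
    walkCost (edgeCost (hitAt (crossEdges A D) e x w)) u l y = walkCost (edgeCost w) u l y := by
  have hedge : ∀ a b, a ∉ A → b ∉ A →
      edgeCost (hitAt (crossEdges A D) e x w) a b = edgeCost w a b := fun a b ha hb ↦
    hitAt_of_notMem he (by rw [mem_crossEdges]; tauto)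
  induction l generalizing u with
  | nil => exact hedge _ _ hu hy
  | cons v l ih =>
    have hv := hl v (by simp)
    rw [walkCost_cons, walkCost_cons, hedge _ _ hu hv, ih hv fun z hz ↦ hl z (by simp [hz])]

lemma separated_of_hitAt_of_disjoint {A D O B C : Finset V} {e : Sym2 V}
    (he : e ∈ crossEdges A D) {x t : ℝ} {w : Sym2 V → ℝ} (hO : Disjoint A O) (hB : Disjoint A B)
    (hC : Disjoint A C) (h : Separated (hitAt (crossEdges A D) e x w) O B C t) :
    Separated w O B C t := by
  intro u hu y hy l hl hlO
  rw [← walkCost_hitAt he (x := x) (Finset.disjoint_right.1 hB hu) (Finset.disjoint_right.1 hC hy)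
    fun v hv ↦ Finset.disjoint_right.1 hO (hlO v hv)]
  exact h u hu y hy l hl hlO

/-- The interior of the walk and its end avoid `A`, so only the first edge can be a cross edge, and
passing from `w` to the hit weights lengthens it by at most `x`. -/
lemma separated_of_hitAt {A D O C : Finset V} {b v : V} (hb : b ∈ A) (hv : v ∈ D)
    {x t : ℝ} (hx : 0 ≤ x) {w : Sym2 V → ℝ} (hw : ∀ e, 0 ≤ w e) (hO : Disjoint A O)
    (hC : Disjoint A C) (h : Separated (hitAt (crossEdges A D) s(b, v) x w) O A C t) :
    Separated w O A C (t - x) := by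
  have he : s(b, v) ∈ crossEdges A D := mem_crossEdges.2 (Or.inl ⟨hb, hv⟩)
  intro u hu y hy l hl hlO
  have key := h u hu y hy l hl hlO
  rw [sub_le_iff_le_add']
  refine key.trans ?_
  cases l with
  | nil => exact hitAt_le_add hx hw
  | cons a l =>
    rw [walkCost_cons, walkCost_cons, walkCost_hitAt he
      (Finset.disjoint_right.1 hO (hlO a (by simp))) (Finset.disjoint_right.1 hC hy)
      fun z hz ↦ Finset.disjoint_right.1 hO (hlO z (by simp [hz])), ← add_assoc]
    gcongr
    exact hitAt_le_add hx hw

/-- A walk from the new vertex `v` is prolonged by the edge from `b` to `v`, of length exactly `x`;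
removing `v` from `O` keeps the prolonged list free of repetitions. -/
lemma separated_insert_of_hitAt {A D O C : Finset V} {b v : V} (hb : b ∈ A) (hv : v ∈ D)
    (hvO : v ∈ O) {x t : ℝ} (hx : 0 ≤ x) {w : Sym2 V → ℝ} (hw : ∀ e, 0 ≤ w e)
    (hO : Disjoint A O) (hC : Disjoint A C)
    (h : Separated (hitAt (crossEdges A D) s(b, v) x w) O A C t) :
    Separated w (O.erase v) (insert v A) C (t - x) := by
  have he : s(b, v) ∈ crossEdges A D := mem_crossEdges.2 (Or.inl ⟨hb, hv⟩)
  intro u hu y hy l hl hlO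
  rcases Finset.mem_insert.1 hu with rfl | hu
  · have key := h b hb y hy (u :: l)
      (List.nodup_cons.2 ⟨fun hul ↦ (Finset.mem_erase.1 (hlO u hul)).1 rfl, hl⟩)
      (by
        intro z hz
        rcases List.mem_cons.1 hz with rfl | hz
        · exact hvO
        · exact Finset.mem_of_mem_erase (hlO z hz))
    rw [walkCost_cons, walkCost_hitAt he (Finset.disjoint_right.1 hO hvO)
      (Finset.disjoint_right.1 hC hy) fun z hz ↦ Finset.disjoint_right.1 hO
        (Finset.mem_of_mem_erase (hlO z hz)), edgeCost, hitAt_self] at key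
    linarith
  · exact (separated_of_hitAt hb hv hx hw hO hC h).anti (Finset.erase_subset _ _) le_rfl u hu y hy
      l hl hlO

lemma le_of_separated_hitAt {A D O C : Finset V} {b v : V} (hb : b ∈ A) (hv : v ∈ C) {x t : ℝ}
    {w : Sym2 V → ℝ} (h : Separated (hitAt (crossEdges A D) s(b, v) x w) O A C t) : t ≤ x := by
  simpa [edgeCost] using h b hb v hv [] (by simp) (by simp)

/-- The step costs when moving inside the colour classes of `c` is free. -/
def freeCost {κ : Type*} [DecidableEq κ] (c : V → Option κ) (w : Sym2 V → ℝ) (a b : V) : ℝ :=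
  if c a = c b ∧ c a ≠ none then 0 else w s(a, b)

section
variable {κ : Type*} [DecidableEq κ]

omit [DecidableEq V] in
lemma freeCost_comm (c : V → Option κ) (w : Sym2 V → ℝ) (a b : V) :
    freeCost c w a b = freeCost c w b a := by
  unfold freeCost
  rw [Sym2.eq_swap]
  refine if_congr ?_ rfl rfl
  constructor <;> rintro ⟨h, h'⟩ <;> exact ⟨h.symm, h ▸ h'⟩

/-- There is a walk of length less than `t` from the colour class `i` to the colour class `j`. -/
def FreeNear (c : V → Option κ) (w : Sym2 V → ℝ) (i j : κ) (t : ℝ) : Prop :=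
  ∃ u y l, c u = some i ∧ c y = some j ∧ walkCost (freeCost c w) u l y < t

omit [DecidableEq V] in
lemma FreeNear.symm {c : V → Option κ} {w : Sym2 V → ℝ} {i j : κ} {t : ℝ}
    (h : FreeNear c w i j t) : FreeNear c w j i t := by
  obtain ⟨u, y, l, hu, hy, hl⟩ := h
  exact ⟨y, u, l.reverse, hy, hu, by rwa [walkCost_reverse (freeCost_comm c w)]⟩

omit [DecidableEq V] in
lemma measurable_freeCost (c : V → Option κ) (a b : V) :
    Measurable fun w : Sym2 V → ℝ ↦ freeCost c w a b := by
  unfold freeCost; split_ifs <;> fun_prop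

omit [DecidableEq V] in
lemma measurableSet_freeNear [Countable V] (c : V → Option κ) (i j : κ) (t : ℝ) :
    MeasurableSet {w : Sym2 V → ℝ | FreeNear c w i j t} := by
  have : {w : Sym2 V → ℝ | FreeNear c w i j t}
      = ⋃ (u : V) (y : V) (l : List V) (_ : c u = some i) (_ : c y = some j),
        {w | walkCost (freeCost c w) u l y < t} := by
    ext w
    simp only [FreeNear, Set.mem_ofPred_eq, Set.mem_iUnion, exists_prop]
  rw [this]
  refine MeasurableSet.iUnion fun u ↦ MeasurableSet.iUnion fun y ↦ MeasurableSet.iUnion fun l ↦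
    MeasurableSet.iUnion fun _ ↦ MeasurableSet.iUnion fun _ ↦ ?_
  exact measurableSet_lt (measurable_walkCost (measurable_freeCost c) _ _ _) measurable_const

omit [DecidableEq V] in
lemma freeCost_nonneg {c : V → Option κ} {w : Sym2 V → ℝ} (hw : ∀ e, 0 ≤ w e) (a b : V) :
    0 ≤ freeCost c w a b := by
  unfold freeCost; split_ifs
  · exact le_rfl
  · exact hw _

omit [DecidableEq V] in
lemma not_freeNear_of_nonpos {c : V → Option κ} {w : Sym2 V → ℝ} (hw : ∀ e, 0 ≤ w e) {i j : κ}
    {t : ℝ} (ht : t ≤ 0) : ¬ FreeNear c w i j t := by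
  rintro ⟨u, y, l, -, -, hl⟩
  have := walkCost_nonneg (freeCost_nonneg (c := c) hw) u y l
  linarith

omit [DecidableEq V] in
lemma FreeNear.anti_weight {c : V → Option κ} {w w' : Sym2 V → ℝ} {i j : κ} {t : ℝ}
    (h : FreeNear c w' i j t) (hw : w ≤ w') : FreeNear c w i j t := by
  obtain ⟨u, y, l, hu, hy, hl⟩ := h
  refine ⟨u, y, l, hu, hy, (walkCost_mono (fun a b ↦ ?_) _ _ _).trans_lt hl⟩
  unfold freeCost; split_ifs
  · exact le_rfl
  · exact hw _

variable [Fintype V]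

/-- The vertices of colour `i`. -/
def colourClass (c : V → Option κ) (i : κ) : Finset V := {u | c u = some i}

omit [DecidableEq V] in
@[simp] lemma mem_colourClass {c : V → Option κ} {i : κ} {u : V} :
    u ∈ colourClass c i ↔ c u = some i := by simp [colourClass]

/-- Give the colour `i` to the vertex `v` and, if it has one, to the vertices of its colour. -/
def absorb (c : V → Option κ) (i : κ) (v : V) (u : V) : Option κ :=
  if u = v ∨ (c v ≠ none ∧ c u = c v) then some i else c u

variable {c : V → Option κ} {i : κ} {b v : V} {x : ℝ} {w : Sym2 V → ℝ}

/-- Merging `v` and its colour class into the class `i` only makes more steps free, and the other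
edges under the hit weights are at least the fresh ones. In particular the revealed edge itself has
become free. -/
lemma freeCost_absorb_le (hb : c b = some i) (hv : c v ≠ some i) (hx : 0 ≤ x)
    (hw : ∀ e, 0 ≤ w e) (p q : V) :
    freeCost (absorb c i v) w p q
      ≤ freeCost c (hitAt (crossEdges (colourClass c i) (colourClass c i)ᶜ) s(b, v) x w) p q := by
  by_cases h : absorb c i v p = absorb c i v q ∧ absorb c i v p ≠ none
  · rw [freeCost, if_pos h]
    refine freeCost_nonneg (fun e ↦ ?_) _ _
    by_cases he : e = s(b, v)
    · subst he; simpa using hx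
    · simp only [hitAt, Function.update_of_ne he, shiftOn]
      split_ifs
      · exact add_nonneg hx (hw e)
      · exact hw e
  · have h' : ¬ (c p = c q ∧ c p ≠ none) := by
      rintro ⟨h1, h2⟩
      refine h ⟨?_, ?_⟩
      · unfold absorb
        by_cases hp : p = v
        · subst hp; simp [h2, h1.symm]
        · by_cases hq : q = v
          · subst hq; simp [h1 ▸ h2, h1]
          · simp [hp, hq, h1]
      · unfold absorb; split_ifs
        · simp
        · exact h2
    rw [freeCost, if_neg h, freeCost, if_neg h']
    by_cases he : s(p, q) = s(b, v)
    · exfalso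
      apply h
      have hbi : absorb c i v b = some i := by
        unfold absorb; split_ifs <;> simp [hb]
      have hvi : absorb c i v v = some i := by simp [absorb]
      rcases Sym2.eq_iff.1 he with ⟨rfl, rfl⟩ | ⟨rfl, rfl⟩ <;> simp [hbi, hvi]
    · simp only [hitAt, Function.update_of_ne he, shiftOn]
      split_ifs
      · linarith
      · exact le_rfl

lemma freeCost_absorb_add_le (hb : c b = some i) (hv : c v ≠ some i)
    (hw : ∀ e, 0 ≤ w e) {p q : V} (hp : c p = some i) (hq : c q ≠ some i) :
    freeCost (absorb c i v) w p q + x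
      ≤ freeCost c (hitAt (crossEdges (colourClass c i) (colourClass c i)ᶜ) s(b, v) x w) p q := by
  have h' : ¬ (c p = c q ∧ c p ≠ none) := by
    rintro ⟨h1, h2⟩; exact hq (h1 ▸ hp)
  have hmem : s(p, q) ∈ crossEdges (colourClass c i) (colourClass c i)ᶜ :=
    mem_crossEdges.2 (Or.inl (by simp [hp, hq]))
  rw [freeCost, freeCost, if_neg h']
  by_cases he : s(p, q) = s(b, v)
  · have hqv : q = v := by
      rcases Sym2.eq_iff.1 he with ⟨rfl, rfl⟩ | ⟨rfl, rfl⟩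
      · rfl
      · exact absurd hp hv
    have hpi : absorb c i v p = some i := by
      unfold absorb; split_ifs <;> simp [hp]
    have hvi : absorb c i v q = some i := by simp [absorb, hqv]
    rw [he, hitAt_self, if_pos (by simp [hpi, hvi])]
    simp
  · rw [hitAt_of_mem hmem he]
    split_ifs
    · linarith [hw s(p, q)]
    · linarith

/-- A walk from class `i` to a vertex outside it has a first exit step. That step crosses the
boundary, where every edge is at least `x` longer than its cost after absorption; the remaining
steps do not get cheaper. -/
lemma walkCost_absorb_add_le (hb : c b = some i) (hv : c v ≠ some i) (hx : 0 ≤ x)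
    (hw : ∀ e, 0 ≤ w e) {u y : V} (l : List V) (hu : c u = some i) (hy : c y ≠ some i) :
    walkCost (freeCost (absorb c i v) w) u l y + x
      ≤ walkCost (freeCost c
        (hitAt (crossEdges (colourClass c i) (colourClass c i)ᶜ) s(b, v) x w)) u l y := by
  induction l generalizing u with
  | nil => exact freeCost_absorb_add_le hb hv hw hu hy
  | cons a l ih =>
    rw [walkCost_cons, walkCost_cons]
    by_cases ha : c a = some i
    · linarith [ih ha, freeCost_absorb_le hb hv hx hw u a]
    · linarith [freeCost_absorb_add_le (x := x) hb hv hw hu ha,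
        walkCost_mono (freeCost_absorb_le hb hv hx hw) a y l]

omit [Fintype V] in
lemma absorb_of_eq (h : c b = some i) : absorb c i v b = some i := by
  unfold absorb; split_ifs <;> simp [h]

omit [Fintype V] in
lemma absorb_of_ne {j : κ} {y : V} (hv : c v ≠ some j) (hy : c y = some j) :
    absorb c i v y = some j := by
  unfold absorb
  rw [if_neg, hy]
  rintro (rfl | ⟨h1, h2⟩)
  · exact hv hy
  · exact hv (h2 ▸ hy)

lemma FreeNear.of_hitAt {j : κ} {t : ℝ} (hij : i ≠ j) (hb : c b = some i) (hv : c v ≠ some i)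
    (hvj : c v ≠ some j) (hx : 0 ≤ x) (hw : ∀ e, 0 ≤ w e)
    (h : FreeNear c (hitAt (crossEdges (colourClass c i) (colourClass c i)ᶜ) s(b, v) x w) i j t) :
    FreeNear (absorb c i v) w i j (t - x) := by
  obtain ⟨u, y, l, hu, hy, hl⟩ := h
  refine ⟨u, y, l, absorb_of_eq hu, absorb_of_ne hvj hy, ?_⟩
  have := walkCost_absorb_add_le hb hv hx hw l hu (y := y) (by rw [hy]; simpa using hij.symm)
  linarith

lemma FreeNear.of_hitAt_of_ne {j k : κ} {t : ℝ} (hb : c b = some i) (hv : c v ≠ some i)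
    (hvj : c v ≠ some j) (hvk : c v ≠ some k) (hx : 0 ≤ x) (hw : ∀ e, 0 ≤ w e)
    (h : FreeNear c (hitAt (crossEdges (colourClass c i) (colourClass c i)ᶜ) s(b, v) x w) j k t) :
    FreeNear (absorb c i v) w j k t := by
  obtain ⟨u, y, l, hu, hy, hl⟩ := h
  exact ⟨u, y, l, absorb_of_ne hvj hu, absorb_of_ne hvk hy,
    (walkCost_mono (freeCost_absorb_le hb hv hx hw) u y l).trans_lt hl⟩

lemma lt_of_freeNear_hitAt {j : κ} {t : ℝ} (hij : i ≠ j) (hb : c b = some i) (hv : c v ≠ some i)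
    (hx : 0 ≤ x) (hw : ∀ e, 0 ≤ w e)
    (h : FreeNear c (hitAt (crossEdges (colourClass c i) (colourClass c i)ᶜ) s(b, v) x w) i j t) :
    x < t := by
  obtain ⟨u, y, l, hu, hy, hl⟩ := h
  have := walkCost_absorb_add_le hb hv hx hw l hu (y := y) (by rw [hy]; simpa using hij.symm)
  have := walkCost_nonneg (freeCost_nonneg (c := absorb c i v) hw) u y l
  linarith

end
end

/-! ### Comparison of rates, and iteration of growth steps. -/

lemma expMeasure_eq_map_mul {a b : ℝ} (ha : 0 < a) (hb : 0 < b) :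
    expMeasure b = (expMeasure a).map (fun x ↦ a / b * x) := by
  have := isProbabilityMeasure_expMeasure ha
  have := isProbabilityMeasure_expMeasure hb
  refine Measure.ext_of_Ici _ _ fun s ↦ ?_
  rw [Measure.map_apply (by fun_prop) measurableSet_Ici]
  have : (fun x ↦ a / b * x) ⁻¹' Set.Ici s = Set.Ici (s * b / a) := by
    ext x
    simp only [Set.mem_preimage, Set.mem_Ici]
    rw [div_le_iff₀ ha, div_mul_eq_mul_div, le_div_iff₀ hb, mul_comm x a]
  rw [this, expMeasure_Ici ha, expMeasure_Ici hb]
  congr 3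
  rw [mul_max_of_nonneg _ _ ha.le, mul_max_of_nonneg _ _ hb.le]
  congr 1
  · field_simp
  · ring

lemma expMeasure_ae_nonneg {a : ℝ} (ha : 0 < a) : ∀ᵐ x ∂(expMeasure a), 0 ≤ x := by
  rw [ae_iff]
  refine measure_mono_null (t := Set.Iic 0) (fun x hx ↦ le_of_lt (not_le.1 hx)) ?_
  rw [expMeasure_Iic ha]; simp

/-- In the scaling coupling a smaller rate gives a larger variable. Hence the rates of the
exploration need only be known up to an inequality. -/
lemma lintegral_expMeasure_le_of_monotone {a b : ℝ} (hb : 0 < b) (hab : b ≤ a) {g : ℝ → ℝ≥0∞}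
    (hg : Monotone g) : ∫⁻ x, g x ∂(expMeasure a) ≤ ∫⁻ x, g x ∂(expMeasure b) := by
  have ha := hb.trans_le hab
  rw [expMeasure_eq_map_mul ha hb, lintegral_map hg.measurable (by fun_prop)]
  refine lintegral_mono_ae ?_
  filter_upwards [expMeasure_ae_nonneg ha] with x hx
  refine hg (le_mul_of_one_le_left hx ?_)
  rwa [one_le_div hb]

lemma lintegral_expMeasure_le_of_antitone {a b : ℝ} (ha : 0 < a) (hab : a ≤ b) {g : ℝ → ℝ≥0∞}
    (hg : Antitone g) : ∫⁻ x, g x ∂(expMeasure a) ≤ ∫⁻ x, g x ∂(expMeasure b) := by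
  have hb := ha.trans_le hab
  rw [expMeasure_eq_map_mul ha hb, lintegral_map hg.measurable (by fun_prop)]
  refine lintegral_mono_ae ?_
  filter_upwards [expMeasure_ae_nonneg ha] with x hx
  refine hg (mul_le_of_le_one_left hx ?_)
  rwa [div_le_one hb]

section
variable {ι : Type*} [DecidableEq ι] [Fintype ι]

/-- The minimal coordinate is uniform on `K` and independent of its value, which is exponential of
rate `r |K|`. The exceptional set `K'` is charged with its full probability `|K'| / |K|`; elsewhere
the bound `g` is averaged over the value. -/
lemma iidExp_le_card_div_add {r : ℝ} [hr : Fact (0 < r)] {K : Finset ι} (hK : K.Nonempty)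
    (K' : Finset ι) (hK' : K' ⊆ K) {X : Set (ι → ℝ)} (hX : MeasurableSet X) {g : ℝ → ℝ≥0∞}
    (hg : Measurable g)
    (h : ∀ e ∈ K \ K', ∀ x, 0 < x → iidExp ι r {w | hitAt K e x w ∈ X} ≤ g x) :
    iidExp ι r X ≤ ENNReal.ofReal (K'.card / K.card) + ∫⁻ x, g x ∂(expMeasure (r * K.card)) := by
  have hr0 := hr.out
  have hcard : (0 : ℝ) < K.card := by exact_mod_cast hK.card_pos
  have hR : 0 < r * K.card := by positivity
  have := isProbabilityMeasure_expMeasure hR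
  refine (iidExp_le_sum_hitAt hK hX).trans ?_
  rw [← Finset.sum_sdiff hK', add_comm]
  refine add_le_add ?_ ?_
  · have h1 : ∀ e ∈ K', ∫⁻ x in Set.Ioi 0, ENNReal.ofReal (r * Real.exp (-(r * K.card * x)))
        * iidExp ι r {w | hitAt K e x w ∈ X} ≤ ENNReal.ofReal (1 / K.card) := by
      intro e _
      calc _ ≤ ∫⁻ x in Set.Ioi 0, ENNReal.ofReal (1 / K.card) * (ENNReal.ofReal (r * K.card
            * Real.exp (-(r * K.card * x))) * 1) := by
            refine lintegral_mono fun x ↦ ?_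
            rw [← mul_assoc, ← ENNReal.ofReal_mul (by positivity)]
            refine mul_le_mul' (le_of_eq ?_) prob_le_one
            congr 1; field_simp
        _ = ENNReal.ofReal (1 / K.card) * ∫⁻ x, 1 ∂(expMeasure (r * K.card)) := by
            rw [lintegral_const_mul _ (by fun_prop), lintegral_expMeasure]
        _ = _ := by simp
    refine (Finset.sum_le_sum h1).trans ?_
    rw [Finset.sum_const, nsmul_eq_mul, ← ENNReal.ofReal_natCast,
      ← ENNReal.ofReal_mul (by positivity), mul_one_div]
  · have h1 : ∀ e ∈ K \ K', ∫⁻ x in Set.Ioi 0, ENNReal.ofReal (r * Real.exp (-(r * K.card * x)))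
        * iidExp ι r {w | hitAt K e x w ∈ X} ≤ ENNReal.ofReal (1 / K.card)
          * ∫⁻ x, g x ∂(expMeasure (r * K.card)) := by
      intro e he
      rw [lintegral_expMeasure, ← lintegral_const_mul _ (by fun_prop)]
      refine setLIntegral_mono' measurableSet_Ioi fun x hx ↦ ?_
      rw [← mul_assoc, ← ENNReal.ofReal_mul (by positivity)]
      refine mul_le_mul' (le_of_eq ?_) (h e he x hx)
      congr 1; field_simp
    refine (Finset.sum_le_sum h1).trans ?_
    rw [Finset.sum_const, nsmul_eq_mul, ← mul_assoc, ← ENNReal.ofReal_natCast,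
      ← ENNReal.ofReal_mul (by positivity), mul_one_div]
    refine (mul_le_mul_left (ENNReal.ofReal_le_one.2 ?_) _).trans (one_mul _).le
    rw [div_le_one hcard]
    exact_mod_cast Finset.card_le_card Finset.sdiff_subset

end

/-- The thresholds `t` reduced by the delays `s` of the end points. -/
def delayed {κ : Type*} (t : κ → κ → ℝ) (s : κ → ℝ) (k l : κ) : ℝ := t k l - s k - s l

section
variable {κ : Type*} [DecidableEq κ]

lemma delayed_single_add (t : κ → κ → ℝ) (i : κ) (s x : ℝ) :
    delayed (delayed t (Pi.single i s)) (Pi.single i x) = delayed t (Pi.single i (s + x)) := by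
  ext k l
  simp only [delayed, Pi.single_add, Pi.add_apply]; ring

omit [DecidableEq κ] in
lemma delayed_symm {t : κ → κ → ℝ} (ht : ∀ k l, t k l = t l k) (s : κ → ℝ) (k l : κ) :
    delayed t s k l = delayed t s l k := by
  simp only [delayed, ht k l]; ring

lemma delayed_single_anti (t : κ → κ → ℝ) (i : κ) {s s' : ℝ} (h : s ≤ s') :
    delayed t (Pi.single i s') ≤ delayed t (Pi.single i s) := by
  intro k l
  have h1 : (Pi.single i s : κ → ℝ) ≤ Pi.single i s' := Pi.single_le_single.2 h
  have h2 := h1 k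
  have h3 := h1 l
  simp only [delayed]; linarith

/-- Iterating a bound for the growth of one cluster over all clusters. -/
lemma le_lintegral_of_step [Fintype κ] (u : (κ → ℕ) → ℕ → (κ → κ → ℝ) → ℝ≥0∞) {K N : ℕ} {C : ℝ≥0∞}
    {T : ℝ → ℝ} (hT : Measurable T)
    (hstep : ∀ (σ : κ → ℕ) (i : κ) (N' : ℕ) (t : κ → κ → ℝ), (∀ k, σ k ≤ K + 1) → N ≤ N' →
      (∀ k l, t k l = t l k) →
      u (Function.update σ i 1) (N' + K) t
        ≤ C + ∫⁻ y, u (Function.update σ i (K + 1)) N' (delayed t (Pi.single i (T y)))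
          ∂(expMeasure 1))
    {F : (κ → κ → ℝ) → ℝ≥0∞} (hF : Measurable F)
    (huF : ∀ t, (∀ k l, t k l = t l k) → u (fun _ ↦ K + 1) N t ≤ F t)
    {t : κ → κ → ℝ} (ht : ∀ k l, t k l = t l k) :
    u (fun _ ↦ 1) (N + Fintype.card κ * K) t
      ≤ Fintype.card κ * C + ∫⁻ y, F (delayed t fun k ↦ T (y k)) ∂(iidExp κ 1) := by
  have hprob : IsProbabilityMeasure (expMeasure 1) := isProbabilityMeasure_expMeasure one_pos
  set f : (κ → ℝ) → ℝ≥0∞ := fun y ↦ F (delayed t fun k ↦ T (y k)) with hf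
  have hfm : Measurable f := by
    refine hF.comp ?_
    refine measurable_pi_lambda _ fun k ↦ measurable_pi_lambda _ fun l ↦ ?_
    unfold delayed; fun_prop
  -- `J` is the set of clusters still to be grown. The others already have size `K + 1` and delays
  -- `T (y k)`, and the marginal integral over `J` averages over the delays to come.
  have hmain : ∀ (J : Finset κ) (y : κ → ℝ),
      u (fun k ↦ if k ∈ J then 1 else K + 1) (N + J.card * K)
        (delayed t fun k ↦ if k ∈ J then 0 else T (y k))
      ≤ J.card * C + (∫⋯∫⁻_J, f ∂(fun _ ↦ expMeasure 1)) y := by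
    intro J
    induction J using Finset.induction_on with
    | empty => intro y; simpa using huF _ (delayed_symm ht _)
    | insert i J hi ih =>
      intro y
      rw [lmarginal_insert f hfm hi, Finset.card_insert_of_notMem hi]
      have h1 := hstep (fun k ↦ if k ∈ J then 1 else K + 1) i (N + J.card * K)
        (delayed t fun k ↦ if k ∈ insert i J then 0 else T (y k))
        (fun k ↦ by split_ifs <;> omega) (by omega) (delayed_symm ht _)
      have e1 : Function.update (fun k ↦ if k ∈ J then 1 else K + 1) i 1
          = fun k ↦ if k ∈ insert i J then 1 else K + 1 := by
        ext k
        by_cases hk : k = i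
        · subst hk; simp
        · simp [hk]
      have e2 : Function.update (fun k ↦ if k ∈ J then 1 else K + 1) i (K + 1)
          = fun k ↦ if k ∈ J then 1 else K + 1 := by
        ext k
        by_cases hk : k = i
        · subst hk; simp [hi]
        · simp [hk]
      have e3 : ∀ z, delayed (delayed t fun k ↦ if k ∈ insert i J then 0 else T (y k))
          (Pi.single i (T z))
          = delayed t fun k ↦ if k ∈ J then 0 else T (Function.update y i z k) := by
        intro z
        have : ∀ k, (if k ∈ insert i J then 0 else T (y k)) + (Pi.single i (T z) : κ → ℝ) k
            = if k ∈ J then 0 else T (Function.update y i z k) := by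
          intro k
          by_cases hk : k = i
          · subst hk; simp [hi]
          · simp [hk]
        ext k l
        simp only [delayed]
        linarith [this k, this l]
      rw [e1, e2] at h1
      simp only [e3] at h1
      have e4 : N + (J.card + 1) * K = N + J.card * K + K := by ring
      rw [e4]
      refine h1.trans ?_
      calc C + ∫⁻ z, u (fun k ↦ if k ∈ J then 1 else K + 1) (N + J.card * K)
            (delayed t fun k ↦ if k ∈ J then 0 else T (Function.update y i z k)) ∂(expMeasure 1)
          ≤ C + ∫⁻ z, (J.card * C
            + (∫⋯∫⁻_J, f ∂(fun _ ↦ expMeasure 1)) (Function.update y i z)) ∂(expMeasure 1) := by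
            gcongr with z; exact ih _
        _ = _ := by
            rw [lintegral_add_left measurable_const, lintegral_const, measure_univ, mul_one,
              ← add_assoc]
            push_cast; ring
  have h0 := hmain Finset.univ 0
  rw [← lintegral_eq_lmarginal_univ (μ := fun _ : κ ↦ expMeasure 1) (f := f) 0,
    Finset.card_univ] at h0
  have h1 : (delayed t fun k ↦ if k ∈ Finset.univ then 0 else T ((0 : κ → ℝ) k)) = t := by
    ext k l; simp [delayed]
  rw [h1] at h0
  simpa only [Finset.mem_univ, if_true] using h0

end

lemma le_lintegral_birthTime {q : ℝ} (hq : 0 < q) {c : ℝ≥0∞} {K : ℕ} (hK : K ≠ 0)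
    (u : ℕ → ℝ → ℝ≥0∞) (hu : ∀ a, Measurable (u a))
    (hstep : ∀ a < K, ∀ s, u a s ≤ c + ∫⁻ x, u (a + 1) (s + x) ∂(expMeasure ((a + 1) * q))) :
    u 0 0 ≤ K * c + ∫⁻ y, u K (birthTime q K y) ∂(expMeasure 1) := by
  have := le_lintegral_expSum hq u hu hstep
  rwa [expSum_eq_map_birthTime hq hK, lintegral_map (hu K) (measurable_birthTime q K)] at this

/-! ### First stage: growing every cluster from one vertex to `K + 1` vertices. -/

section
variable {V κ : Type*} [Fintype V] [DecidableEq V]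

/-- Disjoint sets `B k` with `σ k` elements, and at least `N` further vertices. -/
structure ClusterConfig (σ : κ → ℕ) (N : ℕ) (B : κ → Finset V) (O : Finset V) : Prop where
  card_eq : ∀ k, (B k).card = σ k
  disjoint : ∀ k l, k ≠ l → Disjoint (B k) (B l)
  disjoint_right : ∀ k, Disjoint (B k) O
  le_card : N ≤ O.card

variable [Fintype κ]

omit [Fintype V] in
lemma measurableSet_forall_separated [Finite V] (B : κ → Finset V) (O : Finset V)
    (t : κ → κ → ℝ) :
    MeasurableSet {w : Sym2 V → ℝ | ∀ k l, k ≠ l → Separated w O (B k) (B l) (t k l)} := by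
  have : {w : Sym2 V → ℝ | ∀ k l, k ≠ l → Separated w O (B k) (B l) (t k l)}
      = ⋂ (k : κ) (l : κ) (_ : k ≠ l), {w | Separated w O (B k) (B l) (t k l)} := by
    ext w; simp
  rw [this]
  exact MeasurableSet.iInter fun k ↦ MeasurableSet.iInter fun l ↦ MeasurableSet.iInter fun _ ↦
    measurableSet_separated _ _ _ _

variable (V) in
/-- The largest probability that clusters with given sizes are at given distances. -/
noncomputable def sepBound (r : ℝ) (σ : κ → ℕ) (N : ℕ) (t : κ → κ → ℝ) : ℝ≥0∞ :=
  ⨆ (B : κ → Finset V) (O : Finset V) (_ : ClusterConfig σ N B O),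
    iidExp (Sym2 V) r {w | ∀ k l, k ≠ l → Separated w O (B k) (B l) (t k l)}

lemma le_sepBound {r : ℝ} {σ : κ → ℕ} {N : ℕ} {t : κ → κ → ℝ} {B : κ → Finset V} {O : Finset V}
    (h : ClusterConfig σ N B O) :
    iidExp (Sym2 V) r {w | ∀ k l, k ≠ l → Separated w O (B k) (B l) (t k l)}
      ≤ sepBound V r σ N t :=
  le_iSup_of_le B (le_iSup_of_le O (le_iSup_of_le h le_rfl))

lemma sepBound_anti (r : ℝ) (σ : κ → ℕ) (N : ℕ) {t t' : κ → κ → ℝ} (h : t' ≤ t) :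
    sepBound V r σ N t ≤ sepBound V r σ N t' := by
  refine iSup_mono fun B ↦ iSup_mono fun O ↦ iSup_mono fun _ ↦ measure_mono fun w hw k l hkl ↦ ?_
  exact (hw k l hkl).anti subset_rfl (h k l)

variable [DecidableEq κ]

/-- The shortest edge from the cluster `i` to `O` has rate `r σ_i |O| ≥ σ_i q`. Its end point joins
the cluster and leaves `O`, and the thresholds involving `i` drop by `x`. Separation at lower
thresholds is likelier, so using the smaller rate only increases the bound. -/
lemma sepBound_step {r : ℝ} [hr : Fact (0 < r)] {σ : κ → ℕ} {N : ℕ} {t : κ → κ → ℝ}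
    (ht : ∀ k l, t k l = t l k) {i : κ} (hσ : σ i ≠ 0) {q : ℝ} (hq0 : 0 < q)
    (hq : q ≤ r * (N + 1 : ℕ)) :
    sepBound V r σ (N + 1) t ≤ ∫⁻ x, sepBound V r (Function.update σ i (σ i + 1)) N
      (delayed t (Pi.single i x)) ∂(expMeasure (σ i * q)) := by
  refine iSup_le fun B ↦ iSup_le fun O ↦ iSup_le fun h ↦ ?_
  set g : ℝ → ℝ≥0∞ := fun x ↦ sepBound V r (Function.update σ i (σ i + 1)) N
      (delayed t (Pi.single i x)) with hg
  have hgm : Monotone g := fun x y hxy ↦ sepBound_anti _ _ _ (delayed_single_anti t i hxy)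
  set K := crossEdges (B i) O with hK
  have hcard : K.card = σ i * O.card := by
    rw [hK, card_crossEdges (h.disjoint_right i), h.card_eq]
  have hσ' : (0 : ℝ) < σ i := by positivity
  have hne : K.Nonempty := by
    rw [← Finset.card_pos, hcard]
    exact Nat.mul_pos (Nat.pos_of_ne_zero hσ) (by have := h.le_card; omega)
  have key := iidExp_le_card_div_add (r := r) hne ∅ (Finset.empty_subset _)
    (measurableSet_forall_separated B O t) hgm.measurable (fun e he x hx ↦ by
      rw [Finset.sdiff_empty, hK, crossEdges, Finset.mem_image] at he
      obtain ⟨⟨b, v⟩, hbv, rfl⟩ := he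
      rw [Finset.mem_product] at hbv
      obtain ⟨hb, hv⟩ := hbv
      simp only at hb hv
      have hconf : ClusterConfig (Function.update σ i (σ i + 1)) N
          (Function.update B i (insert v (B i))) (O.erase v) := by
        refine ⟨fun k ↦ ?_, fun k l hkl ↦ ?_, fun k ↦ ?_, ?_⟩
        · by_cases hk : k = i
          · subst hk
            simp [Finset.card_insert_of_notMem (Finset.disjoint_right.1 (h.disjoint_right k) hv),
              h.card_eq]
          · simp [hk, h.card_eq]
        · have hvk : ∀ k, v ∉ B k := fun k ↦ Finset.disjoint_right.1 (h.disjoint_right k) hv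
          by_cases hk : k = i
          · subst hk
            simp [Function.update_of_ne hkl.symm, Finset.disjoint_insert_left, hvk,
              h.disjoint _ _ hkl]
          · by_cases hl : l = i
            · subst hl
              simp [Function.update_of_ne hk, Finset.disjoint_insert_right, hvk,
                h.disjoint _ _ hkl]
            · simp [Function.update_of_ne hk, Function.update_of_ne hl, h.disjoint _ _ hkl]
        · have := (h.disjoint_right k).mono_right (Finset.erase_subset v O)
          by_cases hk : k = i
          · subst hk
            simp [Finset.disjoint_insert_left, this]
          · simpa [Function.update_of_ne hk] using this
        · rw [Finset.card_erase_of_mem hv]; have := h.le_card; omega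
      refine le_trans (measure_mono_ae ?_) (le_sepBound hconf)
      filter_upwards [iidExp_ae_nonneg (ι := Sym2 V) (r := r)] with w hw hX k l hkl
      have hX' : ∀ k l, k ≠ l → Separated (hitAt K s(b, v) x w) O (B k) (B l) (t k l) := hX
      have he : s(b, v) ∈ crossEdges (B i) O := mem_crossEdges.2 (Or.inl ⟨hb, hv⟩)
      have hins : ∀ l, l ≠ i → Separated w (O.erase v) (insert v (B i)) (B l) (t i l - x) :=
        fun l hl ↦ separated_insert_of_hitAt hb hv hv hx.le hw (h.disjoint_right i)
          (h.disjoint _ _ hl.symm) (hX' i l hl.symm)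
      by_cases hk : k = i
      · subst hk
        simpa [Function.update_of_ne hkl.symm, delayed, Pi.single_eq_of_ne hkl.symm]
          using hins l hkl.symm
      · by_cases hl : l = i
        · subst hl
          have := (hins k hkl).symm
          rw [ht] at this
          simpa [Function.update_of_ne hk, delayed, Pi.single_eq_of_ne hk] using this
        · have := (separated_of_hitAt_of_disjoint he (h.disjoint_right i) (h.disjoint _ _ (Ne.symm hk))
            (h.disjoint _ _ (Ne.symm hl)) (hX' k l hkl)).anti (Finset.erase_subset v O) le_rfl
          simpa [Function.update_of_ne hk, Function.update_of_ne hl, delayed,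
            Pi.single_eq_of_ne hk, Pi.single_eq_of_ne hl] using this)
  refine key.trans ?_
  simp only [Finset.card_empty, Nat.cast_zero, zero_div, ENNReal.ofReal_zero, zero_add]
  refine lintegral_expMeasure_le_of_monotone (by positivity) ?_ hgm
  rw [hcard]
  push_cast
  have h1 : ((N + 1 : ℕ) : ℝ) ≤ O.card := by exact_mod_cast h.le_card
  have h2 : q ≤ r * O.card := hq.trans (by have := hr.out; gcongr)
  nlinarith

/-- Each of the `K` steps uses up one vertex of `O`, hence the reserve `N + K`; as at least `N`
vertices always remain, `q` is a valid rate per vertex throughout. -/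
lemma sepBound_le_lintegral_birthTime {r : ℝ} [hr : Fact (0 < r)] {K N : ℕ} (hK : K ≠ 0) {q : ℝ}
    (hq0 : 0 < q) (hq : q ≤ r * N) (σ : κ → ℕ) (i : κ) {t : κ → κ → ℝ}
    (ht : ∀ k l, t k l = t l k) :
    sepBound V r (Function.update σ i 1) (N + K) t
      ≤ ∫⁻ y, sepBound V r (Function.update σ i (K + 1)) N
        (delayed t (Pi.single i (birthTime q K y))) ∂(expMeasure 1) := by
  have h := le_lintegral_birthTime hq0 (c := 0) hK
    (fun a s ↦ sepBound V r (Function.update σ i (a + 1)) (N + (K - a)) (delayed t (Pi.single i s)))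
    (fun a ↦ Monotone.measurable fun x y hxy ↦ sepBound_anti _ _ _ (delayed_single_anti t i hxy))
    (fun a ha s ↦ by
      rw [zero_add, show N + (K - a) = N + (K - (a + 1)) + 1 by omega]
      have := sepBound_step (V := V) (r := r) (N := N + (K - (a + 1)))
        (σ := Function.update σ i (a + 1)) (i := i)
        (delayed_symm ht (Pi.single i s)) (by simp) hq0 (hq.trans (by
          have := hr.out
          gcongr
          omega))
      refine this.trans (le_of_eq ?_)
      simp [delayed_single_add])
  have e0 : delayed t (0 : κ → ℝ) = t := by ext k l; simp [delayed]
  simpa [e0] using h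

variable (V) in
/-- The largest probability that some clusters with given sizes are close to each other. -/
noncomputable def nearBound (r : ℝ) (σ : κ → ℕ) (t : κ → κ → ℝ) : ℝ≥0∞ :=
  ⨆ (c : V → Option κ) (_ : ∀ k, (colourClass c k).card = σ k),
    iidExp (Sym2 V) r {w | ∃ k l, k ≠ l ∧ FreeNear c w k l (t k l)}

lemma le_nearBound {r : ℝ} {σ : κ → ℕ} {t : κ → κ → ℝ} {c : V → Option κ}
    (h : ∀ k, (colourClass c k).card = σ k) :
    iidExp (Sym2 V) r {w | ∃ k l, k ≠ l ∧ FreeNear c w k l (t k l)} ≤ nearBound V r σ t :=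
  le_iSup_of_le c (le_iSup_of_le h le_rfl)

omit [DecidableEq V] [Fintype κ] in
lemma FreeNear.mono {c : V → Option κ} {w : Sym2 V → ℝ} {i j : κ} {t t' : ℝ}
    (h : FreeNear c w i j t) (ht : t ≤ t') : FreeNear c w i j t' := by
  obtain ⟨u, y, l, hu, hy, hl⟩ := h
  exact ⟨u, y, l, hu, hy, hl.trans_le ht⟩

lemma nearBound_mono (r : ℝ) (σ : κ → ℕ) {t t' : κ → κ → ℝ} (h : t ≤ t') :
    nearBound V r σ t ≤ nearBound V r σ t' := by
  refine iSup_mono fun c ↦ iSup_mono fun _ ↦ measure_mono ?_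
  rintro w ⟨k, l, hkl, hw⟩
  exact ⟨k, l, hkl, hw.mono (h k l)⟩

omit [DecidableEq V] [DecidableEq κ] in
lemma measurableSet_exists_freeNear [DecidableEq κ] (c : V → Option κ) (t : κ → κ → ℝ) :
    MeasurableSet {w : Sym2 V → ℝ | ∃ k l, k ≠ l ∧ FreeNear c w k l (t k l)} := by
  have : {w : Sym2 V → ℝ | ∃ k l, k ≠ l ∧ FreeNear c w k l (t k l)}
      = ⋃ (k : κ) (l : κ) (_ : k ≠ l), {w | FreeNear c w k l (t k l)} := by
    ext w; simp
  rw [this]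
  exact MeasurableSet.iUnion fun k ↦ MeasurableSet.iUnion fun l ↦ MeasurableSet.iUnion fun _ ↦
    measurableSet_freeNear _ _ _ _

/-- Here the rate is `r σ_i (|V| - σ_i) ≤ σ_i`, and closeness is less likely for smaller thresholds,
so rate `σ_i` is the safe choice. A step into another cluster is not followed up but paid for by its
probability. -/
lemma nearBound_step {r : ℝ} [hr : Fact (0 < r)] (hrV : r * Fintype.card V ≤ 1) {σ : κ → ℕ}
    {M : ℕ} (hM : M < Fintype.card V) (hσM : ∀ k, σ k ≤ M) {t : κ → κ → ℝ} {i : κ} (hσ : σ i ≠ 0) :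
    nearBound V r σ t ≤ ENNReal.ofReal (Fintype.card κ * M / (Fintype.card V - M))
      + ∫⁻ x, nearBound V r (Function.update σ i (σ i + 1))
        (delayed t (Pi.single i x)) ∂(expMeasure (σ i)) := by
  refine iSup_le fun c ↦ iSup_le fun h ↦ ?_
  set g : ℝ → ℝ≥0∞ := fun x ↦ nearBound V r (Function.update σ i (σ i + 1))
      (delayed t (Pi.single i x)) with hg
  have hgm : Antitone g := fun x y hxy ↦ nearBound_mono _ _ (delayed_single_anti t i hxy)
  set A := colourClass c i with hA
  -- The vertices of the other clusters, at most `|κ| M` of them. They form the exceptional set, so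
  -- that in the remaining case the new vertex is uncoloured and exactly one class grows, by one.
  set D : Finset V := Finset.univ.filter fun v ↦ c v ≠ none ∧ c v ≠ some i with hD
  have hdisj : Disjoint A Aᶜ := disjoint_compl_right
  have hDA : D ⊆ Aᶜ := by
    intro v hv
    simp only [hD, Finset.mem_filter] at hv
    simp [hA, hv.2.2]
  have hAcard : A.card = σ i := h i
  have hσ' : (0 : ℝ) < σ i := by positivity
  have hMV : (M : ℝ) < Fintype.card V := by exact_mod_cast hM
  have hAc : (Aᶜ.card : ℝ) = Fintype.card V - σ i := by
    rw [Finset.card_compl, hAcard, Nat.cast_sub ((hσM i).trans hM.le)]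
  have hσM' : (σ i : ℝ) ≤ M := by exact_mod_cast hσM i
  set K := crossEdges A Aᶜ with hK
  have hcard : (K.card : ℝ) = σ i * (Fintype.card V - σ i) := by
    rw [hK, card_crossEdges hdisj, hAcard, Nat.cast_mul, hAc]
  have hpos : (0 : ℝ) < K.card := by
    rw [hcard]; exact mul_pos hσ' (by linarith)
  have hne : K.Nonempty := by
    rw [← Finset.card_pos]; exact_mod_cast hpos
  set K' := crossEdges A D with hK'
  have hK'K : K' ⊆ K := Finset.image_subset_image (Finset.product_subset_product_right hDA)
  have hDcard : (D.card : ℝ) ≤ Fintype.card κ * M := by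
    have h1 : D ⊆ Finset.univ.biUnion fun k ↦ colourClass c k := by
      intro v hv
      simp only [hD, Finset.mem_filter] at hv
      obtain ⟨k, hk⟩ := Option.ne_none_iff_exists'.1 hv.2.1
      simp [hk]
    have h2 : D.card ≤ Fintype.card κ * M := by
      refine (Finset.card_le_card h1).trans (Finset.card_biUnion_le.trans ?_)
      refine (Finset.sum_le_card_nsmul _ _ M fun k _ ↦ (h k).trans_le (hσM k)).trans ?_
      simp
    exact_mod_cast h2
  have key := iidExp_le_card_div_add (r := r) hne K' hK'K
    (measurableSet_exists_freeNear c t) hgm.measurable (fun e he x hx ↦ by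
      rw [Finset.mem_sdiff, hK, crossEdges, Finset.mem_image] at he
      obtain ⟨⟨⟨b, v⟩, hbv, rfl⟩, he'⟩ := he
      rw [Finset.mem_product] at hbv
      obtain ⟨hb, hv⟩ := hbv
      simp only at hb hv he'
      have hb' : c b = some i := by simpa [hA] using hb
      have hvi : c v ≠ some i := by simpa [hA] using hv
      have hvn : c v = none := by
        by_contra hvn
        exact he' (mem_crossEdges.2 (Or.inl ⟨hb, by simp [hD, hvn, hvi]⟩))
      have hconf : ∀ k, (colourClass (absorb c i v) k).card
          = Function.update σ i (σ i + 1) k := by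
        intro k
        by_cases hk : k = i
        · subst hk
          have : colourClass (absorb c k v) k = insert v (colourClass c k) := by
            ext u
            by_cases hu : u = v
            · subst hu; simp [absorb]
            · simp [absorb, hvn, hu]
          rw [this, Finset.card_insert_of_notMem (by simpa using hvi), h k]
          simp
        · have : colourClass (absorb c i v) k = colourClass c k := by
            ext u
            by_cases hu : u = v
            · subst hu; simp [absorb, hvn, Ne.symm hk]
            · simp [absorb, hvn, hu]
          rw [this, h k, Function.update_of_ne hk]
      refine le_trans (measure_mono_ae ?_) (le_nearBound hconf)
      filter_upwards [iidExp_ae_nonneg (ι := Sym2 V) (r := r)] with w hw hX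
      obtain ⟨k, l, hkl, hX'⟩ := hX
      have hvk : ∀ k, c v ≠ some k := fun k ↦ by simp [hvn]
      refine ⟨k, l, hkl, ?_⟩
      by_cases hk : k = i
      · subst hk
        have := hX'.of_hitAt hkl hb' hvi (hvk l) hx.le hw
        simpa [delayed, Pi.single_eq_of_ne hkl.symm] using this
      · by_cases hl : l = i
        · subst hl
          have := (hX'.symm.of_hitAt hkl.symm hb' hvi (hvk k) hx.le hw).symm
          simpa [delayed, Pi.single_eq_of_ne hk] using this
        · have := hX'.of_hitAt_of_ne hb' hvi (hvk k) (hvk l) hx.le hw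
          simpa [delayed, Pi.single_eq_of_ne hk, Pi.single_eq_of_ne hl] using this)
  refine key.trans (add_le_add (ENNReal.ofReal_le_ofReal ?_) ?_)
  · rw [hK', card_crossEdges (hdisj.mono_right hDA), hAcard, hcard, Nat.cast_mul,
      mul_div_mul_left _ _ hσ'.ne']
    have : (0 : ℝ) < Fintype.card V - M := by linarith
    gcongr
  · refine lintegral_expMeasure_le_of_antitone (mul_pos hr.out hpos) ?_ hgm
    rw [hcard]
    have := hr.out
    nlinarith [mul_pos this hσ']

lemma nearBound_le_lintegral_birthTime {r : ℝ} [hr : Fact (0 < r)]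
    (hrV : r * Fintype.card V ≤ 1) {K : ℕ} (hK : K ≠ 0) (hKV : K + 1 < Fintype.card V)
    (σ : κ → ℕ) (hσ : ∀ k, σ k ≤ K + 1) (i : κ) (t : κ → κ → ℝ) :
    nearBound V r (Function.update σ i 1) t
      ≤ K * ENNReal.ofReal (Fintype.card κ * (K + 1 : ℕ) / (Fintype.card V - (K + 1 : ℕ)))
        + ∫⁻ y, nearBound V r (Function.update σ i (K + 1))
        (delayed t (Pi.single i (birthTime 1 K y))) ∂(expMeasure 1) := by
  have h := le_lintegral_birthTime one_pos
    (c := ENNReal.ofReal (Fintype.card κ * (K + 1 : ℕ) / (Fintype.card V - (K + 1 : ℕ)))) hK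
    (fun a s ↦ nearBound V r (Function.update σ i (a + 1)) (delayed t (Pi.single i s)))
    (fun a ↦ Antitone.measurable fun x y hxy ↦ nearBound_mono _ _ (delayed_single_anti t i hxy))
    (fun a ha s ↦ by
      have := nearBound_step (V := V) (r := r) hrV (M := K + 1) hKV
        (σ := Function.update σ i (a + 1)) (i := i) (fun k ↦ by
          by_cases hk : k = i
          · subst hk; simp; omega
          · simpa [hk] using hσ k)
        (t := delayed t (Pi.single i s)) (by simp)
      refine this.trans (le_of_eq ?_)
      simp [delayed_single_add])
  have e0 : delayed t (0 : κ → ℝ) = t := by ext k l; simp [delayed]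
  simpa [e0] using h

end

/-! ### Second stage: supersolutions, and the star event of one cluster against many. -/

lemma iidExp_le_of_supersolution {V : Type*} [Fintype V] [DecidableEq V] {r : ℝ}
    [hr : Fact (0 < r)] {A D : Finset V} (hAD : Disjoint A D) (hA : A.Nonempty) (hD : D.Nonempty)
    {X : Set (Sym2 V → ℝ)} (hX : MeasurableSet X) {bnd : V → ℝ → ℝ}
    (h : ∀ b ∈ A, ∀ v ∈ D, ∀ x, 0 < x →
      iidExp (Sym2 V) r {w | hitAt (crossEdges A D) s(b, v) x w ∈ X} ≤ ENNReal.ofReal (bnd v x))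
    (hm : ∀ v ∈ D, Measurable (bnd v)) (h0 : ∀ v x, 0 ≤ bnd v x) {C : ℝ}
    (hC : ∀ v ∈ D, ∀ x, 0 < x → bnd v x ≤ C) {φ φ' : ℝ → ℝ} (hφc : Continuous φ)
    (hd : ∀ x, 0 < x → HasDerivWithinAt φ (φ' x) (Set.Ioi x) x) (hφ : ∀ x, 0 ≤ x → 0 ≤ φ x)
    (hle : ∀ x, 0 < x →
      r * A.card * ∑ v ∈ D, bnd v x ≤ r * A.card * D.card * φ x - φ' x) :
    iidExp (Sym2 V) r X ≤ ENNReal.ofReal (φ 0) := by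
  have hr0 := hr.out
  have hcard : ((crossEdges A D).card : ℝ) = A.card * D.card := by
    rw [card_crossEdges hAD, Nat.cast_mul]
  have hne : (crossEdges A D).Nonempty := by
    rw [← Finset.card_pos, card_crossEdges hAD]
    exact Nat.mul_pos hA.card_pos hD.card_pos
  have hsum0 : ∀ x, 0 ≤ r * A.card * ∑ v ∈ D, bnd v x := fun x ↦ by
    have : 0 ≤ ∑ v ∈ D, bnd v x := Finset.sum_nonneg fun v _ ↦ h0 v x
    positivity
  -- The bound after a hit depends only on the end point `v` in `D`, so summing over the other end
  -- point gives the factor `|A|`. What remains is the first-step integral for the total rate `R = r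
  -- |A| |D|`, to which the comparison principle applies.
  calc iidExp (Sym2 V) r X
      ≤ ∑ e ∈ crossEdges A D, ∫⁻ x in Set.Ioi 0, ENNReal.ofReal (r * Real.exp (-(r *
          (crossEdges A D).card * x)))
          * iidExp (Sym2 V) r {w | hitAt (crossEdges A D) e x w ∈ X} := iidExp_le_sum_hitAt hne hX
    _ ≤ ∑ b ∈ A, ∑ v ∈ D, ∫⁻ x in Set.Ioi 0, ENNReal.ofReal
          (r * Real.exp (-(r * A.card * D.card * x)) * bnd v x) := by
        rw [sum_crossEdges hAD]
        refine Finset.sum_le_sum fun b hb ↦ Finset.sum_le_sum fun v hv ↦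
          setLIntegral_mono' measurableSet_Ioi fun x hx ↦ ?_
        rw [hcard, ENNReal.ofReal_mul (q := bnd v x) (by positivity)]
        refine mul_le_mul' (le_of_eq ?_) (h b hb v hv x hx)
        rw [← mul_assoc r]
    _ = ∫⁻ x in Set.Ioi 0, ENNReal.ofReal (Real.exp (-(r * A.card * D.card * x))
          * (r * A.card * ∑ v ∈ D, bnd v x)) := by
        rw [Finset.sum_const, ← lintegral_finsetSum' _ (fun v hv ↦ by
          have := hm v hv
          fun_prop), nsmul_eq_mul,
          ← lintegral_const_mul' _ _ (ENNReal.natCast_ne_top _)]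
        refine lintegral_congr fun x ↦ ?_
        rw [← ENNReal.ofReal_sum_of_nonneg fun v _ ↦ mul_nonneg (by positivity) (h0 v x),
          ← ENNReal.ofReal_natCast, ← ENNReal.ofReal_mul (by positivity), ← Finset.mul_sum]
        congr 1; ring
    _ ≤ ENNReal.ofReal (φ 0) := by
        refine setLIntegral_exp_mul_le (C := r * A.card * (D.card * C)) (by positivity) hφc hd ?_ hφ
          hsum0 ?_ ?_
        · intro x hx
          exact hle x hx
        · intro x hx
          have : ∑ v ∈ D, bnd v x ≤ D.card * C := by
            rw [← nsmul_eq_mul]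
            exact Finset.sum_le_card_nsmul _ _ _ fun v hv ↦ hC v hv x hx
          gcongr
        · exact (Finset.measurable_fun_sum _ fun v hv ↦ hm v hv).const_mul _

/-- The positive part of `exp (q s) - 1`. -/
noncomputable def expSub (q s : ℝ) : ℝ := max (Real.exp (q * s) - 1) 0

lemma expSub_nonneg (q s : ℝ) : 0 ≤ expSub q s := le_max_right _ _

lemma continuous_expSub (q : ℝ) : Continuous (expSub q) := by
  unfold expSub; fun_prop

lemma expSub_of_nonpos {q s : ℝ} (hq : 0 ≤ q) (hs : s ≤ 0) : expSub q s = 0 := by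
  rw [expSub, max_eq_right]
  rw [sub_nonpos, Real.exp_le_one_iff]
  exact mul_nonpos_of_nonneg_of_nonpos hq hs

lemma expSub_of_nonneg {q s : ℝ} (hq : 0 ≤ q) (hs : 0 ≤ s) :
    expSub q s = Real.exp (q * s) - 1 := by
  rw [expSub, max_eq_left]
  rw [sub_nonneg, Real.one_le_exp_iff]
  positivity

lemma expSub_mono {q : ℝ} (hq : 0 ≤ q) : Monotone (expSub q) := by
  intro a b h
  unfold expSub
  gcongr

/-- The right derivative of `x ↦ expSub q (s - x)`, up to sign. -/
noncomputable def expSubDeriv (q s : ℝ) : ℝ := if 0 < s then q * Real.exp (q * s) else 0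

lemma hasDerivWithinAt_expSub {q : ℝ} (hq : 0 ≤ q) (s x : ℝ) :
    HasDerivWithinAt (fun x ↦ expSub q (s - x)) (-expSubDeriv q (s - x)) (Set.Ioi x) x := by
  unfold expSubDeriv
  split_ifs with h
  · have h1 : HasDerivAt (fun x ↦ Real.exp (q * (s - x)) - 1)
        (-(q * Real.exp (q * (s - x)))) x := by
      have := ((((hasDerivAt_id x).const_sub s).const_mul q).exp).sub_const 1
      refine this.congr_deriv ?_
      simp; ring
    refine HasDerivAt.hasDerivWithinAt (h1.congr_of_eventuallyEq ?_)
    have : ∀ᶠ y in nhds x, 0 < s - y := by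
      have hc : ContinuousAt (fun y ↦ s - y) x := by fun_prop
      exact hc.eventually (lt_mem_nhds h)
    filter_upwards [this] with y hy
    exact expSub_of_nonneg hq hy.le
  · rw [neg_zero]
    refine (hasDerivWithinAt_const x _ (0 : ℝ)).congr (fun y hy ↦ ?_) ?_
    · exact expSub_of_nonpos hq (by have := Set.mem_Ioi.1 hy; linarith)
    · exact expSub_of_nonpos hq (by linarith)

lemma expSubDeriv_eq {q : ℝ} (hq : 0 ≤ q) (s : ℝ) :
    expSubDeriv q s = q * expSub q s + q * (if 0 < s then 1 else 0) := by
  unfold expSubDeriv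
  split_ifs with h
  · rw [expSub_of_nonneg hq h.le]; ring
  · rw [expSub_of_nonpos hq (not_lt.1 h)]; ring

section
variable {V κ : Type*} [Fintype V] [DecidableEq V] [Fintype κ] [DecidableEq κ]

lemma measurableSet_forall_mem_separated (B : κ → Finset V) (O : Finset V) (J : Finset κ)
    (t : κ → κ → ℝ) : MeasurableSet
      {w : Sym2 V → ℝ | ∀ k ∈ J, ∀ l ∈ J, k ≠ l → Separated w O (B k) (B l) (t k l)} := by
  have : {w : Sym2 V → ℝ | ∀ k ∈ J, ∀ l ∈ J, k ≠ l → Separated w O (B k) (B l) (t k l)}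
      = ⋂ k ∈ J, ⋂ l ∈ J, ⋂ (_ : k ≠ l), {w | Separated w O (B k) (B l) (t k l)} := by
    ext w; simp
  rw [this]
  exact Finset.measurableSet_biInter _ fun k _ ↦ Finset.measurableSet_biInter _ fun l _ ↦
    MeasurableSet.iInter fun _ ↦ measurableSet_separated _ _ _ _

/-- The event that the cluster `A` is at given distances from the clusters with indices in `J`,
and that these are at given distances from each other. -/
def starEvent (B : κ → Finset V) (J : Finset κ) (t : κ → κ → ℝ) (A O : Finset V) (τ : κ → ℝ) :
    Set (Sym2 V → ℝ) :=
  {w | (∀ j ∈ J, Separated w O A (B j) (τ j)) ∧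
    ∀ k ∈ J, ∀ l ∈ J, k ≠ l → Separated w O (B k) (B l) (t k l)}

lemma measurableSet_starEvent (B : κ → Finset V) (J : Finset κ) (t : κ → κ → ℝ) (A O : Finset V)
    (τ : κ → ℝ) : MeasurableSet (starEvent B J t A O τ) := by
  refine MeasurableSet.inter ?_ (measurableSet_forall_mem_separated B O J t)
  have : {w : Sym2 V → ℝ | ∀ j ∈ J, Separated w O A (B j) (τ j)}
      = ⋂ j ∈ J, {w | Separated w O A (B j) (τ j)} := by
    ext w; simp
  change MeasurableSet {w : Sym2 V → ℝ | ∀ j ∈ J, Separated w O A (B j) (τ j)}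
  rw [this]
  exact Finset.measurableSet_biInter _ fun k _ ↦ measurableSet_separated _ _ _ _

/-- The upper bound for the probability of a star event. -/
noncomputable def starBound (J : Finset κ) (z q V₀ : ℝ) (L a : ℕ) (τ : κ → ℝ) (T : ℝ) : ℝ :=
  V₀ * ((1 + z * ∑ j ∈ J, expSub q (τ j))⁻¹) ^ a + a / L * Real.exp T

lemma starBound_hasDerivWithinAt (J : Finset κ) {z q : ℝ} (hz : 0 ≤ z) (hq : 0 ≤ q) (V₀ : ℝ)
    (L a : ℕ) (τ : κ → ℝ) (T x : ℝ) :
    HasDerivWithinAt (fun x ↦ starBound J z q V₀ L a (fun j ↦ τ j - x) (T - x))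
      (V₀ * (a * ((1 + z * ∑ j ∈ J, expSub q (τ j - x))⁻¹) ^ (a + 1)
        * (z * ∑ j ∈ J, expSubDeriv q (τ j - x))) - a / L * Real.exp (T - x)) (Set.Ioi x) x := by
  unfold starBound
  set S := ∑ j ∈ J, expSub q (τ j - x) with hS
  have hS0 : 0 ≤ S := Finset.sum_nonneg fun j _ ↦ expSub_nonneg _ _
  have h1 : HasDerivWithinAt (fun x ↦ 1 + z * ∑ j ∈ J, expSub q (τ j - x))
      (z * ∑ j ∈ J, -expSubDeriv q (τ j - x)) (Set.Ioi x) x := by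
    have h := HasDerivWithinAt.fun_sum (u := J) (x := x) (s := Set.Ioi x)
      fun j _ ↦ hasDerivWithinAt_expSub hq (τ j) x
    exact (h.const_mul z).const_add 1
  have hne : 1 + z * S ≠ 0 := by positivity
  have h2 := ((h1.fun_inv (by simpa only [← hS] using hne)).fun_pow a).const_mul V₀
  have h3 : HasDerivWithinAt (fun x ↦ (a : ℝ) / L * Real.exp (T - x))
      (-(a / L * Real.exp (T - x))) (Set.Ioi x) x := by
    have := (((hasDerivAt_id x).const_sub T).exp.const_mul ((a : ℝ) / L)).hasDerivWithinAt
      (s := Set.Ioi x)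
    refine this.congr_deriv ?_
    simp
  refine (h2.add h3).congr_deriv ?_
  rw [← sub_eq_add_neg, ← hS, Finset.sum_neg_distrib]
  congr 2
  cases a with
  | zero => simp
  | succ a =>
    rw [Nat.add_sub_cancel, inv_pow, inv_pow]
    push_cast
    field_simp
    ring

lemma continuous_starBound (J : Finset κ) {z : ℝ} (hz : 0 ≤ z) (q V₀ : ℝ) (L a : ℕ)
    (τ : κ → ℝ) (T : ℝ) :
    Continuous fun x ↦ starBound J z q V₀ L a (fun j ↦ τ j - x) (T - x) := by
  unfold starBound
  have h1 : Continuous fun x ↦ 1 + z * ∑ j ∈ J, expSub q (τ j - x) := by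
    have := continuous_expSub q
    fun_prop
  have h2 : ∀ x, 1 + z * ∑ j ∈ J, expSub q (τ j - x) ≠ 0 := fun x ↦ by
    have : 0 ≤ ∑ j ∈ J, expSub q (τ j - x) := Finset.sum_nonneg fun j _ ↦ expSub_nonneg _ _
    positivity
  exact (((h1.inv₀ h2).pow a).const_mul V₀).add (by fun_prop)

lemma starBound_nonneg (J : Finset κ) {z q V₀ : ℝ} (hz : 0 ≤ z) (hV : 0 ≤ V₀) (L a : ℕ)
    (τ : κ → ℝ) (T : ℝ) : 0 ≤ starBound J z q V₀ L a τ T := by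
  unfold starBound
  have : 0 ≤ ∑ j ∈ J, expSub q (τ j) := Finset.sum_nonneg fun j _ ↦ expSub_nonneg _ _
  positivity

lemma starBound_le (J : Finset κ) {z q V₀ : ℝ} (hz : 0 ≤ z) (hV : 0 ≤ V₀) (L a : ℕ)
    (τ : κ → ℝ) {T T' : ℝ} (hT : T ≤ T') :
    starBound J z q V₀ L a τ T ≤ V₀ + a / L * Real.exp T' := by
  unfold starBound
  have : 0 ≤ ∑ j ∈ J, expSub q (τ j) := Finset.sum_nonneg fun j _ ↦ expSub_nonneg _ _
  gcongr
  refine mul_le_of_le_one_right hV (pow_le_one₀ (by positivity) (inv_le_one_of_one_le₀ ?_))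
  have : 0 ≤ z * ∑ j ∈ J, expSub q (τ j) := by positivity
  linarith

/-- The first-step inequality satisfied by `starBound`. -/
lemma starBound_step (J : Finset κ) {M n a L : ℕ} {r q V₀ : ℝ} (hr : 0 < r) (hq : 0 ≤ q)
    (hq1 : q ≤ 1) (hqn : q ≤ r * n) (hn : r * n ≤ 1) (hV : 0 ≤ V₀) (τ : κ → ℝ) (T : ℝ) {p p' n₁ : ℝ}
    (hp : p = ∑ j ∈ J, if 0 < τ j then 1 else 0) (hp' : p' = p + n₁) :
    r * a * (n * starBound J (M * r) q V₀ L (a + 1) τ T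
        + M * n₁ * starBound J (M * r) q V₀ L a τ T)
      ≤ r * a * (n + M * p') * starBound J (M * r) q V₀ L a τ T
        - (V₀ * (a * ((1 + M * r * ∑ j ∈ J, expSub q (τ j))⁻¹) ^ (a + 1)
        * (M * r * ∑ j ∈ J, expSubDeriv q (τ j))) - a / L * Real.exp T) := by
  have hS0 : 0 ≤ ∑ j ∈ J, expSub q (τ j) := Finset.sum_nonneg fun j _ ↦ expSub_nonneg _ _
  have hS' : ∑ j ∈ J, expSubDeriv q (τ j) = q * ∑ j ∈ J, expSub q (τ j) + q * p := by
    rw [hp, Finset.mul_sum, Finset.mul_sum, ← Finset.sum_add_distrib]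
    exact Finset.sum_congr rfl fun j _ ↦ expSubDeriv_eq hq _
  have hp0 : 0 ≤ p := by
    rw [hp]; exact Finset.sum_nonneg fun j _ ↦ by split_ifs <;> simp
  rw [hS']
  unfold starBound
  set S := ∑ j ∈ J, expSub q (τ j)
  set h := M * r * S with hh
  have hh0 : 0 ≤ h := by positivity
  set E := Real.exp T
  have hE : 0 < E := Real.exp_pos T
  set g := ((1 + h)⁻¹) ^ (a + 1) with hg
  have hg0 : 0 ≤ g := by positivity
  have hga : ((1 + h)⁻¹) ^ a = (1 + h) * g := by
    rw [hg, pow_succ]; field_simp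
  rw [hga, hp']
  have hMS : M * r * (q * S + q * p) = q * h + q * (M * r * p) := by rw [hh]; ring
  rw [hMS]
  push_cast
  have e1 : 0 ≤ V₀ * a * g := by positivity
  have e2 : 0 ≤ (a : ℝ) / L * E := by positivity
  -- The difference of the two sides splits into a Yule part, nonnegative because `q ≤ r n` and `q ≤
  -- 1`, and a part for `a exp(T) / L`, nonnegative because clusters grow at rate at most `r n ≤ 1`
  -- per vertex.
  have key : r * a * (n + M * (p + n₁)) * (V₀ * ((1 + h) * g) + a / L * E)
        - (V₀ * (a * g * (q * h + q * (M * r * p))) - a / L * E)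
      - r * a * (n * (V₀ * g + (a + 1) / L * E) + M * n₁ * (V₀ * ((1 + h) * g) + a / L * E))
      = V₀ * a * g * ((r * n - q) * h + (M * r * p) * (1 + h - q))
        + a / L * E * (r * a * M * p + (1 - r * n)) := by ring
  have f1 : 0 ≤ V₀ * a * g * ((r * n - q) * h + (M * r * p) * (1 + h - q)) := by
    refine mul_nonneg e1 (add_nonneg (mul_nonneg (by linarith) hh0)
      (mul_nonneg (by positivity) (by linarith)))
  have f2 : 0 ≤ a / L * E * (r * a * M * p + (1 - r * n)) :=
    mul_nonneg e2 (add_nonneg (by positivity) (by linarith))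
  linarith

lemma measurable_starBound (J : Finset κ) {z : ℝ} (hz : 0 ≤ z) (q V₀ : ℝ) (L a : ℕ)
    (τ : κ → ℝ) (T : ℝ) :
    Measurable fun x ↦ starBound J z q V₀ L a (fun j ↦ τ j - x) (T - x) :=
  (continuous_starBound J hz q V₀ L a τ T).measurable

/-- Exploring the neighbourhood of `A` bounds the probability of a star event. -/
lemma starEvent_le {r : ℝ} [hr : Fact (0 < r)] (hrV : r * Fintype.card V ≤ 1)
    {B : κ → Finset V} {J : Finset κ} {t : κ → κ → ℝ} {M N L : ℕ} (hM : ∀ j ∈ J, (B j).card = M)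
    (hB : ∀ j ∈ J, ∀ k ∈ J, j ≠ k → Disjoint (B j) (B k)) {q V₀ : ℝ} (hq0 : 0 < q) (hq1 : q ≤ 1)
    (hq : q ≤ r * N) (hL : 0 < L) (hV0 : 0 ≤ V₀)
    (hV : ∀ O : Finset V, (∀ j ∈ J, Disjoint (B j) O) → N ≤ O.card →
      iidExp (Sym2 V) r {w | ∀ k ∈ J, ∀ l ∈ J, k ≠ l → Separated w O (B k) (B l) (t k l)}
        ≤ ENNReal.ofReal V₀)
    (A O : Finset V) (hA : A.Nonempty) (hAO : Disjoint A O) (hAB : ∀ j ∈ J, Disjoint A (B j))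
    (hBO : ∀ j ∈ J, Disjoint (B j) O) (hO : N + L ≤ O.card + A.card) (τ : κ → ℝ) {T : ℝ}
    (hT0 : 0 ≤ T) (hT : ∀ j ∈ J, τ j ≤ T) :
    iidExp (Sym2 V) r (starEvent B J t A O τ)
      ≤ ENNReal.ofReal (starBound J (M * r) q V₀ L A.card τ T) := by
  have hr0 := hr.out
  have hz : 0 ≤ M * r := by positivity
  have hN : N ≠ 0 := by
    rintro rfl; simp at hq; linarith
  have hL' : (0 : ℝ) < L := by exact_mod_cast hL
  -- Outer induction: `d` bounds the growth left before `A` reaches size `L`. The sum `|O| + |A|` is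
  -- unchanged by a growth step, so while `|A| < L` more than `N` vertices of `O` are left.
  obtain ⟨d, hd⟩ : ∃ d, L ≤ A.card + d := ⟨L, by omega⟩
  induction d generalizing A O τ T with
  | zero =>
    -- Once `|A| ≥ L`, the term `|A| exp(T) / L` alone is at least `1`; it is the price of stopping
    -- the exploration at size `L`.
    refine prob_le_one.trans ?_
    rw [← ENNReal.ofReal_one]
    refine ENNReal.ofReal_le_ofReal ?_
    unfold starBound
    have h1 : 0 ≤ ∑ j ∈ J, expSub q (τ j) := Finset.sum_nonneg fun j _ ↦ expSub_nonneg _ _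
    have h2 : 0 ≤ V₀ * ((1 + M * r * ∑ j ∈ J, expSub q (τ j))⁻¹) ^ A.card := by positivity
    have h3 : (1 : ℝ) ≤ A.card / L := by
      rw [one_le_div hL']; exact_mod_cast hd
    have h4 : 1 ≤ Real.exp T := Real.one_le_exp hT0
    nlinarith
  | succ d ihd =>
    by_cases hLA : L ≤ A.card
    · exact ihd A O hA hAO hAB hBO hO τ hT0 hT (by omega)
    have hON : N + 1 ≤ O.card := by omega
    -- Inner induction on the number of targets whose threshold is still positive: hitting a target
    -- after its deadline does not enlarge `A`, but reduces this number.
    obtain ⟨n, hn⟩ : ∃ n, (J.filter fun j ↦ 0 < τ j).card ≤ n := ⟨_, le_rfl⟩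
    induction n generalizing τ T with
    | zero =>
      have hneg : ∀ j ∈ J, τ j ≤ 0 := by
        intro j hj
        by_contra hcon
        have : j ∈ J.filter fun j ↦ 0 < τ j := by simp [hj, not_le.1 hcon]
        have := Finset.card_pos.2 ⟨j, this⟩
        omega
      calc iidExp (Sym2 V) r (starEvent B J t A O τ) ≤ ENNReal.ofReal V₀ :=
            (measure_mono fun w hw ↦ hw.2).trans (hV O hBO (by omega))
        _ ≤ _ := by
            refine ENNReal.ofReal_le_ofReal ?_
            unfold starBound
            rw [Finset.sum_eq_zero fun j hj ↦ expSub_of_nonpos hq0.le (hneg j hj)]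
            simp only [mul_zero, add_zero, inv_one, one_pow, mul_one]
            have : 0 ≤ (A.card : ℝ) / L * Real.exp T := by positivity
            linarith
    | succ n ihn =>
      set Jp := J.filter fun j ↦ 0 < τ j with hJp
      have hJpJ : Jp ⊆ J := Finset.filter_subset _ _
      set D := O ∪ Jp.biUnion B with hD
      have hAD : Disjoint A D := by
        rw [hD, Finset.disjoint_union_right, Finset.disjoint_biUnion_right]
        exact ⟨hAO, fun j hj ↦ hAB j (hJpJ hj)⟩
      have hDO : Disjoint O (Jp.biUnion B) := by
        rw [Finset.disjoint_biUnion_right]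
        exact fun j hj ↦ (hBO j (hJpJ hj)).symm
      have hpd : ∀ j ∈ Jp, ∀ k ∈ Jp, j ≠ k → Disjoint (B j) (B k) :=
        fun j hj k hk hjk ↦ hB j (hJpJ hj) k (hJpJ hk) hjk
      have hO0 : O.Nonempty := by rw [← Finset.card_pos]; omega
      set a := A.card with ha
      set Y : ℕ → ℝ → ℝ := fun a x ↦ starBound J (M * r) q V₀ L a (fun j ↦ τ j - x) (T - x) with hY
      have hY0 : ∀ a x, 0 ≤ Y a x := fun a x ↦ starBound_nonneg J hz hV0 _ _ _ _
      -- If the first hit comes after `T`, only the separation among the targets is kept, with bound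
      -- `V₀`. Otherwise a vertex of `O` joins `A`, a target hit after its deadline leaves `A` as it
      -- was, and a target hit before its deadline contradicts the event.
      set bnd : V → ℝ → ℝ := fun v x ↦ if T < x then V₀ else if v ∈ O then Y (a + 1) x else
        if ∀ j ∈ Jp, v ∈ B j → τ j ≤ x then Y a x else 0 with hbnd
      have hbmeas : ∀ v ∈ D, Measurable (bnd v) := by
        intro v _
        have hYm : ∀ a, Measurable (Y a) := fun a ↦ measurable_starBound J hz q V₀ L a τ T
        refine Measurable.ite measurableSet_Ioi measurable_const ?_
        by_cases hv : v ∈ O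
        · simp only [hv, if_true]; exact hYm _
        · simp only [hv, if_false]
          refine Measurable.ite ?_ (hYm _) measurable_const
          refine Set.OrdConnected.measurableSet (Set.ordConnected_iff.2 fun x hx y hy _ z hz j hj hv ↦
            (hx j hj hv).trans hz.1)
      have key := iidExp_le_of_supersolution (r := r) hAD hA
        (hO0.mono Finset.subset_union_left) (measurableSet_starEvent B J t A O τ) (bnd := bnd) ?_ hbmeas
        (C := V₀ + (a + 1 : ℕ) / L * Real.exp T) ?_ ?_ (φ := Y a)
        (φ' := fun x ↦ V₀ * (a * ((1 + M * r * ∑ j ∈ J, expSub q (τ j - x))⁻¹) ^ (a + 1)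
          * (M * r * ∑ j ∈ J, expSubDeriv q (τ j - x))) - a / L * Real.exp (T - x))
        (continuous_starBound J hz q V₀ L a τ T)
        (fun x _ ↦ starBound_hasDerivWithinAt J hz hq0.le V₀ L a τ T x) (fun x _ ↦ hY0 a x) ?_
      · simpa [hY] using key
      · intro b hb v hv x hx
        have hstep : ∀ᵐ w ∂(iidExp (Sym2 V) r), ∀ e, 0 ≤ w e := iidExp_ae_nonneg
        have he : s(b, v) ∈ crossEdges A D := mem_crossEdges.2 (Or.inl ⟨hb, hv⟩)
        have hvA : v ∉ A := Finset.disjoint_right.1 hAD hv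
        have hrest : ∀ w, hitAt (crossEdges A D) s(b, v) x w ∈ starEvent B J t A O τ →
            ∀ k ∈ J, ∀ l ∈ J, k ≠ l → Separated w O (B k) (B l) (t k l) :=
          fun w hw k hk l hl hkl ↦ separated_of_hitAt_of_disjoint he hAO (hAB k hk) (hAB l hl)
            (hw.2 k hk l hl hkl)
        simp only [hbnd]
        split_ifs with hTx hvO hvJ
        · exact (measure_mono (hrest)).trans (hV O hBO (by omega))
        · have hcard : (insert v A).card = a + 1 := Finset.card_insert_of_notMem hvA
          have hcO : (O.erase v).card = O.card - 1 := Finset.card_erase_of_mem hvO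
          have := ihd (insert v A) (O.erase v) (Finset.insert_nonempty _ _)
            (Finset.disjoint_insert_left.2 ⟨Finset.notMem_erase _ _,
              hAO.mono_right (Finset.erase_subset _ _)⟩)
            (fun j hj ↦ Finset.disjoint_insert_left.2
              ⟨Finset.disjoint_right.1 (hBO j hj) hvO, hAB j hj⟩)
            (fun j hj ↦ (hBO j hj).mono_right (Finset.erase_subset _ _))
            (by omega) (fun j ↦ τ j - x) (T := T - x) (by linarith [not_lt.1 hTx])
            (fun j hj ↦ by linarith [hT j hj]) (by omega)
          rw [hcard] at this
          refine le_trans (measure_mono_ae ?_) this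
          filter_upwards [hstep] with w hw hX
          refine ⟨fun j hj ↦ separated_insert_of_hitAt hb hv hvO hx.le hw hAO (hAB j hj)
            (hX.1 j hj), fun k hk l hl hkl ↦ (hrest w hX k hk l hl hkl).anti
              (Finset.erase_subset _ _) le_rfl⟩
        · obtain ⟨j₀, hj₀, hvj₀⟩ : ∃ j ∈ Jp, v ∈ B j := by
            rcases Finset.mem_union.1 hv with h | h
            · exact absurd h hvO
            · simpa using h
          have := ihn (fun j ↦ τ j - x) (T := T - x) (by linarith [not_lt.1 hTx])
            (fun j hj ↦ by linarith [hT j hj]) (by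
              have hsub : (J.filter fun j ↦ 0 < τ j - x) ⊂ Jp := by
                refine Finset.ssubset_iff_of_subset (fun j hj ↦ ?_) |>.2 ⟨j₀, hj₀, ?_⟩
                · simp only [Finset.mem_filter] at hj
                  simp only [hJp, Finset.mem_filter]
                  exact ⟨hj.1, by linarith [hj.2]⟩
                · simp only [Finset.mem_filter, not_and, not_lt]
                  intro _
                  linarith [hvJ j₀ hj₀ hvj₀]
              have := Finset.card_lt_card hsub
              omega)
          refine le_trans (measure_mono_ae ?_) this
          filter_upwards [hstep] with w hw hX
          exact ⟨fun j hj ↦ separated_of_hitAt hb hv hx.le hw hAO (hAB j hj) (hX.1 j hj), hrest w hX⟩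
        · push Not at hvJ
          obtain ⟨j, hj, hvj, hlt⟩ := hvJ
          have : {w | hitAt (crossEdges A D) s(b, v) x w ∈ starEvent B J t A O τ} = ∅ := by
            rw [Set.eq_empty_iff_forall_notMem]
            intro w hw
            exact absurd (le_of_separated_hitAt hb hvj (hw.1 j (hJpJ hj))) (not_le.2 hlt)
          rw [this]; simp
      · intro v x
        simp only [hbnd]
        split_ifs
        · exact hV0
        · exact hY0 _ _
        · exact hY0 _ _
        · exact le_rfl
      · intro v hv x hx
        have hYle : ∀ a', a' ≤ a + 1 → Y a' x ≤ V₀ + (a + 1 : ℕ) / L * Real.exp T := by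
          intro a' ha'
          refine (starBound_le J hz hV0 L a' _ (T' := T) (by linarith)).trans ?_
          gcongr
        have hC0 : 0 ≤ ((a + 1 : ℕ) : ℝ) / L * Real.exp T := by positivity
        simp only [hbnd]
        split_ifs
        · linarith
        · exact hYle _ le_rfl
        · exact hYle _ (by omega)
        · linarith
      · intro x hx
        have hDcard : (D.card : ℝ) = O.card + M * Jp.card := by
          rw [hD, Finset.card_union_of_disjoint hDO, Finset.card_biUnion hpd,
            Finset.sum_congr rfl fun j hj ↦ hM j (hJpJ hj)]
          simp [mul_comm]
        -- `p` counts the targets still live at time `x`. The remaining `Jp.card - p` live targets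
        -- have passed their deadlines by then, and their vertices contribute the bound for an
        -- unchanged `A`.
        set p : ℝ := ∑ j ∈ J, if 0 < τ j - x then 1 else 0 with hp
        have hstep := starBound_step J (M := M) (n := O.card) (a := a) (L := L) hr0 hq0.le hq1
          (hq.trans (by gcongr; omega)) (le_trans (by
            gcongr; exact Finset.card_le_univ O) hrV) hV0 (fun j ↦ τ j - x) (T - x)
          (n₁ := Jp.card - p) hp rfl
        rw [hDcard, show M * (Jp.card : ℝ) = M * (p + (Jp.card - p)) by ring]
        by_cases hTx : T < x
        · have hp0 : p = 0 := Finset.sum_eq_zero fun j hj ↦ by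
            rw [if_neg]; linarith [hT j hj]
          have hd0 : ∑ j ∈ J, expSubDeriv q (τ j - x) = 0 := Finset.sum_eq_zero fun j hj ↦ by
            rw [expSubDeriv, if_neg]; linarith [hT j hj]
          have hs0 : ∑ j ∈ J, expSub q (τ j - x) = 0 := Finset.sum_eq_zero fun j hj ↦
            expSub_of_nonpos hq0.le (by linarith [hT j hj])
          have hYa : Y a x = V₀ + a / L * Real.exp (T - x) := by
            simp [hY, starBound, hs0]
          have hsum : ∑ v ∈ D, bnd v x = D.card * V₀ := by
            rw [Finset.sum_congr rfl (g := fun _ ↦ V₀) fun v _ ↦ by simp [hbnd, hTx]]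
            simp
          rw [hsum, hd0, hYa, hDcard, hp0]
          have h1 : 0 ≤ (a : ℝ) / L * Real.exp (T - x) := by positivity
          have h2 : 0 ≤ r * a * (O.card + M * Jp.card) * (a / L * Real.exp (T - x)) := by positivity
          simp only [mul_zero, zero_sub, zero_add, sub_zero]
          nlinarith
        · have hsumO : ∑ v ∈ O, bnd v x = O.card * Y (a + 1) x := by
            rw [Finset.sum_congr rfl (g := fun _ ↦ Y (a + 1) x) fun v hv ↦ by simp [hbnd, hTx, hv]]
            simp
          have hsumB : ∑ v ∈ Jp.biUnion B, bnd v x = M * (Jp.card - p) * Y a x := by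
            rw [Finset.sum_biUnion hpd]
            have : ∀ j ∈ Jp, ∑ v ∈ B j, bnd v x
                = M * (1 - if 0 < τ j - x then 1 else 0) * Y a x := by
              intro j hj
              have hval : ∀ v ∈ B j, bnd v x = (1 - if 0 < τ j - x then 1 else 0) * Y a x := by
                intro v hv
                have hvO : v ∉ O := Finset.disjoint_left.1 (hBO j (hJpJ hj)) hv
                have huniq : (∀ k ∈ Jp, v ∈ B k → τ k ≤ x) ↔ ¬ 0 < τ j - x := by
                  constructor
                  · intro h; linarith [h j hj hv]
                  · intro h k hk hvk
                    have : k = j := by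
                      by_contra hkj
                      exact Finset.disjoint_left.1 (hpd k hk j hj hkj) hvk hv
                    subst this; linarith
                simp only [hbnd, hTx, hvO, if_false, huniq]
                split_ifs <;> simp
              rw [Finset.sum_congr rfl hval, Finset.sum_const, hM j (hJpJ hj), nsmul_eq_mul,
                mul_assoc]
            rw [Finset.sum_congr rfl this, ← Finset.sum_mul, ← Finset.mul_sum,
              Finset.sum_sub_distrib]
            congr 3
            · simp
            · rw [hp, hJp, Finset.sum_filter]
              refine Finset.sum_congr rfl fun j _ ↦ ?_
              by_cases h : 0 < τ j
              · simp [h]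
              · have : ¬ 0 < τ j - x := by linarith
                simp [h, this]
          rw [hD, Finset.sum_union hDO, hsumO, hsumB]
          exact hstep

end

/-! ### Second stage: all clusters separated, and two clusters near each other. -/

section
variable {V κ : Type*} [Fintype V] [DecidableEq V] [Fintype κ]

/-- The bound for the probability that the clusters with indices in `J` are separated. -/
noncomputable def clusterBound [LinearOrder κ] (r q : ℝ) (M L : ℕ) (T : ℝ) (J : Finset κ)
    (t : κ → κ → ℝ) : ℝ :=
  ∏ k ∈ J, ((1 + M * r * ∑ j ∈ J with j < k, expSub q (t k j))⁻¹) ^ M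
    + J.card * (M / L * Real.exp T)

lemma clusterBound_nonneg [LinearOrder κ] {r : ℝ} (hr : 0 < r) (q : ℝ) (M L : ℕ) (T : ℝ)
    (J : Finset κ) (t : κ → κ → ℝ) : 0 ≤ clusterBound r q M L T J t := by
  unfold clusterBound
  refine add_nonneg (Finset.prod_nonneg fun k _ ↦ ?_) (by positivity)
  have : 0 ≤ ∑ j ∈ J with j < k, expSub q (t k j) := Finset.sum_nonneg fun j _ ↦ expSub_nonneg _ _
  positivity

/-- The largest index `k` is the centre of a star whose targets are the smaller ones; induction on
the index set supplies `V₀` for the separation among the targets. Each exploration may consume `L`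
vertices, hence the reserve `|J| L`. -/
lemma iidExp_separated_le [LinearOrder κ] {r : ℝ} [hr : Fact (0 < r)]
    (hrV : r * Fintype.card V ≤ 1) {B : κ → Finset V} {t : κ → κ → ℝ} {M N L : ℕ}
    (hM : ∀ j, (B j).card = M) (hM0 : M ≠ 0) (hB : ∀ j k, j ≠ k → Disjoint (B j) (B k)) {q : ℝ}
    (hq0 : 0 < q) (hq1 : q ≤ 1) (hq : q ≤ r * N) (hL : 0 < L) {T : ℝ} (hT0 : 0 ≤ T)
    (hT : ∀ k l, t k l ≤ T) (J : Finset κ) (O : Finset V) (hBO : ∀ j ∈ J, Disjoint (B j) O)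
    (hO : N + J.card * L ≤ O.card) :
    iidExp (Sym2 V) r {w | ∀ k ∈ J, ∀ l ∈ J, k ≠ l → Separated w O (B k) (B l) (t k l)}
      ≤ ENNReal.ofReal (clusterBound r q M L T J t) := by
  have hr0 := hr.out
  induction J using Finset.induction_on_max generalizing O with
  | empty => simp [clusterBound]
  | insert k J hk ih =>
    have hkJ : k ∉ J := fun h ↦ lt_irrefl _ (hk k h)
    have hAJ : ∀ j ∈ J, k ≠ j := fun j hj h ↦ hkJ (h ▸ hj)
    have hcard := Finset.card_insert_of_notMem hkJ
    rw [hcard] at hO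
    have key := starEvent_le (r := r) hrV (B := B) (J := J) (t := t) (M := M) (N := N + J.card * L)
      (L := L) (fun j _ ↦ hM j) (fun j _ l _ h ↦ hB j l h) hq0 hq1
      (hq.trans (by gcongr; omega)) hL (clusterBound_nonneg hr0 q M L T J t) ih
      (B k) O (by rw [← Finset.card_pos, hM]; omega) (hBO k (by simp))
      (fun j hj ↦ hB k j (hAJ j hj)) (fun j hj ↦ hBO j (by simp [hj]))
      (by linarith [add_mul J.card 1 L]) (t k) hT0 (fun j _ ↦ hT k j)
    have hsub : {w : Sym2 V → ℝ | ∀ a ∈ insert k J, ∀ b ∈ insert k J, a ≠ b →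
        Separated w O (B a) (B b) (t a b)} ⊆ starEvent B J t (B k) O (t k) := fun w hw ↦
      ⟨fun j hj ↦ hw k (by simp) j (by simp [hj]) (hAJ j hj),
        fun a ha b hb hab ↦ hw a (by simp [ha]) b (by simp [hb]) hab⟩
    refine (measure_mono hsub).trans (key.trans ?_)
    refine ENNReal.ofReal_le_ofReal ?_
    unfold starBound clusterBound
    rw [hM, Finset.prod_insert hkJ, hcard]
    have e1 : ((insert k J).filter fun j ↦ j < k) = J := by
      ext j
      simp only [Finset.mem_filter, Finset.mem_insert]
      constructor
      · rintro ⟨rfl | h, h'⟩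
        · exact absurd h' (lt_irrefl _)
        · exact h
      · exact fun h ↦ ⟨Or.inr h, hk j h⟩
    have e2 : ∀ l ∈ J, ((insert k J).filter fun j ↦ j < l) = J.filter fun j ↦ j < l := by
      intro l hl
      rw [Finset.filter_insert, if_neg (hk l hl).le.not_gt]
    have e3 : ∏ l ∈ J, ((1 + M * r * ∑ j ∈ insert k J with j < l, expSub q (t l j))⁻¹) ^ M
        = ∏ l ∈ J, ((1 + M * r * ∑ j ∈ J with j < l, expSub q (t l j))⁻¹) ^ M :=
      Finset.prod_congr rfl fun l hl ↦ by rw [e2 l hl]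
    rw [e1, e3]
    have h1 : 0 ≤ M * r * ∑ j ∈ J, expSub q (t k j) :=
      mul_nonneg (by positivity) (Finset.sum_nonneg fun j _ ↦ expSub_nonneg _ _)
    have h2 : ((1 + M * r * ∑ j ∈ J, expSub q (t k j))⁻¹) ^ M ≤ 1 :=
      pow_le_one₀ (by positivity) (inv_le_one_of_one_le₀ (by linarith))
    have h3 : 0 ≤ (J.card : ℝ) * (M / L * Real.exp T) := by positivity
    push_cast
    nlinarith

lemma card_coloured_le [DecidableEq κ] {c : V → Option κ} {i : κ} {M : ℕ}
    (h : ∀ k, k ≠ i → (colourClass c k).card ≤ M) :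
    (Finset.univ.filter fun v ↦ c v ≠ none ∧ c v ≠ some i).card ≤ Fintype.card κ * M := by
  have h1 : (Finset.univ.filter fun v ↦ c v ≠ none ∧ c v ≠ some i)
      ⊆ (Finset.univ.filter fun k ↦ k ≠ i).biUnion fun k ↦ colourClass c k := by
    intro v hv
    simp only [Finset.mem_filter] at hv
    obtain ⟨k, hk⟩ := Option.ne_none_iff_exists'.1 hv.2.1
    simp only [Finset.mem_biUnion, Finset.mem_filter, mem_colourClass]
    refine ⟨k, ⟨Finset.mem_univ _, ?_⟩, hk⟩
    rintro rfl
    exact hv.2.2 hk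
  refine (Finset.card_le_card h1).trans (Finset.card_biUnion_le.trans ?_)
  refine (Finset.sum_le_card_nsmul _ _ M fun k hk ↦ h k (Finset.mem_filter.1 hk).2).trans ?_
  rw [smul_eq_mul]
  gcongr
  exact Finset.card_le_univ _

variable [DecidableEq κ]

/-- Heuristically, the descendants of one vertex in the exploration find an edge into the class `j`
before time `t` with probability at most `z = r M (exp(q t) - 1)`, and the `a` vertices of class `i`
act independently; this gives `1 - (1 - z)^a`. The function is a supersolution of the first-step
equation. A rate `q` slightly above `1` pays for the foreign classes, of up to `M` vertices, that
are absorbed whole. -/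
lemma iidExp_freeNear_le {r : ℝ} [hr : Fact (0 < r)] (hrV : r * Fintype.card V ≤ 1) {M : ℕ}
    (hM1 : 1 ≤ M) {q : ℝ} (hq : 1 + r * (Fintype.card κ * M * M) ≤ q) {i j : κ} (hij : i ≠ j)
    (c : V → Option κ) (hc : ∀ k, k ≠ i → (colourClass c k).card ≤ M)
    (hi : (colourClass c i).Nonempty) {t : ℝ} (ht : r * M * expSub q t ≤ 1) :
    iidExp (Sym2 V) r {w | FreeNear c w i j t}
      ≤ ENNReal.ofReal (1 - (1 - r * M * expSub q t) ^ (colourClass c i).card) := by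
  have hr0 := hr.out
  have hq1 : 1 ≤ q := le_trans (by have : 0 ≤ r * (Fintype.card κ * M * M) := by positivity
                                   linarith) hq
  have hq0 : 0 ≤ q := by linarith
  obtain ⟨n, hn⟩ : ∃ n, Fintype.card V ≤ (colourClass c i).card + n := ⟨Fintype.card V, by omega⟩
  induction n generalizing c t with
  | zero =>
    have : {w : Sym2 V → ℝ | FreeNear c w i j t} = ∅ := by
      rw [Set.eq_empty_iff_forall_notMem]
      rintro w ⟨u, y, l, -, hy, -⟩
      have h1 : colourClass c i = Finset.univ :=
        Finset.eq_univ_of_card _ (le_antisymm (Finset.card_le_univ _) (by omega))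
      have : y ∈ colourClass c i := by rw [h1]; simp
      rw [mem_colourClass, hy] at this
      exact hij (by simpa using this.symm)
    rw [this]; simp
  | succ n ih =>
    rcases le_or_gt t 0 with ht0 | ht0
    · have : iidExp (Sym2 V) r {w | FreeNear c w i j t} ≤ 0 := by
        rw [nonpos_iff_eq_zero]
        refine measure_mono_null_ae ?_ measure_empty
        filter_upwards [iidExp_ae_nonneg (ι := Sym2 V) (r := r)] with w hw h
        exact not_freeNear_of_nonpos hw ht0 h
      exact this.trans bot_le
    set A := colourClass c i with hA
    rcases Finset.eq_empty_or_nonempty Aᶜ with hAe | hAne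
    · have : {w : Sym2 V → ℝ | FreeNear c w i j t} = ∅ := by
        rw [Set.eq_empty_iff_forall_notMem]
        rintro w ⟨u, y, l, -, hy, -⟩
        have : y ∈ Aᶜ := by
          simp [hA, hy, hij.symm]
        rw [hAe] at this
        simp at this
      rw [this]; simp
    set a := A.card with ha
    have ha1 : 1 ≤ a := hi.card_pos
    set z : ℝ → ℝ := fun x ↦ r * M * expSub q (t - x) with hz
    have hz0 : ∀ x, 0 ≤ z x := fun x ↦ mul_nonneg (by positivity) (expSub_nonneg _ _)
    have hz1 : ∀ x, 0 ≤ x → z x ≤ 1 := fun x hx ↦ le_trans (by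
      have := expSub_mono hq0 (show t - x ≤ t by linarith)
      simp only [hz]; gcongr) ht
    -- An upper bound for the number of vertices gained when `v` is reached: one if `v` is
    -- uncoloured, its whole class otherwise.
    set β : V → ℕ := fun v ↦ if c v = none then 1 else M with hβ
    set bnd : V → ℝ → ℝ := fun v x ↦ if 0 < x ∧ x < t then
      (if c v = some j then 1 else 1 - (1 - z x) ^ (a + β v)) else 0 with hbnd
    have hpow : ∀ x, 0 ≤ x → ∀ k : ℕ, 0 ≤ (1 - z x) ^ k ∧ (1 - z x) ^ k ≤ 1 := fun x hx k ↦
      ⟨pow_nonneg (by linarith [hz1 x hx]) _,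
        pow_le_one₀ (by linarith [hz1 x hx]) (by linarith [hz0 x])⟩
    have hzc : Continuous z := by
      have := continuous_expSub q
      fun_prop
    have key := iidExp_le_of_supersolution (r := r) (A := A) (D := Aᶜ) disjoint_compl_right hi hAne
      (measurableSet_freeNear c i j t) (bnd := bnd) ?_ ?_ ?_ (C := 1) ?_
      (φ := fun x ↦ 1 - (1 - z x) ^ a)
      (φ' := fun x ↦ -(a * (1 - z x) ^ (a - 1) * (r * M * expSubDeriv q (t - x))))
      (by fun_prop) ?_ ?_ ?_
    · simpa [hz] using key
    · intro b hb v hv x hx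
      have hb' : c b = some i := by simpa [hA] using hb
      have hv' : c v ≠ some i := by simpa [hA] using hv
      simp only [hbnd]
      split_ifs with h1 h2
      · rw [ENNReal.ofReal_one]; exact prob_le_one
      · have hcard : (colourClass (absorb c i v) i).card ≤ a + β v := by
          by_cases hvn : c v = none
          · have : colourClass (absorb c i v) i ⊆ A ∪ {v} := by
              intro u hu
              simp only [mem_colourClass, absorb] at hu
              simp only [Finset.mem_union, hA, mem_colourClass, Finset.mem_singleton]
              split_ifs at hu with h
              · simp only [hvn, ne_eq, not_true_eq_false, false_and, or_false] at h
                exact Or.inr h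
              · exact Or.inl hu
            refine (Finset.card_le_card this).trans ((Finset.card_union_le _ _).trans ?_)
            simp [hβ, hvn, ha]
          · obtain ⟨k, hk⟩ := Option.ne_none_iff_exists'.1 hvn
            have hki : k ≠ i := by rintro rfl; exact hv' hk
            have : colourClass (absorb c i v) i ⊆ A ∪ colourClass c k := by
              intro u hu
              simp only [mem_colourClass, absorb] at hu
              simp only [Finset.mem_union, hA, mem_colourClass]
              split_ifs at hu with h
              · rcases h with rfl | h
                · exact Or.inr hk
                · exact Or.inr (h.2.trans hk)
              · exact Or.inl hu
            refine (Finset.card_le_card this).trans ((Finset.card_union_le _ _).trans ?_)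
            simp only [hβ, hvn, if_false]
            have := hc k hki
            omega
        have hcard' : a + 1 ≤ (colourClass (absorb c i v) i).card := by
          have hvA : v ∉ A := by simpa [hA] using hv'
          rw [ha, ← Finset.card_insert_of_notMem hvA]
          refine Finset.card_le_card fun u hu ↦ ?_
          rcases Finset.mem_insert.1 hu with rfl | hu
          · simp [absorb]
          · rw [mem_colourClass]
            exact absorb_of_eq (by simpa [hA] using hu)
        have := ih (absorb c i v) (fun k hk ↦ by
          refine le_trans (Finset.card_le_card fun u hu ↦ ?_) (hc k hk)
          simp only [mem_colourClass, absorb] at hu ⊢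
          split_ifs at hu with h
          · exact absurd (by simpa using hu.symm) hk
          · exact hu) (by rw [← Finset.card_pos]; omega) (t := t - x) (hz1 x hx.le) (by omega)
        refine le_trans (measure_mono_ae ?_) (this.trans (ENNReal.ofReal_le_ofReal ?_))
        · filter_upwards [iidExp_ae_nonneg (ι := Sym2 V) (r := r)] with w hw h
          exact FreeNear.of_hitAt hij hb' hv' h2 hx.le hw h
        · have := pow_le_pow_of_le_one (a := 1 - z x) (by linarith [hz1 x hx.le])
            (by linarith [hz0 x]) hcard
          simp only [hz] at this ⊢
          linarith
      · rw [ENNReal.ofReal_zero, nonpos_iff_eq_zero]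
        refine measure_mono_null_ae ?_ measure_empty
        filter_upwards [iidExp_ae_nonneg (ι := Sym2 V) (r := r)] with w hw h
        exact h1 ⟨hx, lt_of_freeNear_hitAt hij hb' hv' hx.le hw h⟩
    · intro v _
      refine Measurable.ite (measurableSet_Ioo (a := (0 : ℝ)) (b := t)) ?_ measurable_const
      split_ifs
      · exact measurable_const
      · have := hzc.measurable
        fun_prop
    · intro v x
      simp only [hbnd]
      split_ifs with h1 h2
      · exact zero_le_one
      · linarith [(hpow x h1.1.le (a + β v)).2]
      · exact le_rfl
    · intro v _ x hx
      simp only [hbnd]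
      split_ifs with h1 h2
      · exact le_rfl
      · linarith [(hpow x hx.le (a + β v)).1]
      · exact zero_le_one
    · intro x _
      have h1 : HasDerivWithinAt (fun x ↦ 1 - z x) (r * M * expSubDeriv q (t - x)) (Set.Ioi x) x := by
        have := ((hasDerivWithinAt_expSub hq0 t x).const_mul (r * M)).const_sub 1
        refine this.congr_deriv ?_
        ring
      refine ((h1.fun_pow a).const_sub 1).congr_deriv ?_
      rfl
    · intro x hx
      linarith [(hpow x hx a).2]
    · intro x hx
      have hD0 : 0 ≤ expSubDeriv q (t - x) := by
        unfold expSubDeriv; split_ifs <;> positivity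
      have hp1 := (hpow x hx.le (a - 1)).1
      by_cases hxt : x < t
      · set g := (1 - z x) ^ a with hg
        have hg0 : 0 ≤ g := (hpow x hx.le a).1
        have hga : g = (1 - z x) ^ (a - 1) * (1 - z x) := by
          rw [← pow_succ, hg]; congr 1; omega
        have hgle : g ≤ (1 - z x) ^ (a - 1) := by
          rw [hga]; exact mul_le_of_le_one_right hp1 (by linarith [hz0 x])
        have hbv : ∀ v ∈ Aᶜ, bnd v x ≤ (1 - g) + g * (if c v = some j then 1 else 0)
            + g * z x * β v := by
          intro v _
          simp only [hbnd, if_pos (And.intro hx hxt)]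
          -- Bernoulli's inequality linearises the effect of absorbing `β v` vertices, so only the
          -- sum of `β` over the complement matters; times `r` it is at most `q`.
          have hb := one_add_mul_le_pow (a := -z x) (by linarith [hz1 x hx.le]) (β v)
          have h0 : 0 ≤ g * z x * β v := by have := hz0 x; positivity
          split_ifs
          · linarith
          · rw [pow_add, ← hg]
            have := mul_le_mul_of_nonneg_left hb hg0
            rw [← sub_eq_add_neg] at this
            nlinarith
        have hsumj : ∑ v ∈ Aᶜ, (if c v = some j then (1 : ℝ) else 0) ≤ M := by
          rw [← Finset.sum_filter, Finset.sum_const, nsmul_eq_mul, mul_one]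
          refine Nat.cast_le.2 (le_trans (Finset.card_le_card fun v hv ↦ ?_) (hc j hij.symm))
          rw [mem_colourClass]
          exact (Finset.mem_filter.1 hv).2
        have hsumβ : r * ∑ v ∈ Aᶜ, (β v : ℝ) ≤ q := by
          have h1 : ∑ v ∈ Aᶜ, (β v : ℝ) ≤ Fintype.card V + Fintype.card κ * M * M := by
            have h2 : ∀ v ∈ Aᶜ, (β v : ℝ) ≤ 1 + (if c v ≠ none ∧ c v ≠ some i then M else 0 : ℝ) := by
              intro v hv
              have hv' : c v ≠ some i := by simpa [hA] using hv
              simp only [hβ]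
              by_cases hvn : c v = none
              · simp [hvn]
              · simp [hvn, hv']
            refine (Finset.sum_le_sum h2).trans ?_
            rw [Finset.sum_add_distrib]
            refine add_le_add ?_ ?_
            · rw [Finset.sum_const, nsmul_eq_mul, mul_one]
              exact_mod_cast Finset.card_le_univ _
            · refine (Finset.sum_le_univ_sum_of_nonneg fun v ↦ by split_ifs <;> simp).trans ?_
              rw [← Finset.sum_filter, Finset.sum_const, nsmul_eq_mul]
              have := card_coloured_le hc
              gcongr
              exact_mod_cast this
          calc r * ∑ v ∈ Aᶜ, (β v : ℝ) ≤ r * (Fintype.card V + Fintype.card κ * M * M) := by gcongr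
            _ ≤ q := by linarith
        have hsum : ∑ v ∈ Aᶜ, bnd v x ≤ Aᶜ.card * (1 - g) + g * M
            + g * z x * ∑ v ∈ Aᶜ, (β v : ℝ) := by
          refine (Finset.sum_le_sum hbv).trans ?_
          rw [Finset.sum_add_distrib, Finset.sum_add_distrib, Finset.sum_const, nsmul_eq_mul,
            ← Finset.mul_sum, ← Finset.mul_sum]
          gcongr
        have hE : r * M * expSubDeriv q (t - x) = q * z x + q * (r * M) := by
          rw [expSubDeriv_eq hq0, if_pos (by linarith)]; simp only [hz]; ring
        rw [hE]
        have hz0x := hz0 x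
        calc r * a * ∑ v ∈ Aᶜ, bnd v x
            ≤ r * a * (Aᶜ.card * (1 - g) + g * M + g * z x * ∑ v ∈ Aᶜ, (β v : ℝ)) := by gcongr
          _ = r * a * Aᶜ.card * (1 - g)
              + a * g * (r * M + z x * (r * ∑ v ∈ Aᶜ, (β v : ℝ))) := by ring
          _ ≤ r * a * Aᶜ.card * (1 - g)
              + a * (1 - z x) ^ (a - 1) * (q * (r * M) + z x * q) := by
              have h5 : r * M ≤ q * (r * M) := le_mul_of_one_le_left (by positivity) hq1
              gcongr
          _ = _ := by ring
      · have : ∑ v ∈ Aᶜ, bnd v x = 0 := Finset.sum_eq_zero fun v _ ↦ by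
          simp only [hbnd]; rw [if_neg (fun h ↦ hxt h.2)]
        rw [this]
        have h1 : 0 ≤ r * a * Aᶜ.card * (1 - (1 - z x) ^ a) :=
          mul_nonneg (by positivity) (by linarith [(hpow x hx.le a).2])
        have h2 : 0 ≤ a * (1 - z x) ^ (a - 1) * (r * M * expSubDeriv q (t - x)) := by positivity
        simp only [mul_zero]
        linarith

end

/-! ### Harris' inequality for products of measures on the line. -/

section Harris

/-- This is `(f x - f y) (g x - g y) ≥ 0`, rearranged to avoid subtraction in `ℝ≥0∞`. -/
lemma ENNReal.mul_add_mul_le_of_monotone {f g : ℝ → ℝ≥0∞} (hf : Monotone f) (hg : Monotone g)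
    (x y : ℝ) : f x * g y + f y * g x ≤ f x * g x + f y * g y := by
  have key : ∀ a b c d : ℝ≥0∞, a ≤ b → c ≤ d → a * d + b * c ≤ a * c + b * d := by
    intro a b c d hab hcd
    obtain ⟨e, rfl⟩ := le_iff_exists_add.1 hab
    have : e * c ≤ e * d := by gcongr
    calc a * d + (a + e) * c = a * c + a * d + e * c := by ring
      _ ≤ a * c + a * d + e * d := by gcongr
      _ = a * c + (a + e) * d := by ring
  rcases le_total x y with h | h
  · exact key _ _ _ _ (hf h) (hg h)
  · have := key _ _ _ _ (hf h) (hg h)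
    rw [add_comm, add_comm (f x * g x)]
    exact this

/-- Chebyshev's argument: the pointwise inequality is integrated over two independent copies of the
variable. -/
lemma lintegral_mul_le_of_monotone (μ : Measure ℝ) [IsProbabilityMeasure μ] {f g : ℝ → ℝ≥0∞}
    (hf : Monotone f) (hg : Monotone g) :
    (∫⁻ x, f x ∂μ) * ∫⁻ x, g x ∂μ ≤ ∫⁻ x, f x * g x ∂μ := by
  have hfm := hf.measurable
  have hgm := hg.measurable
  have h : ∫⁻ x, ∫⁻ y, (f x * g y + f y * g x) ∂μ ∂μ
      ≤ ∫⁻ x, ∫⁻ y, (f x * g x + f y * g y) ∂μ ∂μ :=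
    lintegral_mono fun x ↦ lintegral_mono fun y ↦ ENNReal.mul_add_mul_le_of_monotone hf hg x y
  have e1 : ∫⁻ x, ∫⁻ y, (f x * g y + f y * g x) ∂μ ∂μ
      = 2 * ((∫⁻ x, f x ∂μ) * ∫⁻ x, g x ∂μ) := by
    have : ∀ x, ∫⁻ y, (f x * g y + f y * g x) ∂μ
        = f x * (∫⁻ y, g y ∂μ) + (∫⁻ y, f y ∂μ) * g x := fun x ↦ by
      rw [lintegral_add_left (by fun_prop), lintegral_const_mul _ hgm, lintegral_mul_const _ hfm]
    simp_rw [this]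
    rw [lintegral_add_left (by fun_prop), lintegral_const_mul _ hgm, lintegral_mul_const _ hfm]
    ring
  have e2 : ∫⁻ x, ∫⁻ y, (f x * g x + f y * g y) ∂μ ∂μ = 2 * ∫⁻ x, f x * g x ∂μ := by
    have : ∀ x, ∫⁻ y, (f x * g x + f y * g y) ∂μ = f x * g x + ∫⁻ y, f y * g y ∂μ := fun x ↦ by
      rw [lintegral_add_left (by fun_prop), lintegral_const, measure_univ, mul_one]
    simp_rw [this]
    rw [lintegral_add_left (by fun_prop), lintegral_const, measure_univ]
    ring
  rw [e1, e2] at h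
  exact (ENNReal.mul_le_mul_iff_right two_ne_zero ENNReal.ofNat_ne_top).1 h

variable {ι : Type*} [Fintype ι] [DecidableEq ι]

lemma lmarginal_monotone {μ : ι → Measure ℝ} (s : Finset ι) {f : (ι → ℝ) → ℝ≥0∞}
    (hf : Monotone f) : Monotone (∫⋯∫⁻_s, f ∂μ) := by
  intro x y hxy
  refine lintegral_mono fun z ↦ hf fun i ↦ ?_
  simp only [Function.updateFinset]
  split_ifs
  · exact le_rfl
  · exact hxy i

/-- Induction on the integrated coordinates: partial integrals of monotone functions remain
monotone, so the one-dimensional inequality applies to each new coordinate. -/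
lemma lmarginal_mul_le_of_monotone (μ : ι → Measure ℝ) [∀ i, IsProbabilityMeasure (μ i)]
    (s : Finset ι) {f g : (ι → ℝ) → ℝ≥0∞} (hf : Monotone f) (hg : Monotone g)
    (hfm : Measurable f) (hgm : Measurable g) (x : ι → ℝ) :
    (∫⋯∫⁻_s, f ∂μ) x * (∫⋯∫⁻_s, g ∂μ) x ≤ (∫⋯∫⁻_s, fun z ↦ f z * g z ∂μ) x := by
  induction s using Finset.induction_on generalizing x with
  | empty => simp
  | insert i s hi ih =>
    rw [lmarginal_insert f hfm hi, lmarginal_insert g hgm hi,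
      lmarginal_insert (fun z ↦ f z * g z) (hfm.mul hgm) hi]
    refine (lintegral_mul_le_of_monotone (μ i)
      (f := fun y ↦ (∫⋯∫⁻_s, f ∂μ) (Function.update x i y))
      (g := fun y ↦ (∫⋯∫⁻_s, g ∂μ) (Function.update x i y)) ?_ ?_).trans
      (lintegral_mono fun y ↦ ih _)
    · exact fun y z hyz ↦ lmarginal_monotone s hf (Function.update_mono hyz)
    · exact fun y z hyz ↦ lmarginal_monotone s hg (Function.update_mono hyz)

/-- **Harris' inequality**: monotone functions of independent variables are positively
correlated. -/
lemma lintegral_pi_mul_le_of_monotone (μ : ι → Measure ℝ) [∀ i, IsProbabilityMeasure (μ i)]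
    {f g : (ι → ℝ) → ℝ≥0∞} (hf : Monotone f) (hg : Monotone g)
    (hfm : Measurable f) (hgm : Measurable g) :
    (∫⁻ w, f w ∂(Measure.pi μ)) * ∫⁻ w, g w ∂(Measure.pi μ)
      ≤ ∫⁻ w, f w * g w ∂(Measure.pi μ) := by
  have := lmarginal_mul_le_of_monotone μ Finset.univ hf hg hfm hgm 0
  simpa only [lmarginal_univ] using this

lemma monotone_indicator_one {α : Type*} [Preorder α] {U : Set α} (hU : IsUpperSet U) :
    Monotone (U.indicator (1 : α → ℝ≥0∞)) := by
  intro x y hxy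
  by_cases hx : x ∈ U
  · simp [hx, hU hxy hx]
  · simp [hx]

lemma measure_pi_mul_le_inter (μ : ι → Measure ℝ) [∀ i, IsProbabilityMeasure (μ i)]
    {U U' : Set (ι → ℝ)} (hU : IsUpperSet U) (hU' : IsUpperSet U') (hm : MeasurableSet U)
    (hm' : MeasurableSet U') :
    Measure.pi μ U * Measure.pi μ U' ≤ Measure.pi μ (U ∩ U') := by
  have := lintegral_pi_mul_le_of_monotone μ (monotone_indicator_one hU)
    (monotone_indicator_one hU') (measurable_one.indicator hm) (measurable_one.indicator hm')
  rw [lintegral_indicator_one hm, lintegral_indicator_one hm'] at this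
  refine this.trans (le_of_eq ?_)
  rw [← lintegral_indicator_one (hm.inter hm'), Set.inter_indicator_one]
  rfl

lemma prod_measure_pi_le_iInter (μ : ι → Measure ℝ) [∀ i, IsProbabilityMeasure (μ i)]
    {β : Type*} (s : Finset β) {U : β → Set (ι → ℝ)} (hU : ∀ b ∈ s, IsUpperSet (U b))
    (hm : ∀ b ∈ s, MeasurableSet (U b)) :
    ∏ b ∈ s, Measure.pi μ (U b) ≤ Measure.pi μ (⋂ b ∈ s, U b) := by
  classical
  induction s using Finset.induction_on with
  | empty => simp
  | insert b s hb ih =>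
    rw [Finset.prod_insert hb, Finset.set_biInter_insert]
    refine (mul_le_mul_right (ih (fun b hb ↦ hU b (by simp [hb])) fun b hb ↦ hm b (by simp [hb]))
      _).trans (measure_pi_mul_le_inter μ (hU b (by simp)) ?_ (hm b (by simp)) ?_)
    · exact isUpperSet_iInter₂ fun b hb ↦ hU b (by simp [hb])
    · exact Finset.measurableSet_biInter _ fun b hb ↦ hm b (by simp [hb])

end Harris

/-! ### Bounds for clusters of size `M`, uniform in the configuration. -/

section
variable {V κ : Type*} [Fintype V] [DecidableEq V] [Fintype κ]

lemma isUpperSet_not_freeNear [DecidableEq κ] (c : V → Option κ) (i j : κ) (t : ℝ) :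
    IsUpperSet {w : Sym2 V → ℝ | ¬ FreeNear c w i j t} :=
  fun _ _ hw h h' ↦ h (h'.anti_weight hw)

variable [LinearOrder κ]

/-- A lower bound for the probability that clusters of size `M` are far from each other. -/
noncomputable def freeBound (r q : ℝ) (M : ℕ) (t : κ → κ → ℝ) : ℝ :=
  ∏ k, ∏ j with j < k, (max 0 (1 - r * M * expSub q (t k j))) ^ M

lemma freeBound_nonneg (r q : ℝ) (M : ℕ) (t : κ → κ → ℝ) : 0 ≤ freeBound r q M t :=
  Finset.prod_nonneg fun k _ ↦ Finset.prod_nonneg fun j _ ↦ by positivity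

/-- Not being near is an increasing event for each pair of clusters, so Harris bounds the
probability that no pair is near below by the product over pairs. The truncation at `0` makes a
factor harmless when the pair estimate is void. -/
lemma nearBound_le {r : ℝ} [hr : Fact (0 < r)] (hrV : r * Fintype.card V ≤ 1) {M : ℕ}
    (hM1 : 1 ≤ M) {q : ℝ} (hq : 1 + r * (Fintype.card κ * M * M) ≤ q) {t : κ → κ → ℝ}
    (ht : ∀ k l, t k l = t l k) :
    nearBound V r (fun _ ↦ M) t ≤ ENNReal.ofReal (1 - freeBound r q M t) := by
  refine iSup₂_le fun c hc ↦ ?_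
  set U : κ × κ → Set (Sym2 V → ℝ) := fun p ↦ {w | ¬ FreeNear c w p.1 p.2 (t p.1 p.2)} with hU
  have hUm : ∀ p, MeasurableSet (U p) := fun p ↦ (measurableSet_freeNear c p.1 p.2 _).compl
  set s : Finset (κ × κ) := Finset.univ.filter fun p ↦ p.2 < p.1 with hs
  have hpair : ∀ k j, j < k → ENNReal.ofReal ((max 0 (1 - r * M * expSub q (t k j))) ^ M)
      ≤ iidExp (Sym2 V) r (U (k, j)) := by
    intro k j hjk
    rcases le_or_gt (r * M * expSub q (t k j)) 1 with h | h
    · have h1 := iidExp_freeNear_le (r := r) hrV hM1 hq hjk.ne' c (fun k _ ↦ (hc k).le)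
        (by rw [← Finset.card_pos, hc]; exact hM1) h
      rw [hc] at h1
      have h2 : U (k, j) = {w | FreeNear c w k j (t k j)}ᶜ := rfl
      have h0 : 0 ≤ r * M * expSub q (t k j) :=
        mul_nonneg (by have := hr.out; positivity) (expSub_nonneg _ _)
      rw [h2, prob_compl_eq_one_sub (measurableSet_freeNear c k j _), max_eq_right (by linarith)]
      refine le_trans (le_of_eq ?_) (tsub_le_tsub_left h1 1)
      rw [← ENNReal.ofReal_one, ← ENNReal.ofReal_sub _ (by
        linarith [pow_le_one₀ (n := M) (a := 1 - r * M * expSub q (t k j)) (by linarith)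
          (by linarith)])]
      congr 1; ring
    · rw [max_eq_left (by linarith), zero_pow (by omega)]
      simp
  have h1 := prod_measure_pi_le_iInter (fun _ : Sym2 V ↦ expMeasure r) s (U := U)
    (fun p _ ↦ isUpperSet_not_freeNear c _ _ _) fun p _ ↦ hUm p
  have h2 : {w : Sym2 V → ℝ | ∃ k l, k ≠ l ∧ FreeNear c w k l (t k l)} = (⋂ p ∈ s, U p)ᶜ := by
    ext w
    simp only [Set.mem_ofPred_eq, Set.mem_compl_iff, Set.mem_iInter, hs, Finset.mem_filter,
      Finset.mem_univ, true_and, hU, not_forall, not_not, Prod.exists, exists_prop]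
    constructor
    · rintro ⟨k, l, hkl, h⟩
      rcases lt_or_gt_of_ne hkl with h' | h'
      · exact ⟨l, k, h', by rw [ht]; exact h.symm⟩
      · exact ⟨k, l, h', h⟩
    · rintro ⟨k, l, hkl, h⟩
      exact ⟨k, l, hkl.ne', h⟩
  have h3 : ENNReal.ofReal (freeBound r q M t) ≤ iidExp (Sym2 V) r (⋂ p ∈ s, U p) := by
    refine le_trans ?_ h1
    have : freeBound r q M t = ∏ p ∈ s, (max 0 (1 - r * M * expSub q (t p.1 p.2))) ^ M := by
      rw [freeBound, hs, Finset.prod_filter, ← Finset.univ_product_univ, Finset.prod_product]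
      exact Finset.prod_congr rfl fun k _ ↦ Finset.prod_filter _ _
    rw [this, ENNReal.ofReal_prod_of_nonneg fun p _ ↦ by positivity]
    exact Finset.prod_le_prod' fun p hp ↦ hpair p.1 p.2 (by simpa [hs] using hp)
  rw [h2, prob_compl_eq_one_sub (Finset.measurableSet_biInter _ fun p _ ↦ hUm p)]
  refine (tsub_le_tsub_left h3 1).trans (le_of_eq ?_)
  rw [ENNReal.ofReal_sub _ (freeBound_nonneg r q M t), ENNReal.ofReal_one]

lemma sepBound_le {r : ℝ} [hr : Fact (0 < r)] (hrV : r * Fintype.card V ≤ 1) {t : κ → κ → ℝ}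
    {M N L : ℕ} (hM0 : M ≠ 0) {q : ℝ} (hq0 : 0 < q) (hq1 : q ≤ 1) (hq : q ≤ r * N) (hL : 0 < L)
    {T : ℝ} (hT0 : 0 ≤ T) (hT : ∀ k l, t k l ≤ T) :
    sepBound V r (fun _ ↦ M) (N + Fintype.card κ * L) t
      ≤ ENNReal.ofReal (clusterBound r q M L T Finset.univ t) := by
  refine iSup₂_le fun B O ↦ iSup_le fun h ↦ ?_
  refine le_trans (measure_mono fun w hw ↦ ?_) (iidExp_separated_le hrV h.card_eq hM0
    h.disjoint hq0 hq1 hq hL hT0 hT Finset.univ O (fun j _ ↦ h.disjoint_right j) h.le_card)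
  exact fun k _ l _ hkl ↦ hw k l hkl

end

/-! ### Asymptotics of birth times and of the second-stage bounds. -/

section Asymptotics

/-- Write `M f(a) = (M a) (f(a) / a)`; the slope, extended continuously to `0`, tends to the
derivative, also along indices with `a = 0`. -/
lemma tendsto_mul_comp_of_hasDerivAt {f : ℝ → ℝ} {f' : ℝ} (hf : HasDerivAt f f' 0) (hf0 : f 0 = 0)
    {M a : ℕ → ℝ} {A : ℝ} (ha : Tendsto a atTop (𝓝 0))
    (hMa : Tendsto (fun n ↦ M n * a n) atTop (𝓝 A)) :
    Tendsto (fun n ↦ M n * f (a n)) atTop (𝓝 (A * f')) := by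
  have h1 : Tendsto (fun n ↦ dslope f 0 (a n)) atTop (𝓝 f') := by
    have : ContinuousAt (dslope f 0) 0 := continuousAt_dslope_same.2 hf.differentiableAt
    have h := this.tendsto.comp ha
    rwa [dslope_same, hf.deriv] at h
  refine (hMa.mul h1).congr fun n ↦ ?_
  have := sub_smul_dslope f 0 (a n)
  rw [hf0, sub_zero, sub_zero, smul_eq_mul] at this
  rw [mul_assoc, this]

lemma tendsto_one_add_pow {M : ℕ → ℕ} {a : ℕ → ℝ} {A : ℝ} (hM : Tendsto M atTop atTop)
    (hMa : Tendsto (fun n ↦ M n * a n) atTop (𝓝 A)) :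
    Tendsto (fun n ↦ (1 + a n) ^ M n) atTop (𝓝 (Real.exp A)) := by
  have ha : Tendsto a atTop (𝓝 0) := by
    have h := hMa.mul (tendsto_inv_atTop_zero.comp (tendsto_natCast_atTop_atTop.comp hM))
    rw [mul_zero] at h
    refine h.congr' ?_
    filter_upwards [hM.eventually_gt_atTop 0] with n hn
    have : (M n : ℝ) ≠ 0 := by positivity
    simp only [Function.comp]
    field_simp
  have hd : HasDerivAt (fun x : ℝ ↦ Real.log (1 + x)) 1 0 := by
    have := ((hasDerivAt_id (0 : ℝ)).const_add 1).log (by simp)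
    simpa using this
  have h := tendsto_mul_comp_of_hasDerivAt hd (by simp) ha hMa
  rw [mul_one] at h
  refine (Real.continuous_exp.tendsto _ |>.comp h).congr' ?_
  filter_upwards [ha.eventually (lt_mem_nhds (show (-1 : ℝ) < 0 by norm_num))] with n hn
  simp only [Function.comp]
  rw [mul_comm, Real.exp_mul, Real.exp_log (by linarith), Real.rpow_natCast]

variable {K M : ℕ → ℕ} {q : ℕ → ℝ}

lemma tendsto_mul_one_sub_exp (hK : Tendsto K atTop atTop) (hM : ∀ n, M n = K n + 1) {y : ℝ} :
    Tendsto (fun n ↦ M n * (1 - Real.exp (-(y / K n)))) atTop (𝓝 y) := by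
  have hKr : Tendsto (fun n ↦ (K n : ℝ)) atTop atTop := tendsto_natCast_atTop_atTop.comp hK
  have hd : HasDerivAt (fun x : ℝ ↦ 1 - Real.exp (-x)) 1 0 := by
    have := ((hasDerivAt_id (0 : ℝ)).neg.exp).const_sub 1
    simpa using this
  have h0 : Tendsto (fun n ↦ y / K n) atTop (𝓝 0) := tendsto_const_nhds.div_atTop hKr
  have h := tendsto_mul_comp_of_hasDerivAt hd (by simp) (M := fun n ↦ M n) (A := y) h0 ?_
  · simpa using h
  · have : Tendsto (fun n ↦ y + y / K n) atTop (𝓝 (y + 0)) := tendsto_const_nhds.add h0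
    rw [add_zero] at this
    refine this.congr' ?_
    filter_upwards [hK.eventually_gt_atTop 0] with n hn
    have : (K n : ℝ) ≠ 0 := by positivity
    rw [hM]; push_cast; field_simp

/-- The difference equals `(1 / q) log(M (1 - exp(-y / K)))` plus `(1 / q) (q - 1) log M`; the
argument of the first logarithm tends to `y`. This is where the limiting scaled cluster size
appears. -/
lemma tendsto_log_sub_birthTime (hK : Tendsto K atTop atTop) (hM : ∀ n, M n = K n + 1)
    (hq1 : Tendsto q atTop (𝓝 1))
    (hq : Tendsto (fun n ↦ (q n - 1) * Real.log (M n)) atTop (𝓝 0)) {y : ℝ} (hy : 0 < y) :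
    Tendsto (fun n ↦ Real.log (M n) - birthTime (q n) (K n) y) atTop (𝓝 (Real.log y)) := by
  have h1 := ((Real.continuousAt_log hy.ne').tendsto).comp
    (tendsto_mul_one_sub_exp hK hM (y := y))
  have h2 := hq1.inv₀ one_ne_zero
  have h3 := (h2.mul h1).add (h2.mul hq)
  rw [inv_one, one_mul, mul_zero, add_zero] at h3
  refine h3.congr' ?_
  filter_upwards [hq1.eventually (lt_mem_nhds zero_lt_one), hK.eventually_gt_atTop 0] with n hn hKn
  have hp : 0 < 1 - Real.exp (-(y / K n)) := by
    have : Real.exp (-(y / K n)) < 1 := Real.exp_lt_one_iff.2 (by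
      have : 0 < y / K n := by positivity
      linarith)
    linarith
  have hMn : (M n : ℝ) ≠ 0 := by rw [hM]; positivity
  simp only [Function.comp, birthTime]
  rw [Real.log_mul hMn hp.ne']
  field_simp
  ring

variable {κ : Type*}

lemma tendsto_delayed (hK : Tendsto K atTop atTop) (hM : ∀ n, M n = K n + 1)
    (hq1 : Tendsto q atTop (𝓝 1))
    (hq : Tendsto (fun n ↦ (q n - 1) * Real.log (M n)) atTop (𝓝 0)) {y : κ → ℝ}
    (hy : ∀ k, 0 < y k) (x : κ → κ → ℝ) (k l : κ) :
    Tendsto (fun n : ℕ ↦ delayed (fun k l ↦ Real.log n + x k l)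
        (fun k ↦ birthTime (q n) (K n) (y k)) k l - Real.log n + 2 * Real.log (M n)) atTop
      (𝓝 (x k l + Real.log (y k) + Real.log (y l))) := by
  have h := ((tendsto_log_sub_birthTime hK hM hq1 hq (hy k)).const_add (x k l)).add
    (tendsto_log_sub_birthTime hK hM hq1 hq (hy l))
  refine h.congr fun n ↦ ?_
  unfold delayed; ring

/-- The exponent is `q (t - log n + 2 log M) + (q - 1) log n - 2 (q - 1) log M`, so `q` has to
approach `1` faster than `1 / log n`. -/
lemma tendsto_sq_mul_exp {t : ℕ → ℝ} {s : ℝ} (hM : ∀ n, M n = K n + 1)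
    (hq1 : Tendsto q atTop (𝓝 1))
    (hqM : Tendsto (fun n ↦ (q n - 1) * Real.log (M n)) atTop (𝓝 0))
    (hqn : Tendsto (fun n : ℕ ↦ (q n - 1) * Real.log n) atTop (𝓝 0))
    (ht : Tendsto (fun n : ℕ ↦ t n - Real.log n + 2 * Real.log (M n)) atTop (𝓝 s)) :
    Tendsto (fun n : ℕ ↦ (M n : ℝ) ^ 2 / n * Real.exp (q n * t n)) atTop (𝓝 (Real.exp s)) := by
  have h := ((hq1.mul ht).add hqn).sub (hqM.const_mul 2)
  rw [one_mul, add_zero, mul_zero, sub_zero] at h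
  refine ((Real.continuous_exp.tendsto s).comp h).congr' ?_
  filter_upwards [eventually_gt_atTop 0] with n hn
  have hMn : (0 : ℝ) < M n := by rw [hM]; positivity
  have hn' : (0 : ℝ) < n := by positivity
  have e : (M n : ℝ) ^ 2 / n = Real.exp (2 * Real.log (M n) - Real.log n) := by
    rw [Real.exp_sub, Real.exp_log hn', two_mul, Real.exp_add, Real.exp_log hMn, sq]
  simp only [Function.comp]
  rw [e, ← Real.exp_add]
  congr 1; ring

lemma tendsto_sq_mul_expSub {t : ℕ → ℝ} {s : ℝ} (hM : ∀ n, M n = K n + 1)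
    (hq1 : Tendsto q atTop (𝓝 1))
    (hqM : Tendsto (fun n ↦ (q n - 1) * Real.log (M n)) atTop (𝓝 0))
    (hqn : Tendsto (fun n : ℕ ↦ (q n - 1) * Real.log n) atTop (𝓝 0))
    (hMn : Tendsto (fun n : ℕ ↦ (M n : ℝ) ^ 2 / n) atTop (𝓝 0))
    (ht : Tendsto (fun n : ℕ ↦ t n - Real.log n + 2 * Real.log (M n)) atTop (𝓝 s)) :
    Tendsto (fun n : ℕ ↦ M n * (M n * (1 / (n : ℝ)) * expSub (q n) (t n))) atTop
      (𝓝 (Real.exp s)) := by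
  have h := ((tendsto_sq_mul_exp hM hq1 hqM hqn ht).sub hMn).max (tendsto_const_nhds (x := (0 : ℝ)))
  rw [sub_zero, max_eq_left (Real.exp_pos s).le] at h
  refine h.congr fun n ↦ ?_
  have h0 : 0 ≤ (M n : ℝ) ^ 2 / n := by positivity
  have := mul_max_of_nonneg (Real.exp (q n * t n) - 1) 0 h0
  rw [mul_zero] at this
  rw [show (M n : ℝ) ^ 2 / n * Real.exp (q n * t n) - (M n : ℝ) ^ 2 / n
    = (M n : ℝ) ^ 2 / n * (Real.exp (q n * t n) - 1) by ring, ← this, expSub]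
  ring

end Asymptotics

section
variable {κ : Type*} [Fintype κ] [LinearOrder κ]

/-- The limiting probability that the points are at given recentred distances, given the scaled
sizes `y` of the neighbourhoods of the points. -/
noncomputable def farKernel (x : κ → κ → ℝ) (y : κ → ℝ) : ℝ :=
  ∏ k, ∏ j with j < k, Real.exp (-(Real.exp (x k j) * y k * y j))

lemma farKernel_pos (x : κ → κ → ℝ) (y : κ → ℝ) : 0 < farKernel x y :=
  Finset.prod_pos fun _ _ ↦ Finset.prod_pos fun _ _ ↦ Real.exp_pos _

lemma farKernel_le_one (x : κ → κ → ℝ) {y : κ → ℝ} (hy : ∀ k, 0 ≤ y k) : farKernel x y ≤ 1 := by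
  refine Finset.prod_le_one (fun _ _ ↦ Finset.prod_nonneg fun _ _ ↦ (Real.exp_pos _).le)
    fun k _ ↦ Finset.prod_le_one (fun _ _ ↦ (Real.exp_pos _).le) fun j _ ↦ ?_
  rw [Real.exp_le_one_iff]
  have := hy k; have := hy j
  have : 0 ≤ Real.exp (x k j) * y k * y j := by positivity
  linarith

lemma measurable_farKernel (x : κ → κ → ℝ) : Measurable (farKernel x) := by
  unfold farKernel
  fun_prop

/-- The limiting probability that the points are at given recentred distances. -/
noncomputable def farLimit (x : κ → κ → ℝ) : ℝ≥0∞ :=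
  ∫⁻ y, ENNReal.ofReal (farKernel x y) ∂(iidExp κ 1)

lemma iidExp_ae_pos : ∀ᵐ y ∂(iidExp κ 1), ∀ k, 0 < y k := by
  have := nullSingletonClass_expMeasure (r := 1)
  have hp : IsProbabilityMeasure (expMeasure 1) := isProbabilityMeasure_expMeasure one_pos
  rw [ae_all_iff]
  intro k
  have h : ∀ᵐ x ∂(expMeasure 1), 0 < x := by
    filter_upwards [expMeasure_ae_nonneg one_pos, measure_eq_zero_iff_ae_notMem.1
      (measure_singleton (μ := expMeasure 1) 0)] with x hx hx'
    exact lt_of_le_of_ne hx (Ne.symm hx')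
  exact (Measure.quasiMeasurePreserving_eval (fun _ : κ ↦ expMeasure 1) k).ae h

variable {K M : ℕ → ℕ} {q : ℕ → ℝ}

lemma exp_log_add {x a b : ℝ} (ha : 0 < a) (hb : 0 < b) :
    Real.exp (x + Real.log a + Real.log b) = Real.exp x * a * b := by
  rw [Real.exp_add, Real.exp_add, Real.exp_log ha, Real.exp_log hb]

lemma tendsto_freeBound (hK : Tendsto K atTop atTop) (hM : ∀ n, M n = K n + 1)
    (hq1 : Tendsto q atTop (𝓝 1))
    (hqM : Tendsto (fun n ↦ (q n - 1) * Real.log (M n)) atTop (𝓝 0))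
    (hqn : Tendsto (fun n : ℕ ↦ (q n - 1) * Real.log n) atTop (𝓝 0))
    (hMn : Tendsto (fun n : ℕ ↦ (M n : ℝ) ^ 2 / n) atTop (𝓝 0)) {y : κ → ℝ} (hy : ∀ k, 0 < y k)
    (x : κ → κ → ℝ) {s : ℕ → κ → ℝ}
    (hs : ∀ k l, Tendsto (fun n : ℕ ↦ delayed (fun k l ↦ Real.log n + x k l) (s n) k l
      - Real.log n + 2 * Real.log (M n)) atTop (𝓝 (x k l + Real.log (y k) + Real.log (y l)))) :
    Tendsto (fun n : ℕ ↦ freeBound (1 / (n : ℝ)) (q n) (M n)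
      (delayed (fun k l ↦ Real.log n + x k l) (s n))) atTop (𝓝 (farKernel x y)) := by
  have hMt : Tendsto M atTop atTop :=
    tendsto_atTop_mono (fun n ↦ by rw [hM]; omega) hK
  refine tendsto_finsetProd _ fun k _ ↦ tendsto_finsetProd _ fun j _ ↦ ?_
  have h := (tendsto_sq_mul_expSub hM hq1 hqM hqn hMn (hs k j)).neg
  rw [exp_log_add (hy k) (hy j)] at h
  have h1 := tendsto_one_add_pow (M := M) (a := fun n ↦ -(M n * (1 / (n : ℝ)) * expSub (q n)
    (delayed (fun k l ↦ Real.log n + x k l) (s n) k j))) hMt (h.congr fun n ↦ by ring)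
  refine h1.congr' ?_
  have hMr : Tendsto (fun n ↦ (M n : ℝ)) atTop atTop := tendsto_natCast_atTop_atTop.comp hMt
  have h2 := (h.div_atTop hMr).eventually (lt_mem_nhds (show (-1 : ℝ) < 0 by norm_num))
  filter_upwards [h2, hMr.eventually_gt_atTop 0] with n hn hMn
  have e : -(M n * (M n * (1 / (n : ℝ)) * expSub (q n)
    (delayed (fun k l ↦ Real.log n + x k l) (s n) k j))) / M n = -(1 / n * M n * expSub (q n)
    (delayed (fun k l ↦ Real.log n + x k l) (s n) k j)) := by field_simp
  rw [e] at hn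
  rw [max_eq_right (by linarith)]
  congr 1; ring

/-- Each power `(1 + h / M)^(-M)` with `h → H` tends to `exp(-H)`. In the error term `exp(T)` is one
plus the sum of the exponentials of the thresholds, which are of order `n / M^2`; this leaves `M /
L` and `n / (L M)`. -/
lemma tendsto_clusterBound {L : ℕ → ℕ} (hK : Tendsto K atTop atTop) (hM : ∀ n, M n = K n + 1)
    (hq1 : Tendsto q atTop (𝓝 1))
    (hqM : Tendsto (fun n ↦ (q n - 1) * Real.log (M n)) atTop (𝓝 0))
    (hqn : Tendsto (fun n : ℕ ↦ (q n - 1) * Real.log n) atTop (𝓝 0))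
    (hMn : Tendsto (fun n : ℕ ↦ (M n : ℝ) ^ 2 / n) atTop (𝓝 0))
    (hML : Tendsto (fun n : ℕ ↦ (M n : ℝ) / L n) atTop (𝓝 0))
    (hnL : Tendsto (fun n : ℕ ↦ (n : ℝ) / (L n * M n)) atTop (𝓝 0))
    {y : κ → ℝ} (hy : ∀ k, 0 < y k)
    (x : κ → κ → ℝ) {s : ℕ → κ → ℝ}
    (hs : ∀ k l, Tendsto (fun n : ℕ ↦ delayed (fun k l ↦ Real.log n + x k l) (s n) k l
      - Real.log n + 2 * Real.log (M n)) atTop (𝓝 (x k l + Real.log (y k) + Real.log (y l)))) :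
    Tendsto (fun n : ℕ ↦ clusterBound (1 / (n : ℝ)) (q n) (M n) (L n)
      (Real.log (1 + ∑ k, ∑ l, Real.exp (delayed (fun k l ↦ Real.log n + x k l) (s n) k l)))
      Finset.univ (delayed (fun k l ↦ Real.log n + x k l) (s n))) atTop (𝓝 (farKernel x y)) := by
  have hMt : Tendsto M atTop atTop :=
    tendsto_atTop_mono (fun n ↦ by rw [hM]; omega) hK
  rw [← add_zero (farKernel x y)]
  refine Tendsto.add (tendsto_finsetProd _ fun k _ ↦ ?_) ?_
  · rw [← Real.exp_sum, Finset.sum_neg_distrib, Real.exp_neg]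
    simp_rw [inv_pow]
    refine Tendsto.inv₀ ?_ (Real.exp_ne_zero _)
    refine tendsto_one_add_pow hMt ?_
    have h := tendsto_finsetSum (Finset.univ.filter fun j ↦ j < k) fun j _ ↦
      tendsto_sq_mul_expSub hM hq1 hqM hqn hMn (hs k j)
    simp_rw [exp_log_add (hy _) (hy _)] at h
    refine h.congr fun n ↦ ?_
    rw [Finset.mul_sum, Finset.mul_sum]
  · have h1 : Tendsto (fun n : ℕ ↦ (M n : ℝ) / L n * Real.exp (Real.log (1 + ∑ k, ∑ l,
        Real.exp (delayed (fun k l ↦ Real.log n + x k l) (s n) k l)))) atTop (𝓝 0) := by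
      have h2 : ∀ k l, Tendsto (fun n : ℕ ↦ (n : ℝ) / (L n * M n) * Real.exp
          (delayed (fun k l ↦ Real.log n + x k l) (s n) k l
            - Real.log n + 2 * Real.log (M n))) atTop (𝓝 0) := fun k l ↦ by
        have := hnL.mul ((Real.continuous_exp.tendsto _).comp (hs k l))
        rwa [zero_mul] at this
      have h3 := hML.add (tendsto_finsetSum Finset.univ fun k _ ↦
        tendsto_finsetSum Finset.univ fun l _ ↦ h2 k l)
      simp only [Finset.sum_const_zero, add_zero] at h3
      refine h3.congr' ?_
      filter_upwards [eventually_gt_atTop 0] with n hn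
      have hn' : (0 : ℝ) < n := by positivity
      have hMp : (0 : ℝ) < M n := by rw [hM]; positivity
      rw [Real.exp_log (by positivity), mul_add, mul_one, Finset.mul_sum]
      congr 1
      refine Finset.sum_congr rfl fun k _ ↦ ?_
      rw [Finset.mul_sum]
      refine Finset.sum_congr rfl fun l _ ↦ ?_
      rw [Real.exp_add, Real.exp_sub, Real.exp_log hn', two_mul, Real.exp_add, Real.exp_log hMp]
      rcases eq_or_ne (L n : ℝ) 0 with h | h
      · simp [h]
      · field_simp
    simpa using h1.const_mul (Finset.univ.card : ℝ)

end

/-! ### Choice of scales: clusters of size `n^(1/4)`, explorations of size `n^(7/8)`. -/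

/-- The number of steps in the first stage of the exploration. -/
noncomputable def growthSteps (n : ℕ) : ℕ := ⌊(n : ℝ) ^ (1 / 4 : ℝ)⌋₊

/-- A bound for the number of vertices explored in the second stage from each point. -/
noncomputable def exploredSize (n : ℕ) : ℕ := ⌈(n : ℝ) ^ (7 / 8 : ℝ)⌉₊

section Growth

lemma tendsto_natCast_rpow {a : ℝ} (ha : 0 < a) :
    Tendsto (fun n : ℕ ↦ (n : ℝ) ^ a) atTop atTop :=
  (tendsto_rpow_atTop ha).comp tendsto_natCast_atTop_atTop

lemma tendsto_natCast_rpow_neg {a : ℝ} (ha : 0 < a) :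
    Tendsto (fun n : ℕ ↦ (n : ℝ) ^ (-a)) atTop (𝓝 0) :=
  (tendsto_rpow_neg_atTop ha).comp tendsto_natCast_atTop_atTop

lemma tendsto_growthSteps : Tendsto growthSteps atTop atTop :=
  tendsto_nat_floor_atTop.comp (tendsto_natCast_rpow (by norm_num))

lemma growthSteps_le (n : ℕ) (hn : 0 < n) :
    ((growthSteps n + 1 : ℕ) : ℝ) ≤ 2 * (n : ℝ) ^ (1 / 4 : ℝ) := by
  have h1 : (growthSteps n : ℝ) ≤ (n : ℝ) ^ (1 / 4 : ℝ) := Nat.floor_le (by positivity)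
  have h2 : 1 ≤ (n : ℝ) ^ (1 / 4 : ℝ) :=
    Real.one_le_rpow (by exact_mod_cast hn) (by norm_num)
  push_cast
  linarith

lemma le_growthSteps (n : ℕ) : (n : ℝ) ^ (1 / 4 : ℝ) ≤ ((growthSteps n + 1 : ℕ) : ℝ) := by
  push_cast
  exact (Nat.lt_floor_add_one _).le

lemma le_exploredSize (n : ℕ) : (n : ℝ) ^ (7 / 8 : ℝ) ≤ exploredSize n := Nat.le_ceil _

lemma exploredSize_le (n : ℕ) (hn : 0 < n) : (exploredSize n : ℝ) ≤ 2 * (n : ℝ) ^ (7 / 8 : ℝ) := by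
  have h1 : (exploredSize n : ℝ) < (n : ℝ) ^ (7 / 8 : ℝ) + 1 := Nat.ceil_lt_add_one (by positivity)
  have h2 : 1 ≤ (n : ℝ) ^ (7 / 8 : ℝ) :=
    Real.one_le_rpow (by exact_mod_cast hn) (by norm_num)
  linarith

lemma tendsto_zero_of_le_rpow {f : ℕ → ℝ} (C : ℝ) {a : ℝ} (ha : 0 < a) (h0 : ∀ n, 0 ≤ f n)
    (h : ∀ n : ℕ, 0 < n → f n ≤ C * (n : ℝ) ^ (-a)) : Tendsto f atTop (𝓝 0) := by
  have h1 := (tendsto_natCast_rpow_neg ha).const_mul C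
  rw [mul_zero] at h1
  refine squeeze_zero' (Eventually.of_forall h0) ?_ h1
  filter_upwards [eventually_gt_atTop 0] with n hn using h n hn

lemma sq_growthSteps_le (n : ℕ) (hn : 0 < n) :
    ((growthSteps n + 1 : ℕ) : ℝ) ^ 2 / n ≤ 4 * (n : ℝ) ^ (-(1 / 8) : ℝ) := by
  have hn' : (0 : ℝ) < n := by positivity
  have hn1 : (1 : ℝ) ≤ n := by exact_mod_cast hn
  have h := pow_le_pow_left₀ (by positivity) (growthSteps_le n hn) 2
  rw [div_le_iff₀ hn']
  refine h.trans ?_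
  rw [mul_pow, ← Real.rpow_natCast ((n : ℝ) ^ _), ← Real.rpow_mul hn'.le, mul_assoc]
  nth_rewrite 3 [← Real.rpow_one (n : ℝ)]
  rw [← Real.rpow_add hn']
  have : (n : ℝ) ^ ((1 / 4 : ℝ) * ((2 : ℕ) : ℝ)) ≤ (n : ℝ) ^ (-(1 / 8) + 1 : ℝ) :=
    Real.rpow_le_rpow_of_exponent_le hn1 (by norm_num)
  linarith

lemma tendsto_sq_growthSteps :
    Tendsto (fun n : ℕ ↦ ((growthSteps n + 1 : ℕ) : ℝ) ^ 2 / n) atTop (𝓝 0) :=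
  tendsto_zero_of_le_rpow 4 (by norm_num) (fun n ↦ by positivity) sq_growthSteps_le

lemma tendsto_growthSteps_div :
    Tendsto (fun n : ℕ ↦ ((growthSteps n + 1 : ℕ) : ℝ) / exploredSize n) atTop (𝓝 0) := by
  refine tendsto_zero_of_le_rpow 2 (a := 5 / 8) (by norm_num) (fun n ↦ by positivity) fun n hn ↦ ?_
  have hn' : (0 : ℝ) < n := by positivity
  rw [div_le_iff₀ ((Real.rpow_pos_of_pos hn' _).trans_le (le_exploredSize n))]
  calc ((growthSteps n + 1 : ℕ) : ℝ) ≤ 2 * (n : ℝ) ^ (1 / 4 : ℝ) := growthSteps_le n hn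
    _ = 2 * (n : ℝ) ^ (-(5 / 8) : ℝ) * (n : ℝ) ^ (7 / 8 : ℝ) := by
      rw [mul_assoc, ← Real.rpow_add hn']; norm_num
    _ ≤ _ := by gcongr; exact le_exploredSize n

/-- The second exploration from a cluster has expected size of order `n / M`, which must be much
smaller than `L`: the exponents `1/4` and `7/8` add up to more than `1`. Both being below `1`, with
`M^2` much smaller than `n`, keeps the depletion of vertices negligible. -/
lemma tendsto_div_exploredSize_mul :
    Tendsto (fun n : ℕ ↦ (n : ℝ) / (exploredSize n * (growthSteps n + 1 : ℕ))) atTop (𝓝 0) := by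
  refine tendsto_zero_of_le_rpow 1 (a := 1 / 8) (by norm_num) (fun n ↦ by positivity) fun n hn ↦ ?_
  have hn' : (0 : ℝ) < n := by positivity
  have h1 := (Real.rpow_pos_of_pos hn' _).trans_le (le_exploredSize n)
  rw [div_le_iff₀ (by positivity), one_mul]
  calc (n : ℝ) = (n : ℝ) ^ (-(1 / 8) : ℝ) * ((n : ℝ) ^ (7 / 8 : ℝ) * (n : ℝ) ^ (1 / 4 : ℝ)) := by
        rw [← Real.rpow_add hn', ← Real.rpow_add hn']; norm_num
    _ ≤ _ := by gcongr; exacts [le_exploredSize n, le_growthSteps n]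

/-- Applied to `q - 1`: a power rate beats the logarithm, and `log M ≤ log n` eventually. -/
lemma tendsto_mul_log_of_le {f : ℕ → ℝ} (C : ℝ)
    (h : ∀ n : ℕ, 0 < n → |f n| ≤ C * (n : ℝ) ^ (-(1 / 8) : ℝ)) :
    Tendsto f atTop (𝓝 0) ∧ Tendsto (fun n : ℕ ↦ f n * Real.log n) atTop (𝓝 0) ∧
      Tendsto (fun n : ℕ ↦ f n * Real.log (growthSteps n + 1 : ℕ)) atTop (𝓝 0) := by
  have h1 : Tendsto f atTop (𝓝 0) := by
    rw [tendsto_zero_iff_abs_tendsto_zero]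
    exact tendsto_zero_of_le_rpow C (a := 1 / 8) (by norm_num) (fun n ↦ abs_nonneg _) h
  have h2 : Tendsto (fun n : ℕ ↦ |f n| * Real.log n) atTop (𝓝 0) := by
    have h3 := ((isLittleO_log_rpow_atTop (r := 1 / 8) (by norm_num)).tendsto_div_nhds_zero.comp
      tendsto_natCast_atTop_atTop (α := ℕ)).const_mul C
    rw [mul_zero] at h3
    refine squeeze_zero' ?_ ?_ h3
    · filter_upwards [eventually_gt_atTop 0] with n hn
      have : 0 ≤ Real.log n := Real.log_natCast_nonneg n
      positivity
    · filter_upwards [eventually_gt_atTop 0] with n hn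
      have : 0 ≤ Real.log n := Real.log_natCast_nonneg n
      refine (mul_le_mul_of_nonneg_right (h n hn) this).trans (le_of_eq ?_)
      simp only [Function.comp]
      rw [Real.rpow_neg (by positivity)]
      field_simp
  refine ⟨h1, ?_, ?_⟩
  · rw [tendsto_zero_iff_abs_tendsto_zero]
    refine h2.congr fun n ↦ ?_
    simp only [Function.comp, abs_mul, abs_of_nonneg (Real.log_natCast_nonneg n)]
  · rw [tendsto_zero_iff_abs_tendsto_zero]
    refine squeeze_zero' (Eventually.of_forall fun n ↦ abs_nonneg _) ?_ h2
    filter_upwards [eventually_gt_atTop 0,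
      tendsto_sq_growthSteps.eventually (gt_mem_nhds one_pos)] with n hn hM
    simp only [Function.comp, abs_mul, abs_of_nonneg (Real.log_natCast_nonneg (growthSteps n + 1))]
    rw [div_lt_one (by positivity)] at hM
    have h4 : ((growthSteps n + 1 : ℕ) : ℝ) ≤ n := by
      have : (1 : ℝ) ≤ (growthSteps n + 1 : ℕ) := by push_cast; linarith [Nat.cast_nonneg (α := ℝ) (growthSteps n)]
      nlinarith
    gcongr

end Growth

/-! ### Both worst-case bounds converge to the same limit. -/

section
variable {κ : Type*} [Fintype κ] [LinearOrder κ]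

lemma measurable_clusterBound (r q : ℝ) (M L : ℕ) : Measurable fun t : κ → κ → ℝ ↦
    clusterBound r q M L (Real.log (1 + ∑ k, ∑ l, Real.exp (t k l))) Finset.univ t := by
  have := (continuous_expSub q).measurable
  unfold clusterBound
  fun_prop

lemma measurable_freeBound (r q : ℝ) (M : ℕ) :
    Measurable fun t : κ → κ → ℝ ↦ freeBound r q M t := by
  have := (continuous_expSub q).measurable
  unfold freeBound
  fun_prop

lemma measurable_delayed {T : ℝ → ℝ} (hT : Measurable T) (t : κ → κ → ℝ) :
    Measurable fun y : κ → ℝ ↦ delayed t fun k ↦ T (y k) := by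
  refine measurable_pi_lambda _ fun k ↦ measurable_pi_lambda _ fun l ↦ ?_
  unfold delayed; fun_prop

/-- Growing all the clusters and then applying the separation bound gives an integral over
independent exponentials; its integrand converges for almost every `y`. -/
lemma exists_tendsto_sepBound (m : ℕ) {x : κ → κ → ℝ} (hx : ∀ k l, x k l = x l k) :
    ∃ U : ℕ → ℝ≥0∞, Tendsto U atTop (𝓝 (farLimit x)) ∧ ∀ᶠ n : ℕ in atTop,
      sepBound (Fin n) (1 / (n : ℝ)) (fun _ : κ ↦ 1) (n - m) (fun k l ↦ Real.log n + x k l)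
        ≤ U n := by
  have : Fact ((0 : ℝ) < 1) := ⟨one_pos⟩
  -- All vertices that may be unavailable: `m` initially, `K` per cluster in the first stage and `L`
  -- per cluster in the second. The growth rate per vertex is then at least `q = (n - d) / n`, and
  -- `d / n` is of order at most `n^(-1/8)`.
  set d : ℕ → ℕ := fun n ↦
    m + Fintype.card κ * growthSteps n + Fintype.card κ * exploredSize n with hd
  set q : ℕ → ℝ := fun n ↦ ((n - d n : ℕ) : ℝ) / n with hq
  have hdn : ∀ n : ℕ, 0 < n → (d n : ℝ) / n
      ≤ (m + 4 * Fintype.card κ) * (n : ℝ) ^ (-(1 / 8) : ℝ) := by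
    intro n hn
    have hn' : (0 : ℝ) < n := by positivity
    have hn1 : (1 : ℝ) ≤ n := by exact_mod_cast hn
    rw [div_le_iff₀ hn', mul_assoc]
    nth_rewrite 2 [← Real.rpow_one (n : ℝ)]
    rw [← Real.rpow_add hn', show (-(1 / 8) + 1 : ℝ) = 7 / 8 by norm_num]
    have h1 := exploredSize_le n hn
    have h2 := growthSteps_le n hn
    have h3 : (n : ℝ) ^ (1 / 4 : ℝ) ≤ (n : ℝ) ^ (7 / 8 : ℝ) :=
      Real.rpow_le_rpow_of_exponent_le hn1 (by norm_num)
    have h4 : 1 ≤ (n : ℝ) ^ (7 / 8 : ℝ) := Real.one_le_rpow hn1 (by norm_num)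
    simp only [hd]
    push_cast at h2 ⊢
    have h5 : (m : ℝ) ≤ m * (n : ℝ) ^ (7 / 8 : ℝ) := le_mul_of_one_le_right (by positivity) h4
    have h6 : (Fintype.card κ : ℝ) * growthSteps n
        ≤ Fintype.card κ * (2 * (n : ℝ) ^ (7 / 8 : ℝ)) := by gcongr; linarith
    have h7 : (Fintype.card κ : ℝ) * exploredSize n
        ≤ Fintype.card κ * (2 * (n : ℝ) ^ (7 / 8 : ℝ)) := by gcongr
    linarith
  have hd0 : Tendsto (fun n : ℕ ↦ (d n : ℝ) / n) atTop (𝓝 0) :=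
    tendsto_zero_of_le_rpow _ (by norm_num) (fun n ↦ by positivity) hdn
  have hqd : ∀ n : ℕ, 0 < n → |q n - 1| ≤ (d n : ℝ) / n := by
    intro n hn
    have hn' : (0 : ℝ) < n := by positivity
    have h1 : ((n - d n : ℕ) : ℝ) ≤ n := by exact_mod_cast Nat.sub_le _ _
    have h2 : (n : ℝ) ≤ ((n - d n : ℕ) : ℝ) + d n := by exact_mod_cast (by omega)
    rw [hq]
    simp only
    rw [abs_le]
    constructor
    · rw [neg_le_sub_iff_le_add, ← add_div, le_div_iff₀ hn']; linarith
    · have : ((n - d n : ℕ) : ℝ) / n ≤ 1 := by rw [div_le_one hn']; exact h1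
      have : 0 ≤ (d n : ℝ) / n := by positivity
      linarith
  obtain ⟨hq1, hqn, hqM⟩ := tendsto_mul_log_of_le (f := fun n ↦ q n - 1) _
    fun n hn ↦ (hqd n hn).trans (hdn n hn)
  have hq1' : Tendsto q atTop (𝓝 1) := by simpa using hq1.add_const 1
  set t : ℕ → κ → κ → ℝ := fun n k l ↦ Real.log n + x k l with ht
  -- The minimum with `1` provides the dominating function; it disappears in the limit because
  -- `farKernel` is at most `1` for nonnegative `y`.
  set F : ℕ → (κ → κ → ℝ) → ℝ≥0∞ := fun n t ↦ min 1 (ENNReal.ofReal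
    (clusterBound (1 / (n : ℝ)) (q n) (growthSteps n + 1) (exploredSize n)
      (Real.log (1 + ∑ k, ∑ l, Real.exp (t k l))) Finset.univ t)) with hF
  have hFm : ∀ n, Measurable (F n) := fun n ↦
    measurable_const.min (measurable_clusterBound _ _ _ _).ennreal_ofReal
  refine ⟨fun n ↦ ∫⁻ y, F n (delayed (t n) fun k ↦ birthTime (q n) (growthSteps n) (y k))
    ∂(iidExp κ 1), ?_, ?_⟩
  · refine tendsto_lintegral_of_dominated_convergence (fun _ ↦ 1)
      (fun n ↦ (hFm n).comp (measurable_delayed (measurable_birthTime _ _) _))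
      (fun n ↦ Eventually.of_forall fun y ↦ min_le_left _ _) (by simp) ?_
    filter_upwards [iidExp_ae_pos (κ := κ)] with y hy
    have h := tendsto_clusterBound (M := fun n ↦ growthSteps n + 1) tendsto_growthSteps
      (fun _ ↦ rfl) hq1' hqM hqn tendsto_sq_growthSteps tendsto_growthSteps_div
      tendsto_div_exploredSize_mul hy x
      (tendsto_delayed (M := fun n ↦ growthSteps n + 1) tendsto_growthSteps
      (fun _ ↦ rfl) hq1' hqM hy x)
    have h2 := (tendsto_const_nhds (x := (1 : ℝ≥0∞))).min (ENNReal.tendsto_ofReal h)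
    rwa [min_eq_right (by
      rw [← ENNReal.ofReal_one]
      exact ENNReal.ofReal_le_ofReal (farKernel_le_one x fun k ↦ (hy k).le))] at h2
  · filter_upwards [eventually_gt_atTop 0, hq1'.eventually (lt_mem_nhds zero_lt_one),
      hd0.eventually (gt_mem_nhds one_pos), tendsto_growthSteps.eventually_gt_atTop 0]
      with n hn hqn hdn hKn
    have hn' : (0 : ℝ) < n := by positivity
    have hr : Fact (0 < 1 / (n : ℝ)) := ⟨by positivity⟩
    have hLn : 0 < exploredSize n := by
      have := (Real.rpow_pos_of_pos hn' (7 / 8)).trans_le (le_exploredSize n)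
      exact_mod_cast this
    rw [div_lt_one hn'] at hdn
    have hdn' : d n < n := by exact_mod_cast hdn
    have hqr : q n = 1 / n * ((n - d n : ℕ) : ℝ) := by simp only [hq]; ring
    have key := le_lintegral_of_step (κ := κ) (sepBound (Fin n) (1 / (n : ℝ)))
      (K := growthSteps n) (N := n - d n + Fintype.card κ * exploredSize n) (C := 0)
      (measurable_birthTime (q n) (growthSteps n)) (fun σ i N' t _ hN' ht ↦ ?_) (hFm n)
      (fun t ht ↦ ?_) (t := t n) (fun k l ↦ by simp only [ht]; rw [hx])
    · rw [mul_zero, zero_add] at key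
      refine le_trans (le_of_eq ?_) key
      congr 1
      simp only [hd] at hdn' ⊢
      omega
    · rw [zero_add]
      refine sepBound_le_lintegral_birthTime hKn.ne' hqn (hqr.le.trans ?_) σ i ht
      gcongr
      omega
    · refine le_min ?_ (sepBound_le (by simp [hn.ne']) (by omega) hqn ?_ hqr.le hLn ?_ ?_)
      · exact iSup₂_le fun B O ↦ iSup_le fun _ ↦ prob_le_one
      · simp only [hq]
        rw [div_le_one hn']
        exact_mod_cast Nat.sub_le _ _
      · refine Real.log_nonneg ?_
        have : 0 ≤ ∑ k, ∑ l, Real.exp (t k l) :=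
          Finset.sum_nonneg fun _ _ ↦ Finset.sum_nonneg fun _ _ ↦ (Real.exp_pos _).le
        linarith
      · intro k l
        rw [Real.le_log_iff_exp_le (by positivity)]
        have h1 : Real.exp (t k l) ≤ ∑ l, Real.exp (t k l) :=
          Finset.single_le_sum (f := fun l ↦ Real.exp (t k l)) (fun _ _ ↦ (Real.exp_pos _).le)
            (Finset.mem_univ l)
        have h2 : ∑ l, Real.exp (t k l) ≤ ∑ k, ∑ l, Real.exp (t k l) :=
          Finset.single_le_sum (f := fun k ↦ ∑ l, Real.exp (t k l))
            (fun _ _ ↦ Finset.sum_nonneg fun _ _ ↦ (Real.exp_pos _).le) (Finset.mem_univ k)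
        linarith

lemma farLimit_le_one (x : κ → κ → ℝ) : farLimit x ≤ 1 := by
  have : Fact ((0 : ℝ) < 1) := ⟨one_pos⟩
  calc farLimit x ≤ ∫⁻ _, 1 ∂(iidExp κ 1) := by
        refine lintegral_mono_ae ?_
        filter_upwards [iidExp_ae_pos (κ := κ)] with y hy
        rw [← ENNReal.ofReal_one]
        exact ENNReal.ofReal_le_ofReal (farKernel_le_one x fun k ↦ (hy k).le)
    _ = 1 := by simp

lemma lintegral_one_sub_farKernel (x : κ → κ → ℝ) :
    ∫⁻ y, ENNReal.ofReal (1 - farKernel x y) ∂(iidExp κ 1) = 1 - farLimit x := by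
  have : Fact ((0 : ℝ) < 1) := ⟨one_pos⟩
  have h1 : ∀ y, ENNReal.ofReal (1 - farKernel x y) = 1 - ENNReal.ofReal (farKernel x y) :=
    fun y ↦ by rw [ENNReal.ofReal_sub _ (farKernel_pos x y).le, ENNReal.ofReal_one]
  simp_rw [h1]
  have h2 := ((farLimit_le_one x).trans_lt ENNReal.one_lt_top).ne
  rw [lintegral_sub (measurable_farKernel x).ennreal_ofReal h2, lintegral_one, measure_univ]
  · rfl
  · filter_upwards [iidExp_ae_pos (κ := κ)] with y hy
    rw [← ENNReal.ofReal_one]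
    exact ENNReal.ofReal_le_ofReal (farKernel_le_one x fun k ↦ (hy k).le)

/-- The complementary estimate: the first stage runs at the exact Yule rates, hence `birthTime 1`,
while the second uses `q = 1 + |κ| M^2 / n`. The limit `1 - farLimit x` matches the separation
bound, so nothing is lost asymptotically. -/
lemma exists_tendsto_nearBound {x : κ → κ → ℝ} (hx : ∀ k l, x k l = x l k) :
    ∃ W : ℕ → ℝ≥0∞, Tendsto W atTop (𝓝 (1 - farLimit x)) ∧ ∀ᶠ n : ℕ in atTop,
      nearBound (Fin n) (1 / (n : ℝ)) (fun _ : κ ↦ 1) (fun k l ↦ Real.log n + x k l) ≤ W n := by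
  have : Fact ((0 : ℝ) < 1) := ⟨one_pos⟩
  set m := Fintype.card κ with hm
  set M : ℕ → ℕ := fun n ↦ growthSteps n + 1 with hM
  set q : ℕ → ℝ := fun n ↦ 1 + 1 / (n : ℝ) * (m * M n * M n) with hq
  have hM2 := tendsto_sq_growthSteps
  obtain ⟨hq1, hqn, hqM⟩ := tendsto_mul_log_of_le (f := fun n ↦ q n - 1) (m * 4) fun n hn ↦ by
    have h1 := sq_growthSteps_le n hn
    have h2 : q n - 1 = m * (((growthSteps n + 1 : ℕ) : ℝ) ^ 2 / n) := by
      simp only [hq, hM]; ring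
    rw [h2, abs_of_nonneg (by positivity), mul_assoc]
    gcongr
  have hq1' : Tendsto q atTop (𝓝 1) := by simpa using hq1.add_const 1
  set t : ℕ → κ → κ → ℝ := fun n k l ↦ Real.log n + x k l with ht
  set F : ℕ → (κ → κ → ℝ) → ℝ≥0∞ := fun n t ↦ ENNReal.ofReal
    (1 - freeBound (1 / (n : ℝ)) (q n) (M n) t) with hF
  have hFm : ∀ n, Measurable (F n) := fun n ↦
    ((measurable_freeBound _ _ _).const_sub 1).ennreal_ofReal
  -- The probability that the growth of one cluster runs into another: `K` steps, each costing at
  -- most `m M / (n - M)`, so of order `M^2 / n` in total.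
  set C : ℕ → ℝ≥0∞ := fun n ↦
    growthSteps n * ENNReal.ofReal (m * (growthSteps n + 1 : ℕ) / (n - (growthSteps n + 1 : ℕ)))
    with hC
  have hMn : ∀ᶠ n in atTop, M n < n ∧ C n ≤ ENNReal.ofReal (2 * m * ((M n : ℝ) ^ 2 / n)) := by
    filter_upwards [eventually_gt_atTop 0,
      hM2.eventually (gt_mem_nhds (show (0 : ℝ) < 1 / 2 by norm_num))] with n hn hMn
    have hn' : (0 : ℝ) < n := by positivity
    rw [div_lt_iff₀ hn'] at hMn
    have h1 : (1 : ℝ) ≤ M n := by simp [hM]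
    have h2 : (M n : ℝ) ≤ n / 2 := by simp only [hM] at h1 ⊢; nlinarith
    refine ⟨by have : (M n : ℝ) < n := by linarith
               exact_mod_cast this, ?_⟩
    simp only [hC]
    rw [← ENNReal.ofReal_natCast, ← ENNReal.ofReal_mul (by positivity)]
    refine ENNReal.ofReal_le_ofReal ?_
    have h3 : (m * M n : ℝ) / (n - M n) ≤ m * M n / (n / 2) := by
      gcongr; linarith
    calc (growthSteps n : ℝ) * (m * M n / (n - M n)) ≤ M n * (m * M n / (n / 2)) := by
          refine mul_le_mul (by simp [hM]) h3 (div_nonneg (by positivity) (by linarith))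
            (by positivity)
      _ = 2 * m * ((M n : ℝ) ^ 2 / n) := by field_simp
  refine ⟨fun n ↦ m * C n + ∫⁻ y, F n (delayed (t n) fun k ↦ birthTime 1 (growthSteps n) (y k))
    ∂(iidExp κ 1), ?_, ?_⟩
  · rw [← zero_add (1 - farLimit x), ← lintegral_one_sub_farKernel]
    refine Tendsto.add ?_ ?_
    · have h0 : Tendsto C atTop (𝓝 0) := by
        have h1 := ENNReal.tendsto_ofReal (hM2.const_mul (2 * (m : ℝ)))
        rw [mul_zero, ENNReal.ofReal_zero] at h1
        exact tendsto_of_tendsto_of_tendsto_of_le_of_le' tendsto_const_nhds h1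
          (Eventually.of_forall fun _ ↦ bot_le) (hMn.mono fun n hn ↦ hn.2)
      simpa using ENNReal.Tendsto.const_mul h0 (Or.inr (ENNReal.natCast_ne_top m))
    · refine tendsto_lintegral_of_dominated_convergence (fun _ ↦ 1)
        (fun n ↦ (hFm n).comp (measurable_delayed (measurable_birthTime _ _) _))
        (fun n ↦ Eventually.of_forall fun y ↦ ?_) (by simp) ?_
      · rw [← ENNReal.ofReal_one]
        exact ENNReal.ofReal_le_ofReal (by
          linarith [freeBound_nonneg (1 / (n : ℝ)) (q n) (M n)
            (delayed (t n) fun k ↦ birthTime 1 (growthSteps n) (y k))])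
      filter_upwards [iidExp_ae_pos (κ := κ)] with y hy
      have h := tendsto_freeBound (M := M) tendsto_growthSteps
        (fun _ ↦ rfl) hq1' hqM hqn hM2 hy x
        (tendsto_delayed (M := M) (q := fun _ ↦ 1) tendsto_growthSteps
        (fun _ ↦ rfl) tendsto_const_nhds (by simp) hy x)
      exact ENNReal.tendsto_ofReal (h.const_sub 1)
  · filter_upwards [eventually_gt_atTop 0, hMn, tendsto_growthSteps.eventually_gt_atTop 0]
      with n hn hMn hKn
    have hn' : (0 : ℝ) < n := by positivity
    have hr : Fact (0 < 1 / (n : ℝ)) := ⟨by positivity⟩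
    have hrV : 1 / (n : ℝ) * Fintype.card (Fin n) ≤ 1 := by simp [hn.ne']
    have key := le_lintegral_of_step (κ := κ) (fun σ _ ↦ nearBound (Fin n) (1 / (n : ℝ)) σ)
      (K := growthSteps n) (N := 0) (C := C n)
      (measurable_birthTime 1 (growthSteps n)) (fun σ i N' t hσ _ ht ↦ ?_) (hFm n)
      (fun t ht ↦ ?_) (t := t n) (fun k l ↦ by simp only [ht]; rw [hx])
    · exact key
    · have := nearBound_le_lintegral_birthTime hrV hKn.ne' (by simpa using hMn.1) σ hσ i t
      simp only [hC, hm]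
      simpa using this
    · exact nearBound_le hrV (by omega) (le_of_eq rfl) ht

end

/-! ### Conditioning on the absence of rare increasing events. -/

section Conditioning
variable {ι : Type*} [Fintype ι] [DecidableEq ι] (μ : ι → Measure ℝ)
  [∀ i, IsProbabilityMeasure (μ i)]

lemma measureReal_pi_inter_compl_le {D A : Set (ι → ℝ)} (hD : IsUpperSet D) (hA : IsUpperSet A)
    (hDm : MeasurableSet D) (hAm : MeasurableSet A) :
    (Measure.pi μ).real (D ∩ Aᶜ) ≤ (Measure.pi μ).real D * (Measure.pi μ).real Aᶜ := by
  have h1 := ENNReal.toReal_mono (measure_ne_top _ _) (measure_pi_mul_le_inter μ hD hA hDm hAm)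
  rw [ENNReal.toReal_mul] at h1
  have h2 := measureReal_inter_add_sdiff (μ := Measure.pi μ) (s := D) hAm
  rw [Set.sdiff_eq] at h2
  rw [probReal_compl_eq_one_sub hAm]
  simp only [Measure.real] at *
  linarith

/-- For an increasing event `D` which is hardly correlated with the increasing events `A v`, the
intersection of the complements of the `A v` hardly changes the probability of `D`. -/
lemma le_measureReal_pi_inter_compl {β : Type*} (s : Finset β) {A : β → Set (ι → ℝ)}
    {D : Set (ι → ℝ)} (hD : IsUpperSet D) (hA : ∀ b, IsUpperSet (A b))
    (hDm : MeasurableSet D) (hAm : ∀ b, MeasurableSet (A b)) {l u : ℝ}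
    (hl : l ≤ (Measure.pi μ).real D)
    (hu : ∀ b ∈ s, (Measure.pi μ).real (D ∩ A b) ≤ u * (Measure.pi μ).real (A b)) :
    l * (Measure.pi μ).real (⋃ b ∈ s, A b)ᶜ - (u - l) * ∑ b ∈ s, (Measure.pi μ).real (A b)
      ≤ (Measure.pi μ).real (D ∩ (⋃ b ∈ s, A b)ᶜ) := by
  set π := Measure.pi μ with hπ
  set B := ⋃ b ∈ s, A b with hB
  have hBm : MeasurableSet B := Finset.measurableSet_biUnion _ fun b _ ↦ hAm b
  set N : (ι → ℝ) → ℝ≥0∞ := fun w ↦ ∑ b ∈ s, (A b).indicator 1 w with hN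
  have hNm : Measurable N := Finset.measurable_fun_sum _ fun b _ ↦ measurable_one.indicator (hAm b)
  have hNmono : Monotone N := fun w w' h ↦
    Finset.sum_le_sum fun b _ ↦ monotone_indicator_one (hA b) h
  -- With truncated subtraction this is the positive part of `N - 1`, which equals `N` minus the
  -- indicator of `B` but is visibly increasing. Harris applied to `D` and `g` bounds the
  -- probability of `D ∩ B` from above, which the union bound alone would not do sharply enough.
  set g : (ι → ℝ) → ℝ≥0∞ := fun w ↦ N w - 1 with hg
  have hgm : Measurable g := hNm.sub measurable_const
  have hgmono : Monotone g := fun w w' h ↦ tsub_le_tsub_right (hNmono h) 1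
  have hgN : ∀ w, g w + B.indicator 1 w = N w := by
    intro w
    by_cases hw : w ∈ B
    · obtain ⟨b, hb, hwb⟩ : ∃ b ∈ s, w ∈ A b := by simpa [hB] using hw
      have : 1 ≤ N w := by
        have h := Finset.single_le_sum (f := fun b ↦ (A b).indicator (1 : (ι → ℝ) → ℝ≥0∞) w)
          (fun _ _ ↦ bot_le) hb
        simpa [hwb] using h
      simp only [hg, hw, Set.indicator_of_mem, Pi.one_apply]
      exact tsub_add_cancel_of_le this
    · have : N w = 0 := Finset.sum_eq_zero fun b hb ↦ Set.indicator_of_notMem (fun h ↦ hw (by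
        simp only [hB, Set.mem_iUnion]; exact ⟨b, hb, h⟩)) _
      simp [hg, hw, this]
  have hNint : ∫⁻ w, N w ∂π = ∑ b ∈ s, π (A b) := by
    simp only [hN]
    rw [lintegral_finsetSum _ fun b _ ↦ measurable_one.indicator (hAm b)]
    exact Finset.sum_congr rfl fun b _ ↦ lintegral_indicator_one (hAm b)
  have e1 : ∫⁻ w, g w ∂π + π B = ∑ b ∈ s, π (A b) := by
    rw [← hNint, ← lintegral_indicator_one hBm, ← lintegral_add_left hgm]
    exact lintegral_congr hgN
  have e2 : ∫⁻ w, D.indicator 1 w * g w ∂π + π (D ∩ B) = ∑ b ∈ s, π (D ∩ A b) := by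
    have hm : Measurable fun w ↦ D.indicator (1 : (ι → ℝ) → ℝ≥0∞) w * g w :=
      (measurable_one.indicator hDm).mul hgm
    rw [← lintegral_indicator_one (hDm.inter hBm), ← lintegral_add_left hm]
    have : ∀ b ∈ s, π (D ∩ A b) = ∫⁻ w, (D ∩ A b).indicator 1 w ∂π := fun b _ ↦
      (lintegral_indicator_one (hDm.inter (hAm b))).symm
    rw [Finset.sum_congr rfl this, ← lintegral_finsetSum _ fun b _ ↦
      measurable_one.indicator (hDm.inter (hAm b))]
    refine lintegral_congr fun w ↦ ?_
    simp only [Set.inter_indicator_one, Pi.mul_apply]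
    rw [← mul_add, hgN w, Finset.mul_sum]
  have hfin : ∫⁻ w, g w ∂π ≠ ⊤ := by
    refine ne_top_of_le_ne_top ?_ (le_self_add.trans e1.le)
    exact (ENNReal.sum_lt_top.2 fun b _ ↦ measure_lt_top _ _).ne
  have hfin2 : ∫⁻ w, D.indicator 1 w * g w ∂π ≠ ⊤ := by
    refine ne_top_of_le_ne_top ?_ (le_self_add.trans e2.le)
    exact (ENNReal.sum_lt_top.2 fun b _ ↦ measure_lt_top _ _).ne
  have h := lintegral_pi_mul_le_of_monotone μ (monotone_indicator_one hD) hgmono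
    (measurable_one.indicator hDm) hgm
  rw [lintegral_indicator_one hDm] at h
  have h' := ENNReal.toReal_mono hfin2 h
  rw [ENNReal.toReal_mul] at h'
  have e1' := congrArg ENNReal.toReal e1
  have e2' := congrArg ENNReal.toReal e2
  rw [ENNReal.toReal_add hfin (measure_ne_top _ _), ENNReal.toReal_sum fun b _ ↦
    measure_ne_top _ _] at e1'
  rw [ENNReal.toReal_add hfin2 (measure_ne_top _ _), ENNReal.toReal_sum fun b _ ↦
    measure_ne_top _ _] at e2'
  have h3 := measureReal_inter_add_sdiff (μ := π) (s := D) hBm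
  rw [Set.sdiff_eq] at h3
  have h4 : ∑ b ∈ s, π.real (D ∩ A b) ≤ u * ∑ b ∈ s, π.real (A b) := by
    rw [Finset.mul_sum]; exact Finset.sum_le_sum hu
  rw [probReal_compl_eq_one_sub hBm]
  have h5 : 0 ≤ π.real B := measureReal_nonneg
  have h6 : 0 ≤ (∫⁻ w, g w ∂π).toReal := ENNReal.toReal_nonneg
  simp only [Measure.real] at *
  have h7 : π B ≤ 1 := prob_le_one
  have h8 : (π B).toReal ≤ 1 := ENNReal.toReal_le_of_le_ofReal zero_le_one (by simpa using h7)
  set γ := (∫⁻ w, g w ∂π).toReal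
  set bB := (π B).toReal
  set dD := (π D).toReal
  set μs := ∑ b ∈ s, (π (A b)).toReal
  have h9 : γ = μs - bB := by linarith
  have h10 := mul_nonneg (sub_nonneg.2 hl) (show 0 ≤ μs by linarith)
  have h11 := mul_nonneg (sub_nonneg.2 hl) (sub_nonneg.2 h8)
  rw [h9] at h'
  linarith [h', h10, h11, h3, h4, e2']

lemma prod_le_measureReal_pi_compl {β : Type*} (s : Finset β) {A : β → Set (ι → ℝ)}
    (hA : ∀ b, IsUpperSet (A b)) (hAm : ∀ b, MeasurableSet (A b)) :
    ∏ b ∈ s, (1 - (Measure.pi μ).real (A b)) ≤ (Measure.pi μ).real (⋃ b ∈ s, A b)ᶜ := by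
  classical
  induction s using Finset.induction_on with
  | empty => simp
  | insert b s hb ih =>
    set B := ⋃ b ∈ s, A b with hB
    have hBm : MeasurableSet B := Finset.measurableSet_biUnion _ fun b _ ↦ hAm b
    have hBu : IsUpperSet B := isUpperSet_iUnion₂ fun b _ ↦ hA b
    have h1 := measureReal_pi_inter_compl_le μ (hA b) hBu (hAm b) hBm
    have h2 := measureReal_inter_add_sdiff (μ := Measure.pi μ) (s := Bᶜ) (hAm b)
    rw [Finset.prod_insert hb, Finset.set_biUnion_insert, Set.compl_union]
    rw [Set.inter_comm (A b)] at h1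
    rw [Set.sdiff_eq, Set.inter_comm Bᶜ (A b)ᶜ] at h2
    have h3 : 0 ≤ 1 - (Measure.pi μ).real (A b) := sub_nonneg.2 measureReal_le_one
    nlinarith [mul_le_mul_of_nonneg_left ih h3]

end Conditioning

/-! ### Distances, slow vertices and the lengthening of edges touching a set. -/

section Graph
variable {n : ℕ}

lemma le_minIncidentWeight_iff (hn : 2 ≤ n) {w : Sym2 (Fin n) → ℝ} {i : Fin n} {c : ℝ} :
    c ≤ minIncidentWeight w i ↔ ∀ j, j ≠ i → c ≤ w s(i, j) := by
  have : Nontrivial (Fin n) := Fin.nontrivial_iff_two_le.2 hn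
  obtain ⟨j, hj⟩ := exists_ne i
  have : Nonempty {j : Fin n // j ≠ i} := ⟨⟨j, hj⟩⟩
  rw [minIncidentWeight, le_ciInf_iff (Set.finite_range _).bddBelow]
  simp

lemma SimpleGraph.Walk.exists_walkCost_eq (w : Sym2 (Fin n) → ℝ) {i j : Fin n}
    (p : (⊤ : SimpleGraph (Fin n)).Walk i j) (hp : ¬ p.Nil) :
    ∃ l, p.support = i :: (l ++ [j]) ∧ pathLength w p = walkCost (edgeCost w) i l j := by
  induction p with
  | nil => simp at hp
  | cons h p ih =>
    cases p with
    | nil => exact ⟨[], by simp, by simp [pathLength, edgeCost]⟩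
    | cons h' p =>
      obtain ⟨l, h1, h2⟩ := ih (by simp)
      refine ⟨_ :: l, by rw [SimpleGraph.Walk.support_cons, h1]; rfl, ?_⟩
      rw [walkCost_cons, ← h2]
      simp [pathLength, edgeCost]

lemma exists_walk_of_nodup (w : Sym2 (Fin n) → ℝ) {i j : Fin n} (l : List (Fin n))
    (h : (i :: (l ++ [j])).Nodup) :
    ∃ p : (⊤ : SimpleGraph (Fin n)).Walk i j, p.support = i :: (l ++ [j]) ∧
      pathLength w p = walkCost (edgeCost w) i l j := by
  induction l generalizing i with
  | nil =>
    have hij : i ≠ j := by simpa using h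
    exact ⟨.cons (by simpa using hij) .nil, by simp, by simp [pathLength, edgeCost]⟩
  | cons a l ih =>
    rw [List.nodup_cons] at h
    obtain ⟨p, h1, h2⟩ := ih h.2
    have hia : i ≠ a := fun hia ↦ h.1 (by simp [hia])
    refine ⟨.cons (by simpa using hia) p, by simp [h1], ?_⟩
    rw [walkCost_cons, ← h2]
    simp [pathLength, edgeCost]

lemma le_weightedDist_iff {w : Sym2 (Fin n) → ℝ} {i j : Fin n} (hij : i ≠ j) {t : ℝ} :
    t ≤ weightedDist w i j ↔
      ∀ l : List (Fin n), (i :: (l ++ [j])).Nodup → t ≤ walkCost (edgeCost w) i l j := by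
  have hpath : ∀ l : List (Fin n), (i :: (l ++ [j])).Nodup →
      ∃ p : (⊤ : SimpleGraph (Fin n)).Path i j,
        pathLength w p.1 = walkCost (edgeCost w) i l j := fun l hl ↦ by
    obtain ⟨p, h1, h2⟩ := exists_walk_of_nodup w l hl
    exact ⟨⟨p, (SimpleGraph.Walk.isPath_def p).2 (h1 ▸ hl)⟩, h2⟩
  obtain ⟨p₀, -⟩ := hpath [] (by simpa using hij)
  have : Nonempty ((⊤ : SimpleGraph (Fin n)).Path i j) := ⟨p₀⟩
  rw [weightedDist, le_ciInf_iff (Set.finite_range _).bddBelow]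
  constructor
  · intro h l hl
    obtain ⟨p, hp⟩ := hpath l hl
    exact hp ▸ h p
  · intro h p
    obtain ⟨l, h1, h2⟩ := p.1.exists_walkCost_eq w (fun h ↦ hij h.eq)
    rw [h2]
    exact h l (h1 ▸ (SimpleGraph.Walk.isPath_def _).1 p.2)

lemma measurable_weightedDist {i j : Fin n} (hij : i ≠ j) :
    Measurable fun w : Sym2 (Fin n) → ℝ ↦ weightedDist w i j := by
  refine measurable_of_Ici fun t ↦ ?_
  have : (fun w : Sym2 (Fin n) → ℝ ↦ weightedDist w i j) ⁻¹' Set.Ici t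
      = ⋂ (l : List (Fin n)) (_ : (i :: (l ++ [j])).Nodup),
        {w | t ≤ walkCost (edgeCost w) i l j} := by
    ext w
    simp [le_weightedDist_iff hij]
  rw [this]
  exact MeasurableSet.iInter fun l ↦ MeasurableSet.iInter fun _ ↦
    measurableSet_le measurable_const (measurable_walkCost measurable_edgeCost _ _ _)

lemma walkCost_congr {V : Type*} {f g : V → V → ℝ} {O : Set V} (h : ∀ a ∈ O, ∀ b ∈ O, f a b = g a b)
    {u y : V} {l : List V} (hu : u ∈ O) (hy : y ∈ O) (hl : ∀ v ∈ l, v ∈ O) :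
    walkCost f u l y = walkCost g u l y := by
  induction l generalizing u with
  | nil => exact h _ hu _ hy
  | cons a l ih =>
    rw [walkCost_cons, walkCost_cons, h _ hu _ (hl a (by simp)),
      ih (hl a (by simp)) fun v hv ↦ hl v (by simp [hv])]

/-- The edges with an end point in `S`. -/
def touchingEdges (S : Finset (Fin n)) : Finset (Sym2 (Fin n)) :=
  {e | ¬ e.IsDiag ∧ ∃ v ∈ S, v ∈ e}

lemma mem_touchingEdges {S : Finset (Fin n)} {a b : Fin n} :
    s(a, b) ∈ touchingEdges S ↔ a ≠ b ∧ (a ∈ S ∨ b ∈ S) := by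
  simp only [touchingEdges, Finset.mem_filter, Finset.mem_univ, true_and, Sym2.mk_isDiag_iff,
    Sym2.mem_iff]
  refine and_congr Iff.rfl ⟨?_, ?_⟩
  · rintro ⟨v, hv, rfl | rfl⟩
    · exact Or.inl hv
    · exact Or.inr hv
  · rintro (h | h)
    · exact ⟨a, h, Or.inl rfl⟩
    · exact ⟨b, h, Or.inr rfl⟩

/-- Every edge between `v` and another vertex outside `S` has length at least `c`. -/
def isolatedEvent (S : Finset (Fin n)) (c : ℝ) (v : Fin n) : Set (Sym2 (Fin n) → ℝ) :=
  {w | ∀ e ∈ crossEdges {v} (Sᶜ.erase v), c ≤ w e}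

lemma measurableSet_isolatedEvent (S : Finset (Fin n)) (c : ℝ) (v : Fin n) :
    MeasurableSet (isolatedEvent S c v) := by
  have : isolatedEvent S c v = ⋂ e ∈ crossEdges {v} (Sᶜ.erase v), {w | c ≤ w e} := by
    ext w; simp [isolatedEvent]
  rw [this]
  exact Finset.measurableSet_biInter _ fun e _ ↦
    measurableSet_le measurable_const (measurable_pi_apply e)

lemma isUpperSet_isolatedEvent (S : Finset (Fin n)) (c : ℝ) (v : Fin n) :
    IsUpperSet (isolatedEvent S c v) := fun _ _ h hw e he ↦ (hw e he).trans (h e)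

/-- Splits the event into edges touching `S` and edges inside the complement. When the former are
all long, a vertex outside `S` is slow exactly if its edges inside the complement are long too. The
two conditions involve disjoint sets of edges. -/
lemma slowVertices_eq_iff (hn : 2 ≤ n) {α : ℝ} {w : Sym2 (Fin n) → ℝ} {S : Finset (Fin n)} :
    slowVertices α w = S ↔ w ∈ (⋃ v ∈ Sᶜ, isolatedEvent S (Real.log n - α) v)ᶜ ∧
      ∀ e ∈ touchingEdges S, Real.log n - α ≤ w e := by
  set c := Real.log n - α with hc
  have hslow : ∀ i, i ∈ slowVertices α w ↔ ∀ j, j ≠ i → c ≤ w s(i, j) := fun i ↦ by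
    rw [slowVertices, Finset.mem_filter, le_minIncidentWeight_iff hn]
    simp [hc]
  have htouch : (∀ e ∈ touchingEdges S, c ≤ w e) ↔ ∀ i ∈ S, i ∈ slowVertices α w := by
    constructor
    · intro h i hi
      rw [hslow]
      exact fun j hj ↦ h _ (mem_touchingEdges.2 ⟨hj.symm, Or.inl hi⟩)
    · intro h e
      induction e using Sym2.ind with
      | _ a b =>
        rw [mem_touchingEdges]
        rintro ⟨hab, ha | hb⟩
        · exact (hslow a).1 (h a ha) b hab.symm
        · rw [Sym2.eq_swap]; exact (hslow b).1 (h b hb) a hab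
  have hiso : ∀ v ∉ S, (∀ e ∈ touchingEdges S, c ≤ w e) →
      (w ∈ isolatedEvent S c v ↔ v ∈ slowVertices α w) := by
    intro v hv ht
    rw [hslow]
    constructor
    · intro h j hj
      by_cases hjS : j ∈ S
      · exact ht _ (mem_touchingEdges.2 ⟨hj.symm, Or.inr hjS⟩)
      · exact h _ (mem_crossEdges.2 (Or.inl ⟨by simp, by simp [hj, hjS]⟩))
    · intro h e
      induction e using Sym2.ind with
      | _ a b =>
        rw [mem_crossEdges]
        rintro (⟨ha, hb⟩ | ⟨hb, ha⟩)
        · rw [Finset.mem_singleton] at ha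
          subst ha
          exact h b (Finset.ne_of_mem_erase hb)
        · rw [Finset.mem_singleton] at hb
          subst hb
          rw [Sym2.eq_swap]
          exact h a (Finset.ne_of_mem_erase ha)
  simp only [Set.mem_compl_iff, Set.mem_iUnion, not_exists, Finset.mem_compl]
  constructor
  · rintro rfl
    have ht := htouch.2 fun i hi ↦ hi
    exact ⟨fun v hv h ↦ hv ((hiso v hv ht).1 h), ht⟩
  · rintro ⟨h1, ht⟩
    ext v
    by_cases hv : v ∈ S
    · exact iff_of_true (htouch.1 ht v hv) hv
    · exact iff_of_false (fun h ↦ h1 v hv ((hiso v hv ht).2 h)) hv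

lemma shiftOn_mem_isolatedEvent_iff {S : Finset (Fin n)} {c x : ℝ} {v : Fin n} (hv : v ∉ S)
    {w : Sym2 (Fin n) → ℝ} :
    shiftOn (touchingEdges S) x w ∈ isolatedEvent S c v ↔ w ∈ isolatedEvent S c v := by
  refine forall₂_congr fun e he ↦ ?_
  have : e ∉ touchingEdges S := by
    induction e using Sym2.ind with
    | _ a b =>
      rw [mem_crossEdges] at he
      rw [mem_touchingEdges]
      rcases he with ⟨ha, hb⟩ | ⟨hb, ha⟩ <;> simp only [Finset.mem_singleton, Finset.mem_erase,
        Finset.mem_compl] at ha hb <;> grind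
  simp [shiftOn, this]

variable {S : Finset (Fin n)} {c : ℝ} {w : Sym2 (Fin n) → ℝ}

lemma shiftOn_le_add (hc : 0 ≤ c) (e : Sym2 (Fin n)) : shiftOn (touchingEdges S) c w e ≤ c + w e := by
  unfold shiftOn; split_ifs <;> linarith

lemma le_shiftOn {ι : Type*} [DecidableEq ι] (K : Finset ι) (hc : 0 ≤ c) (w : ι → ℝ) :
    w ≤ shiftOn K c w := by
  intro e; unfold shiftOn; split_ifs <;> linarith

lemma walkCost_shiftOn_le (hc : 0 ≤ c) {u y : Fin n} {l : List (Fin n)} (hu : u ∉ S)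
    (hl : ∀ v ∈ l, v ∉ S) : walkCost (edgeCost (shiftOn (touchingEdges S) c w)) u l y
      ≤ c + walkCost (edgeCost w) u l y := by
  induction l generalizing u with
  | nil => exact shiftOn_le_add hc _
  | cons a l ih =>
    have ha := hl a (by simp)
    have h1 := ih ha fun v hv ↦ hl v (by simp [hv])
    have h2 : edgeCost (shiftOn (touchingEdges S) c w) u a = edgeCost w u a := by
      have : s(u, a) ∉ touchingEdges S := by rw [mem_touchingEdges]; tauto
      simp [edgeCost, shiftOn, this]
    rw [walkCost_cons, walkCost_cons, h2]
    linarith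

lemma edgeCost_shiftOn {u a : Fin n} (hua : u ≠ a) (h : u ∈ S ∨ a ∈ S) :
    edgeCost (shiftOn (touchingEdges S) c w) u a = c + edgeCost w u a := by
  simp [edgeCost, shiftOn, mem_touchingEdges, hua, h]

lemma le_walkCost_shiftOn (hc : 0 ≤ c) {u y : Fin n} {l : List (Fin n)} (hy : y ∈ S)
    (hl : (u :: (l ++ [y])).Nodup) : c + walkCost (edgeCost w) u l y
      ≤ walkCost (edgeCost (shiftOn (touchingEdges S) c w)) u l y := by
  induction l generalizing u with
  | nil => exact (edgeCost_shiftOn (by simpa using hl) (Or.inr hy)).ge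
  | cons a l ih =>
    rw [List.nodup_cons] at hl
    have h1 := ih hl.2
    have h2 : edgeCost w u a ≤ edgeCost (shiftOn (touchingEdges S) c w) u a :=
      le_shiftOn (touchingEdges S) hc w s(u, a)
    rw [walkCost_cons, walkCost_cons]
    linarith

/-- A path with interior outside `S` touches `S` only through its first and last edges, so the
lengthening adds at most `2 c`. -/
lemma separated_of_le_weightedDist (hc : 0 ≤ c) {u y : Fin n} (hu : u ∈ S) (hy : y ∈ S)
    (huy : u ≠ y) {t : ℝ} (h : t ≤ weightedDist (shiftOn (touchingEdges S) c w) u y) :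
    Separated w Sᶜ {u} {y} (t - 2 * c) := by
  rw [le_weightedDist_iff huy] at h
  intro u' hu' y' hy' l hl hlS
  rw [Finset.mem_singleton] at hu' hy'
  subst hu' hy'
  have hlS' : ∀ v ∈ l, v ∉ S := fun v hv ↦ Finset.mem_compl.1 (hlS v hv)
  have h1 := h l (by
    rw [List.nodup_cons, List.nodup_append]
    refine ⟨?_, hl, by simp, ?_⟩
    · simp only [List.mem_append, List.mem_singleton, not_or]
      exact ⟨fun h ↦ hlS' _ h hu, huy⟩
    · intro a ha b hb
      rw [List.mem_singleton] at hb
      subst hb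
      rintro rfl
      exact hlS' _ ha hy)
  cases l with
  | nil =>
    rw [walkCost_nil, edgeCost_shiftOn huy (Or.inl hu)] at h1
    rw [walkCost_nil]; linarith
  | cons a l =>
    have ha := hlS' a (by simp)
    rw [walkCost_cons, edgeCost_shiftOn (by rintro rfl; exact ha hu) (Or.inl hu)] at h1
    have h2 := walkCost_shiftOn_le (w := w) (y := y') (l := l) hc ha fun v hv ↦ hlS' v (by simp [hv])
    rw [walkCost_cons]
    linarith

/-- A path with an interior vertex has two distinct end edges touching `S`, so it gains at least `2
c`. The direct edge gains only `c`, hence its separate hypothesis. -/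
lemma le_weightedDist_shiftOn (hc : 0 ≤ c) {u y : Fin n} (hu : u ∈ S) (hy : y ∈ S)
    (huy : u ≠ y) {t : ℝ} (h1 : ∀ l, t - 2 * c ≤ walkCost (edgeCost w) u l y)
    (h2 : t - c ≤ w s(u, y)) : t ≤ weightedDist (shiftOn (touchingEdges S) c w) u y := by
  rw [le_weightedDist_iff huy]
  intro l hl
  cases l with
  | nil =>
    rw [walkCost_nil, edgeCost_shiftOn huy (Or.inl hu), edgeCost]; linarith
  | cons a l =>
    rw [List.cons_append, List.nodup_cons] at hl
    rw [walkCost_cons, edgeCost_shiftOn (by rintro rfl; exact hl.1 (by simp)) (Or.inl hu)]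
    have h3 := le_walkCost_shiftOn (w := w) hc hy hl.2
    have h4 := h1 (a :: l)
    rw [walkCost_cons] at h4
    linarith

end Graph

/-! ### Far vertices after the lengthening, and isolated vertices. -/

section
variable {n m : ℕ}

/-- The symmetric array that extends `x`. -/
def symmExt (x : OrderedPairs m → ℝ) (k l : Fin m) : ℝ :=
  if h : k < l then x ⟨(k, l), h⟩ else if h : l < k then x ⟨(l, k), h⟩ else 0

lemma symmExt_symm (x : OrderedPairs m → ℝ) (k l : Fin m) : symmExt x k l = symmExt x l k := by
  unfold symmExt
  rcases lt_trichotomy k l with h | h | h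
  · simp [h, h.not_gt]
  · simp [h]
  · simp [h, h.not_gt]

lemma symmExt_apply (x : OrderedPairs m → ℝ) (p : OrderedPairs m) :
    symmExt x p.1.1 p.1.2 = x p := by simp [symmExt, p.2]

variable {S : Finset (Fin n)} {c : ℝ}

/-- After the edges touching `S` are lengthened by `c`, the distances are at least `t`. -/
def farEvent (v : Fin m ≃ S) (c : ℝ) (t : OrderedPairs m → ℝ) : Set (Sym2 (Fin n) → ℝ) :=
  {w | ∀ p : OrderedPairs m,
    t p ≤ weightedDist (shiftOn (touchingEdges S) c w) (v p.1.1) (v p.1.2)}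

lemma Equiv.coe_ne_coe {v : Fin m ≃ S} {k l : Fin m} (h : k ≠ l) : (v k : Fin n) ≠ v l :=
  fun h' ↦ h (v.injective (Subtype.ext h'))

lemma measurableSet_farEvent (v : Fin m ≃ S) (c : ℝ) (t : OrderedPairs m → ℝ) :
    MeasurableSet (farEvent v c t) := by
  have : farEvent v c t = ⋂ p : OrderedPairs m, shiftOn (touchingEdges S) c ⁻¹'
      {w | t p ≤ weightedDist w (v p.1.1) (v p.1.2)} := by
    ext w; simp [farEvent]
  rw [this]
  exact MeasurableSet.iInter fun p ↦ measurable_shiftOn _ _ (measurableSet_le measurable_const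
    (measurable_weightedDist (Equiv.coe_ne_coe p.2.ne)))

lemma isUpperSet_farEvent (v : Fin m ≃ S) (c : ℝ) (t : OrderedPairs m → ℝ) :
    IsUpperSet (farEvent v c t) := by
  intro w w' h hw p
  have h1 := hw p
  have hne := Equiv.coe_ne_coe (v := v) p.2.ne
  rw [le_weightedDist_iff hne] at h1 ⊢
  refine fun l hl ↦ (h1 l hl).trans (walkCost_mono (fun a b ↦ ?_) _ _ _)
  have := h s(a, b)
  simp only [edgeCost, shiftOn]
  split_ifs <;> linarith

/-- The clusters consisting of single vertices of `S` are separated in `O`. -/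
def sepEvent (v : Fin m ≃ S) (O : Finset (Fin n)) (t : Fin m → Fin m → ℝ) :
    Set (Sym2 (Fin n) → ℝ) :=
  {w | ∀ k l, k ≠ l → Separated w O {(v k : Fin n)} {(v l : Fin n)} (t k l)}

lemma iidExp_sepEvent_le (v : Fin m ≃ S) (O : Finset (Fin n)) (hO : Disjoint S O) {N : ℕ}
    (hN : N ≤ O.card) (r : ℝ) (t : Fin m → Fin m → ℝ) :
    iidExp (Sym2 (Fin n)) r (sepEvent v O t) ≤ sepBound (Fin n) r (fun _ ↦ 1) N t :=
  le_sepBound (B := fun k ↦ {(v k : Fin n)}) (O := O) ⟨fun _ ↦ rfl, fun k l h ↦ by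
    rw [Finset.disjoint_singleton]; exact Equiv.coe_ne_coe h, fun k ↦ by
    simpa using Finset.disjoint_left.1 hO (v k).2, hN⟩

lemma farEvent_subset_sepEvent (hc : 0 ≤ c) (v : Fin m ≃ S) {a : ℝ} (x : OrderedPairs m → ℝ)
    {O : Finset (Fin n)} (hO : O ⊆ Sᶜ) :
    farEvent v c (fun p ↦ a + 2 * c + x p) ⊆ sepEvent v O fun k l ↦ a + symmExt x k l := by
  intro w hw
  have key : ∀ k l, k < l →
      Separated w O {(v k : Fin n)} {(v l : Fin n)} (a + symmExt x k l) := by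
    intro k l h
    have h1 := separated_of_le_weightedDist hc (v k).2 (v l).2 (Equiv.coe_ne_coe h.ne)
      (hw ⟨(k, l), h⟩)
    refine h1.anti hO (le_of_eq ?_)
    have := symmExt_apply x ⟨(k, l), h⟩
    simp only at this ⊢
    rw [this]; ring
  intro k l hkl
  rcases lt_or_gt_of_ne hkl with h | h
  · exact key k l h
  · have := (key l k h).symm
    rwa [symmExt_symm] at this

open Classical in
/-- The colouring in which the vertices of `S` have different colours. -/
noncomputable def starColour (v : Fin m ≃ S) (a : Fin n) : Option (Fin m) :=
  if h : a ∈ S then some (v.symm ⟨a, h⟩) else none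

lemma starColour_eq_some_iff (v : Fin m ≃ S) (a : Fin n) (k : Fin m) :
    starColour v a = some k ↔ a = v k := by
  unfold starColour
  split_ifs with h
  · rw [Option.some_inj, Equiv.symm_apply_eq, Subtype.ext_iff]
  · simp only [false_iff]
    rintro rfl
    exact h (v k).2

lemma card_colourClass_starColour (v : Fin m ≃ S) (k : Fin m) :
    (colourClass (starColour v) k).card = 1 := by
  rw [Finset.card_eq_one]
  exact ⟨v k, by ext a; simp [starColour_eq_some_iff]⟩

lemma freeCost_le {κ : Type*} [DecidableEq κ] (col : Fin n → Option κ) {w : Sym2 (Fin n) → ℝ}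
    (hw : ∀ e, 0 ≤ w e) (a b : Fin n) : freeCost col w a b ≤ edgeCost w a b := by
  unfold freeCost
  split_ifs
  · exact hw _
  · exact le_rfl

lemma mem_farEvent (hc : 0 ≤ c) (v : Fin m ≃ S) {a b : ℝ} (x : OrderedPairs m → ℝ)
    {w : Sym2 (Fin n) → ℝ} (hw : ∀ e, 0 ≤ w e)
    (h1 : ¬ ∃ k l, k ≠ l ∧ FreeNear (starColour v) w k l (a + symmExt x k l))
    (hb : ∀ p, a + c + x p ≤ b) (h2 : ∀ e ∈ crossEdges S S, b ≤ w e) :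
    w ∈ farEvent v c (fun p ↦ a + 2 * c + x p) := by
  intro p
  have hne := Equiv.coe_ne_coe (v := v) p.2.ne
  refine le_weightedDist_shiftOn hc (v _).2 (v _).2 hne (fun l ↦ ?_) ?_
  · by_contra! h
    refine h1 ⟨p.1.1, p.1.2, p.2.ne, v p.1.1, v p.1.2, l, by rw [starColour_eq_some_iff],
      by rw [starColour_eq_some_iff], ?_⟩
    have h3 := walkCost_mono (freeCost_le (starColour v) hw) (v p.1.1 : Fin n) (v p.1.2) l
    rw [symmExt_apply]
    linarith
  · have := h2 s((v p.1.1 : Fin n), (v p.1.2 : Fin n))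
      (mem_crossEdges.2 (Or.inl ⟨(v _).2, (v _).2⟩))
    have := hb p
    linarith

variable {r : ℝ} [hr : Fact (0 < r)]

/-- The exponential factor is the cost of making all direct edges inside `S` at least `b`, at most
`m^2` of them counting loops. By memorylessness this only increases the other lengths, which cannot
create closeness. -/
lemma le_iidExp_farEvent (hc : 0 ≤ c) (v : Fin m ≃ S) {a b : ℝ} (x : OrderedPairs m → ℝ)
    (hb0 : 0 ≤ b) (hb : ∀ p, a + c + x p ≤ b) :
    Real.exp (-(r * b * m ^ 2)) *
      (1 - (nearBound (Fin n) r (fun _ : Fin m ↦ 1) fun k l ↦ a + symmExt x k l).toReal)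
      ≤ (iidExp (Sym2 (Fin n)) r).real (farEvent v c fun p ↦ a + 2 * c + x p) := by
  have hr0 := hr.out
  set X : Set (Sym2 (Fin n) → ℝ) :=
    {w | ∃ k l, k ≠ l ∧ FreeNear (starColour v) w k l (a + symmExt x k l)} with hX
  have hXm : MeasurableSet X :=
    measurableSet_exists_freeNear (starColour v) fun k l ↦ a + symmExt x k l
  have h1 := iidExp_inter (r := r) (crossEdges S S) hb0 hXm.compl
  have h2 : iidExp (Sym2 (Fin n)) r {w | w ∈ Xᶜ ∧ ∀ e ∈ crossEdges S S, b ≤ w e}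
      ≤ iidExp (Sym2 (Fin n)) r (farEvent v c fun p ↦ a + 2 * c + x p) := by
    refine measure_mono_ae ?_
    filter_upwards [iidExp_ae_nonneg (ι := Sym2 (Fin n)) (r := r)] with w hw h
    exact mem_farEvent hc v x hw h.1 hb h.2
  have h3 : iidExp (Sym2 (Fin n)) r Xᶜ
      ≤ iidExp (Sym2 (Fin n)) r {w | shiftOn (crossEdges S S) b w ∈ Xᶜ} := by
    refine measure_mono fun w hw h ↦ hw ?_
    obtain ⟨k, l, hkl, h⟩ := h
    exact ⟨k, l, hkl, h.anti_weight (le_shiftOn _ hb0 _)⟩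
  rw [h1] at h2
  have h4 := ENNReal.toReal_mono (measure_ne_top _ _) ((mul_le_mul_right h3 _).trans h2)
  rw [ENNReal.toReal_mul, ENNReal.toReal_ofReal (Real.exp_pos _).le] at h4
  refine le_trans ?_ h4
  have h5 : nearBound (Fin n) r (fun _ : Fin m ↦ 1) (fun k l ↦ a + symmExt x k l) ≠ ⊤ :=
    ne_top_of_le_ne_top ENNReal.one_ne_top (iSup₂_le fun _ _ ↦ prob_le_one)
  have h6 := ENNReal.toReal_mono h5 (le_nearBound (r := r) (t := fun k l ↦ a + symmExt x k l)
    (card_colourClass_starColour v))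
  have h7 : 1 - (nearBound (Fin n) r (fun _ : Fin m ↦ 1) fun k l ↦ a + symmExt x k l).toReal
      ≤ (iidExp (Sym2 (Fin n)) r).real Xᶜ := by
    rw [probReal_compl_eq_one_sub hXm]
    exact sub_le_sub_left h6 1
  refine (mul_le_mul_of_nonneg_left h7 (Real.exp_pos _).le).trans ?_
  refine mul_le_mul_of_nonneg_right (Real.exp_le_exp.2 ?_) measureReal_nonneg
  have h8 : ((crossEdges S S).card : ℝ) ≤ m ^ 2 := by
    have h9 : (crossEdges S S).card ≤ S.card * S.card := by
      rw [crossEdges, ← Finset.card_product]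
      exact Finset.card_image_le
    have h10 : S.card = m := by
      rw [← Fintype.card_coe, ← Fintype.card_congr v, Fintype.card_fin]
    rw [h10] at h9
    rw [sq]; exact_mod_cast h9
  have := mul_le_mul_of_nonneg_left h8 (show 0 ≤ r * b by positivity)
  linarith

lemma card_crossEdges_singleton {v : Fin n} (hv : v ∉ S) :
    (crossEdges {v} (Sᶜ.erase v)).card = n - (S.card + 1) := by
  rw [card_crossEdges (by simp), Finset.card_singleton, one_mul, Finset.card_erase_of_mem
    (by simpa using hv), Finset.card_compl, Fintype.card_fin]
  omega

lemma iidExp_isolatedEvent (hc : 0 ≤ c) {v : Fin n} (hv : v ∉ S) :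
    (iidExp (Sym2 (Fin n)) r).real (isolatedEvent S c v)
      = Real.exp (-(r * c * (n - (S.card + 1) : ℕ))) := by
  have h := iidExp_inter (r := r) (crossEdges {v} (Sᶜ.erase v)) hc MeasurableSet.univ
  simp only [Set.mem_univ, true_and, Set.ofPred_true, measure_univ, mul_one] at h
  rw [card_crossEdges_singleton hv] at h
  rw [Measure.real, isolatedEvent, h, ENNReal.toReal_ofReal (Real.exp_pos _).le]

lemma separated_of_shiftOn {u y b : Fin n} {O : Finset (Fin n)} (hb : b ∉ O) (hu : u ≠ b)
    (hy : y ≠ b) {D : Finset (Fin n)} {t : ℝ} {w : Sym2 (Fin n) → ℝ}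
    (h : Separated (shiftOn (crossEdges {b} D) c w) O {u} {y} t) : Separated w O {u} {y} t := by
  intro u' hu' y' hy' l hl hlO
  refine (h u' hu' y' hy' l hl hlO).trans (le_of_eq ?_)
  rw [Finset.mem_singleton] at hu' hy'
  refine walkCost_congr (O := {z | z ≠ b}) (fun p hp q hq ↦ ?_) (hu' ▸ hu) (hy' ▸ hy)
    fun z hz ↦ fun h ↦ hb (h ▸ hlO z hz)
  have : s(p, q) ∉ crossEdges {b} D := by
    rw [mem_crossEdges]
    simp only [Set.mem_ofPred_eq] at hp hq
    simp [hp, hq]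
  simp [edgeCost, shiftOn, this]

/-- Given that `b` is isolated, its edges into the complement are lengthened fresh ones. Discarding
the paths through `b` leaves a separation event that does not see those edges, and one more vertex
is lost: `n - (|S| + 1)`. -/
lemma iidExp_farEvent_inter_le (hc : 0 ≤ c) (v : Fin m ≃ S) {a : ℝ} (x : OrderedPairs m → ℝ)
    {b : Fin n} (hb : b ∉ S) :
    (iidExp (Sym2 (Fin n)) r).real ((farEvent v c fun p ↦ a + 2 * c + x p) ∩ isolatedEvent S c b)
      ≤ (sepBound (Fin n) r (fun _ : Fin m ↦ 1) (n - (S.card + 1))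
          fun k l ↦ a + symmExt x k l).toReal
        * (iidExp (Sym2 (Fin n)) r).real (isolatedEvent S c b) := by
  set Y : Set (Sym2 (Fin n) → ℝ) := sepEvent v (Sᶜ.erase b) fun k l ↦ a + symmExt x k l with hY
  have hYm : MeasurableSet Y := measurableSet_forall_separated (fun k ↦ {(v k : Fin n)}) _ _
  have h1 := iidExp_inter (r := r) (crossEdges {b} (Sᶜ.erase b)) hc hYm
  have h2 : iidExp (Sym2 (Fin n)) r
        ((farEvent v c fun p ↦ a + 2 * c + x p) ∩ isolatedEvent S c b)
      ≤ iidExp (Sym2 (Fin n)) r {w | w ∈ Y ∧ ∀ e ∈ crossEdges {b} (Sᶜ.erase b), c ≤ w e} :=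
    measure_mono fun w hw ↦
      ⟨farEvent_subset_sepEvent hc v x (Finset.erase_subset _ _) hw.1, hw.2⟩
  have h3 : iidExp (Sym2 (Fin n)) r {w | shiftOn (crossEdges {b} (Sᶜ.erase b)) c w ∈ Y}
      ≤ sepBound (Fin n) r (fun _ : Fin m ↦ 1) (n - (S.card + 1))
          fun k l ↦ a + symmExt x k l := by
    refine le_trans (measure_mono fun w hw ↦ ?_) (iidExp_sepEvent_le v (Sᶜ.erase b) ?_ ?_ r _)
    · intro k l hkl
      have hne : ∀ k, (v k : Fin n) ≠ b := fun k h ↦ hb (h ▸ (v k).2)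
      exact separated_of_shiftOn (by simp) (hne k) (hne l) (hw k l hkl)
    · exact disjoint_compl_right.mono_right (Finset.erase_subset _ _)
    · rw [Finset.card_erase_of_mem (by simpa using hb), Finset.card_compl, Fintype.card_fin]
      omega
  rw [h1] at h2
  have h5 : sepBound (Fin n) r (fun _ : Fin m ↦ 1) (n - (S.card + 1))
      (fun k l ↦ a + symmExt x k l) ≠ ⊤ :=
    ne_top_of_le_ne_top ENNReal.one_ne_top (iSup₂_le fun _ _ ↦ iSup_le fun _ ↦ prob_le_one)
  have h4 := ENNReal.toReal_mono (ENNReal.mul_ne_top ENNReal.ofReal_ne_top h5)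
    (h2.trans (mul_le_mul_right h3 _))
  rw [ENNReal.toReal_mul, ENNReal.toReal_ofReal (Real.exp_pos _).le] at h4
  rw [iidExp_isolatedEvent hc hb, mul_comm (ENNReal.toReal _)]
  rw [card_crossEdges_singleton hb] at h4
  exact h4

lemma iidExp_farEvent_le (hc : 0 ≤ c) (v : Fin m ≃ S) {a : ℝ} (x : OrderedPairs m → ℝ) :
    (iidExp (Sym2 (Fin n)) r).real (farEvent v c fun p ↦ a + 2 * c + x p)
      ≤ (sepBound (Fin n) r (fun _ : Fin m ↦ 1) (n - (S.card + 1))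
          fun k l ↦ a + symmExt x k l).toReal := by
  have h5 : sepBound (Fin n) r (fun _ : Fin m ↦ 1) (n - (S.card + 1))
      (fun k l ↦ a + symmExt x k l) ≠ ⊤ :=
    ne_top_of_le_ne_top ENNReal.one_ne_top (iSup₂_le fun _ _ ↦ iSup_le fun _ ↦ prob_le_one)
  refine ENNReal.toReal_mono h5 ((measure_mono
    (farEvent_subset_sepEvent hc v x Finset.Subset.rfl)).trans
    (iidExp_sepEvent_le v Sᶜ disjoint_compl_right ?_ r _))
  rw [Finset.card_compl, Fintype.card_fin]
  omega

/-- The event that no vertex outside `S` is isolated. -/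
def noIsolatedEvent (S : Finset (Fin n)) (c : ℝ) : Set (Sym2 (Fin n) → ℝ) :=
  (⋃ v ∈ Sᶜ, isolatedEvent S c v)ᶜ

lemma measurableSet_noIsolatedEvent (S : Finset (Fin n)) (c : ℝ) :
    MeasurableSet (noIsolatedEvent S c) :=
  (Finset.measurableSet_biUnion _ fun v _ ↦ measurableSet_isolatedEvent S c v).compl

lemma shiftOn_mem_noIsolatedEvent_iff {x : ℝ} {w : Sym2 (Fin n) → ℝ} :
    shiftOn (touchingEdges S) x w ∈ noIsolatedEvent S c ↔ w ∈ noIsolatedEvent S c := by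
  simp only [noIsolatedEvent, Set.mem_compl_iff, Set.mem_iUnion]
  refine not_congr (exists_congr fun v ↦ exists_congr fun hv ↦
    shiftOn_mem_isolatedEvent_iff (Finset.mem_compl.1 hv))

/-- Memorylessness on the edges touching `S`. The lengthening does not affect whether vertices
outside `S` are isolated, and the prefactor does not depend on `X`, so it cancels in conditional
probabilities. -/
lemma iidExp_inter_slowVertices_eq (hn : 2 ≤ n) {α : ℝ} (hα : 0 ≤ Real.log n - α)
    (S : Finset (Fin n)) {X : Set (Sym2 (Fin n) → ℝ)} (hX : MeasurableSet X) :
    (iidExp (Sym2 (Fin n)) r).real {w | w ∈ X ∧ slowVertices α w = S}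
      = Real.exp (-(r * (Real.log n - α) * (touchingEdges S).card)) *
        (iidExp (Sym2 (Fin n)) r).real
          ({w | shiftOn (touchingEdges S) (Real.log n - α) w ∈ X}
            ∩ noIsolatedEvent S (Real.log n - α)) := by
  have h := iidExp_inter (r := r) (touchingEdges S) hα
    (hX.inter (measurableSet_noIsolatedEvent S (Real.log n - α)))
  have e1 : {w : Sym2 (Fin n) → ℝ | w ∈ X ∧ slowVertices α w = S}
      = {w | w ∈ X ∩ noIsolatedEvent S (Real.log n - α) ∧
        ∀ e ∈ touchingEdges S, Real.log n - α ≤ w e} := by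
    ext w
    simp only [Set.mem_ofPred_eq, slowVertices_eq_iff hn, noIsolatedEvent, Set.mem_inter_iff]
    tauto
  have e2 : {w : Sym2 (Fin n) → ℝ | shiftOn (touchingEdges S) (Real.log n - α) w
        ∈ X ∩ noIsolatedEvent S (Real.log n - α)}
      = {w | shiftOn (touchingEdges S) (Real.log n - α) w ∈ X}
            ∩ noIsolatedEvent S (Real.log n - α) := by
    ext w
    simp only [Set.mem_ofPred_eq, Set.mem_inter_iff, shiftOn_mem_noIsolatedEvent_iff]
  rw [Measure.real, e1, h, e2, ENNReal.toReal_mul, ENNReal.toReal_ofReal (Real.exp_pos _).le]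
  rfl

end

/-! ### Conditional bounds, uniform in the set of slow vertices. -/

section

/-- The exponent differs from `log n - α` by `(log n - α) (m + 1) / n`, which is bounded since `log
n ≤ n`. -/
lemma exp_isolated_le {n m : ℕ} (hn : m + 1 ≤ n) (α : ℝ) :
    Real.exp (-(1 / (n : ℝ) * (Real.log n - α) * (n - (m + 1) : ℕ)))
      ≤ Real.exp (α + (m + 1) * (1 + |α|)) / n := by
  have hn' : (0 : ℝ) < n := by exact_mod_cast (by omega : 0 < n)
  have hn1 : (1 : ℝ) ≤ n := by exact_mod_cast (by omega : 1 ≤ n)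
  have h1 : Real.exp (α + (m + 1) * (1 + |α|)) / n
      = Real.exp (α + (m + 1) * (1 + |α|) - Real.log n) := by
    rw [Real.exp_sub, Real.exp_log hn']
  rw [h1, Nat.cast_sub hn, Real.exp_le_exp]
  push_cast
  have h2 : Real.log n ≤ n := (Real.log_le_sub_one_of_pos hn').trans (by linarith)
  have h3 : |α| ≤ n * |α| := le_mul_of_one_le_left (abs_nonneg _) hn1
  have h4 : (Real.log n - α) / n ≤ 1 + |α| := by
    rw [div_le_iff₀ hn']
    linarith [neg_abs_le α]
  have h5 := mul_le_mul_of_nonneg_right h4 (show (0 : ℝ) ≤ m + 1 by positivity)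
  have h6 : 1 / (n : ℝ) * (Real.log n - α) * (n - (m + 1))
      = (Real.log n - α) - (Real.log n - α) / n * (m + 1) := by field_simp
  rw [h6]
  linarith

lemma exists_noIsolated_bounds (α : ℝ) (m : ℕ) :
    ∃ b C : ℝ, 0 < b ∧ 0 ≤ C ∧ ∀ᶠ n : ℕ in atTop, ∀ S : Finset (Fin n), S.card = m →
      b ≤ (iidExp (Sym2 (Fin n)) (1 / (n : ℝ))).real (noIsolatedEvent S (Real.log n - α)) ∧
      ∑ v ∈ Sᶜ, (iidExp (Sym2 (Fin n)) (1 / (n : ℝ))).real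
        (isolatedEvent S (Real.log n - α) v) ≤ C := by
  set C := Real.exp (α + (m + 1) * (1 + |α|)) with hC
  have hC0 : 0 < C := Real.exp_pos _
  refine ⟨Real.exp (-(2 * C)), C, Real.exp_pos _, hC0.le, ?_⟩
  filter_upwards [eventually_ge_atTop (m + 1),
    tendsto_natCast_atTop_atTop.eventually_ge_atTop (2 * C),
    (Real.tendsto_log_atTop.comp tendsto_natCast_atTop_atTop).eventually_ge_atTop α]
    with n hn hnC hα S hS
  simp only [Function.comp] at hα
  have hn' : (0 : ℝ) < n := by exact_mod_cast (by omega : 0 < n)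
  have hr : Fact (0 < 1 / (n : ℝ)) := ⟨by positivity⟩
  have hp : ∀ v ∈ Sᶜ, (iidExp (Sym2 (Fin n)) (1 / (n : ℝ))).real
      (isolatedEvent S (Real.log n - α) v) ≤ C / n := fun v hv ↦ by
    rw [iidExp_isolatedEvent (by linarith) (by simpa using hv), hS]
    exact exp_isolated_le hn α
  have hcard : (Sᶜ.card : ℝ) ≤ n := by
    rw [Finset.card_compl, Fintype.card_fin]; exact_mod_cast Nat.sub_le _ _
  constructor
  · refine le_trans ?_ (prod_le_measureReal_pi_compl (fun _ : Sym2 (Fin n) ↦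
      expMeasure (1 / (n : ℝ))) Sᶜ (fun v ↦ isUpperSet_isolatedEvent S (Real.log n - α) v)
      fun v ↦ measurableSet_isolatedEvent S (Real.log n - α) v)
    -- The inequality `exp(-2 p) ≤ 1 - p` holds here because `p = C / n` is at most `1 / 2`;
    -- multiplied over at most `n` vertices it gives `exp(-2 C)`.
    have h1 : Real.exp (-(2 * (C / n))) ≤ 1 - C / n := by
      have h0 : 0 ≤ C / n := by positivity
      have h2 : C / n ≤ 1 / 2 := by rw [div_le_div_iff₀ hn' two_pos]; linarith
      rw [Real.exp_neg, inv_le_comm₀ (Real.exp_pos _) (by linarith)]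
      refine le_trans ?_ (Real.add_one_le_exp _)
      rw [inv_eq_one_div, div_le_iff₀ (by linarith)]
      nlinarith
    calc Real.exp (-(2 * C)) = Real.exp (-(2 * (C / n))) ^ n := by
          rw [← Real.exp_nat_mul]; congr 1; field_simp
      _ ≤ Real.exp (-(2 * (C / n))) ^ Sᶜ.card := by
          refine pow_le_pow_of_le_one (Real.exp_pos _).le (Real.exp_le_one_iff.2 ?_)
            (by exact_mod_cast hcard)
          have : 0 ≤ C / n := by positivity
          linarith
      _ = ∏ _v ∈ Sᶜ, Real.exp (-(2 * (C / n))) := by rw [Finset.prod_const]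
      _ ≤ _ := Finset.prod_le_prod (fun _ _ ↦ (Real.exp_pos _).le) fun v hv ↦
          h1.trans (sub_le_sub_left (hp v hv) 1)
  · refine (Finset.sum_le_card_nsmul _ _ _ hp).trans ?_
    rw [nsmul_eq_mul]
    calc (Sᶜ.card : ℝ) * (C / n) ≤ n * (C / n) := by gcongr
      _ = C := by field_simp

variable {n m : ℕ} {S : Finset (Fin n)} {r : ℝ} [hr : Fact (0 < r)]

lemma farEvent_inter_noIsolated_bounds {c : ℝ} (hc : 0 ≤ c) (v : Fin m ≃ S) {a d l u : ℝ}
    (x : OrderedPairs m → ℝ)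
    (hl : l ≤ (iidExp (Sym2 (Fin n)) r).real (farEvent v c fun p ↦ a + 2 * c + x p))
    (hu : (sepBound (Fin n) r (fun _ : Fin m ↦ 1) (n - (m + 1))
          fun k l ↦ a + symmExt x k l).toReal ≤ u)
    (hd : ∑ v ∈ Sᶜ, (iidExp (Sym2 (Fin n)) r).real (isolatedEvent S c v)
      ≤ d * (iidExp (Sym2 (Fin n)) r).real (noIsolatedEvent S c)) :
    (l - (u - l) * d) * (iidExp (Sym2 (Fin n)) r).real (noIsolatedEvent S c)
        ≤ (iidExp (Sym2 (Fin n)) r).real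
          ((farEvent v c fun p ↦ a + 2 * c + x p) ∩ noIsolatedEvent S c) ∧
      (iidExp (Sym2 (Fin n)) r).real
          ((farEvent v c fun p ↦ a + 2 * c + x p) ∩ noIsolatedEvent S c)
        ≤ u * (iidExp (Sym2 (Fin n)) r).real (noIsolatedEvent S c) := by
  have hS : S.card = m := by
    rw [← Fintype.card_coe, ← Fintype.card_congr v, Fintype.card_fin]
  have hDm := measurableSet_farEvent v c fun p ↦ a + 2 * c + x p
  have hDu := isUpperSet_farEvent v c fun p ↦ a + 2 * c + x p
  have h1 := iidExp_farEvent_le (r := r) hc v (a := a) x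
  rw [hS] at h1
  have h2 := h1.trans hu
  constructor
  · have h := le_measureReal_pi_inter_compl (fun _ : Sym2 (Fin n) ↦ expMeasure r) Sᶜ hDu
      (fun v ↦ isUpperSet_isolatedEvent S c v) hDm (fun v ↦ measurableSet_isolatedEvent S c v)
      hl (u := u) fun b hb ↦ by
        refine (iidExp_farEvent_inter_le hc v x (Finset.mem_compl.1 hb)).trans ?_
        rw [hS]
        exact mul_le_mul_of_nonneg_right hu measureReal_nonneg
    refine le_trans ?_ h
    have h3 := mul_le_mul_of_nonneg_left hd (show 0 ≤ u - l by linarith)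
    have h4 : (l - (u - l) * d) * (iidExp (Sym2 (Fin n)) r).real (noIsolatedEvent S c)
        = l * (iidExp (Sym2 (Fin n)) r).real (noIsolatedEvent S c)
          - (u - l) * (d * (iidExp (Sym2 (Fin n)) r).real (noIsolatedEvent S c)) := by ring
    rw [h4]
    exact sub_le_sub_left h3 _
  · refine (measureReal_pi_inter_compl_le (fun _ : Sym2 (Fin n) ↦ expMeasure r) hDu
      (isUpperSet_iUnion₂ fun v _ ↦ isUpperSet_isolatedEvent S c v) hDm
      (Finset.measurableSet_biUnion _ fun v _ ↦ measurableSet_isolatedEvent S c v)).trans ?_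
    exact mul_le_mul_of_nonneg_right h2 measureReal_nonneg

lemma slowVertices_recenteredDistances_iff {α : ℝ} (V : (S : Finset (Fin n)) → S.card = m → (Fin m ≃ S))
    (hS : S.card = m) (x : OrderedPairs m → ℝ) (w : Sym2 (Fin n) → ℝ) :
    (slowVertices α w = S ∧ ∀ p, x p ≤ recenteredDistances α V w p) ↔
      w ∈ {w | ∀ p : OrderedPairs m, Real.log n + 2 * (Real.log n - α) + x p
        ≤ weightedDist w (V S hS p.1.1) (V S hS p.1.2)} ∧ slowVertices α w = S := by
  rw [and_comm]
  refine and_congr_left ?_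
  rintro rfl
  refine forall_congr' fun p ↦ ?_
  rw [recenteredDistances, dif_pos hS]
  constructor <;> intro h <;> linarith

lemma measurableSet_le_weightedDist (v : Fin m ≃ S) (t : OrderedPairs m → ℝ) :
    MeasurableSet {w : Sym2 (Fin n) → ℝ | ∀ p : OrderedPairs m,
      t p ≤ weightedDist w (v p.1.1) (v p.1.2)} := by
  rw [Set.ofPred_forall]
  exact MeasurableSet.iInter fun p ↦ measurableSet_le measurable_const
    (measurable_weightedDist (Equiv.coe_ne_coe p.2.ne))

lemma measurableSet_slowVertices_eq (hn : 2 ≤ n) (α : ℝ) (S : Finset (Fin n)) :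
    MeasurableSet {w : Sym2 (Fin n) → ℝ | slowVertices α w = S} := by
  have : {w : Sym2 (Fin n) → ℝ | slowVertices α w = S}
      = noIsolatedEvent S (Real.log n - α) ∩ ⋂ e ∈ touchingEdges S, {w | Real.log n - α ≤ w e} := by
    ext w
    simp [slowVertices_eq_iff hn, noIsolatedEvent]
  rw [this]
  exact (measurableSet_noIsolatedEvent S _).inter (Finset.measurableSet_biInter _ fun e _ ↦
    measurableSet_le measurable_const (measurable_pi_apply e))

lemma measureReal_card_slowVertices_eq (α : ℝ) (m : ℕ)
    {D : Set (Sym2 (Fin n) → ℝ)}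
    (hD : ∀ S : Finset (Fin n), S.card = m → MeasurableSet {w | slowVertices α w = S ∧ w ∈ D})
    (μ : Measure (Sym2 (Fin n) → ℝ)) [IsFiniteMeasure μ] :
    μ.real {w | (slowVertices α w).card = m ∧ w ∈ D}
      = ∑ S ∈ Finset.powersetCard m Finset.univ, μ.real {w | slowVertices α w = S ∧ w ∈ D} := by
  have : {w | (slowVertices α w).card = m ∧ w ∈ D}
      = ⋃ S ∈ Finset.powersetCard m (Finset.univ : Finset (Fin n)),
        {w | slowVertices α w = S ∧ w ∈ D} := by
    ext w
    simp only [Set.mem_ofPred_eq, Set.mem_iUnion, Finset.mem_powersetCard_univ]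
    constructor
    · rintro ⟨h1, h2⟩
      exact ⟨_, h1, rfl, h2⟩
    · rintro ⟨S, h1, rfl, h2⟩
      exact ⟨h1, h2⟩
  rw [this]
  refine measureReal_biUnion_finset ?_ fun S hS ↦ hD S (Finset.mem_powersetCard_univ.1 hS)
  intro S _ S' _ hne
  refine Set.disjoint_left.2 fun w h1 h2 ↦ hne ?_
  exact h1.1.symm.trans h2.1

end

/-- For each `S` the events factor through the same prefactor, and the ratio is squeezed between
bounds depending only on `n`. Summing over all `S` of size `m` transfers the squeeze to the event on
the cardinality, whatever the labelling. -/
lemma exists_conditional_bounds (α : ℝ) (m : ℕ) (x : OrderedPairs m → ℝ) :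
    ∃ l u : ℕ → ℝ, Tendsto l atTop (𝓝 (farLimit (symmExt x)).toReal) ∧
      Tendsto u atTop (𝓝 (farLimit (symmExt x)).toReal) ∧ ∀ᶠ n : ℕ in atTop,
        ∀ V : (S : Finset (Fin n)) → S.card = m → (Fin m ≃ S),
          0 < (iidExp (Sym2 (Fin n)) (1 / (n : ℝ))).real {w | (slowVertices α w).card = m} ∧
          l n * (iidExp (Sym2 (Fin n)) (1 / (n : ℝ))).real {w | (slowVertices α w).card = m}
            ≤ (iidExp (Sym2 (Fin n)) (1 / (n : ℝ))).real {w | (slowVertices α w).card = m ∧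
              ∀ p, x p ≤ recenteredDistances α V w p} ∧
          (iidExp (Sym2 (Fin n)) (1 / (n : ℝ))).real {w | (slowVertices α w).card = m ∧
              ∀ p, x p ≤ recenteredDistances α V w p}
            ≤ u n * (iidExp (Sym2 (Fin n)) (1 / (n : ℝ))).real
              {w | (slowVertices α w).card = m} := by
  obtain ⟨U, hU, hUn⟩ := exists_tendsto_sepBound (m + 1) (symmExt_symm x)
  obtain ⟨W, hW, hWn⟩ := exists_tendsto_nearBound (symmExt_symm x)
  obtain ⟨b, C, hb, hC, hbC⟩ := exists_noIsolated_bounds α m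
  set G := farLimit (symmExt x) with hG
  have hG1 : G ≤ 1 := farLimit_le_one _
  have hGtop : G ≠ ⊤ := ne_top_of_le_ne_top ENNReal.one_ne_top hG1
  set s : ℝ := |α| + ∑ p, |x p| with hs
  -- A common lower bound required of the direct edges inside `S`, since `log n + c + x p ≤ 2 log n
  -- + |α| + ∑ |x p|`. As it is only logarithmic, requiring it costs a factor tending to `1`.
  set B : ℕ → ℝ := fun n ↦ 2 * Real.log n + s with hB
  set l₀ : ℕ → ℝ := fun n ↦ Real.exp (-(1 / (n : ℝ) * B n * m ^ 2)) * (1 - (W n).toReal) with hl₀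
  set u : ℕ → ℝ := fun n ↦ (U n).toReal with hu
  have hut : Tendsto u atTop (𝓝 G.toReal) := (ENNReal.tendsto_toReal hGtop).comp hU
  have hlt : Tendsto l₀ atTop (𝓝 G.toReal) := by
    have h1 : Tendsto (fun n : ℕ ↦ (W n).toReal) atTop (𝓝 (1 - G).toReal) :=
      (ENNReal.tendsto_toReal (ENNReal.sub_ne_top ENNReal.one_ne_top)).comp hW
    rw [ENNReal.toReal_sub_of_le hG1 ENNReal.one_ne_top, ENNReal.toReal_one] at h1
    have h2 : Tendsto (fun n : ℕ ↦ Real.log n / n) atTop (𝓝 0) :=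
      (Real.isLittleO_log_id_atTop.tendsto_div_nhds_zero).comp tendsto_natCast_atTop_atTop
    have h3 : Tendsto (fun n : ℕ ↦ s / (n : ℝ)) atTop (𝓝 0) :=
      tendsto_const_nhds.div_atTop tendsto_natCast_atTop_atTop
    have h4 := ((((h2.const_mul 2).add h3).mul_const ((m : ℝ) ^ 2)).neg).rexp.mul
      (h1.const_sub 1)
    simp only [mul_zero, add_zero, zero_mul, neg_zero, Real.exp_zero, one_mul,
      sub_sub_cancel] at h4
    refine h4.congr fun n ↦ ?_
    simp only [hl₀, hB]
    congr 3
    ring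
  -- The correction comes from the isolated vertices: their expected number is at most `C`, hence at
  -- most `C / b` times the probability that there is none. It vanishes since `u` and `l₀` have the
  -- same limit.
  refine ⟨fun n ↦ l₀ n - (u n - l₀ n) * (C / b), u, ?_, hut, ?_⟩
  · have := hlt.sub ((hut.sub hlt).mul_const (C / b))
    simpa using this
  filter_upwards [hUn, hWn, hbC, eventually_ge_atTop 2, eventually_ge_atTop m,
    (Real.tendsto_log_atTop.comp tendsto_natCast_atTop_atTop).eventually_ge_atTop α,
    hU.eventually (gt_mem_nhds (lt_top_iff_ne_top.2 hGtop)),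
    hW.eventually (gt_mem_nhds (lt_top_iff_ne_top.2 (ENNReal.sub_ne_top (b := G)
      ENNReal.one_ne_top)))] with n hUn hWn hbC hn2 hnm hα hUt hWt V
  simp only [Function.comp] at hα
  have hn' : (0 : ℝ) < n := by exact_mod_cast (by omega : 0 < n)
  have hr : Fact (0 < 1 / (n : ℝ)) := ⟨by positivity⟩
  have hc : 0 ≤ Real.log n - α := by linarith
  set c := Real.log n - α with hcdef
  set π := iidExp (Sym2 (Fin n)) (1 / (n : ℝ)) with hπ
  set D : Set (Sym2 (Fin n) → ℝ) := {w | ∀ p, x p ≤ recenteredDistances α V w p} with hD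
  have hBn : ∀ p, Real.log n + c + x p ≤ B n := fun p ↦ by
    have h1 : |x p| ≤ ∑ p, |x p| :=
      Finset.single_le_sum (f := fun p ↦ |x p|) (fun _ _ ↦ abs_nonneg _) (Finset.mem_univ p)
    simp only [hB, hs, hcdef]
    linarith [neg_abs_le α, le_abs_self (x p)]
  have hBn0 : 0 ≤ B n := by
    have := Real.log_natCast_nonneg n
    simp only [hB, hs]
    positivity
  have e1 : ∀ S : Finset (Fin n), ∀ hS : S.card = m, {w | slowVertices α w = S ∧ w ∈ D}
      = {w | w ∈ {w | ∀ p : OrderedPairs m, Real.log n + 2 * c + x p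
        ≤ weightedDist w (V S hS p.1.1) (V S hS p.1.2)} ∧ slowVertices α w = S} := fun S hS ↦ by
    ext w
    exact slowVertices_recenteredDistances_iff V hS x w
  have key : ∀ S : Finset (Fin n), S.card = m →
      0 < π.real {w | slowVertices α w = S ∧ w ∈ Set.univ} ∧
      (l₀ n - (u n - l₀ n) * (C / b)) * π.real {w | slowVertices α w = S ∧ w ∈ Set.univ}
        ≤ π.real {w | slowVertices α w = S ∧ w ∈ D} ∧
      π.real {w | slowVertices α w = S ∧ w ∈ D}
        ≤ u n * π.real {w | slowVertices α w = S ∧ w ∈ Set.univ} := by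
    intro S hS
    obtain ⟨hbS, hCS⟩ := hbC S hS
    have h0 := iidExp_inter_slowVertices_eq (r := 1 / (n : ℝ)) hn2 hc S MeasurableSet.univ
    have h1 := iidExp_inter_slowVertices_eq (r := 1 / (n : ℝ)) hn2 hc S
      (measurableSet_le_weightedDist (V S hS) fun p ↦ Real.log n + 2 * c + x p)
    rw [← e1 S hS] at h1
    simp only [Set.mem_univ, true_and, and_true, Set.ofPred_true, Set.univ_inter] at h0 ⊢
    have h2 : {w : Sym2 (Fin n) → ℝ | shiftOn (touchingEdges S) (Real.log n - α) w ∈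
        {w | ∀ p : OrderedPairs m, Real.log n + 2 * c + x p
          ≤ weightedDist w (V S hS p.1.1) (V S hS p.1.2)}}
        = farEvent (V S hS) c fun p ↦ Real.log n + 2 * c + x p := rfl
    rw [h2] at h1
    rw [h0, h1]
    have h3 := le_iidExp_farEvent (r := 1 / (n : ℝ)) hc (V S hS) (a := Real.log n) x hBn0 hBn
    have h4 : l₀ n ≤ π.real (farEvent (V S hS) c fun p ↦ Real.log n + 2 * c + x p) := by
      refine le_trans ?_ h3
      refine mul_le_mul_of_nonneg_left ?_ (Real.exp_pos _).le
      exact sub_le_sub_left (ENNReal.toReal_mono hWt.ne hWn) 1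
    obtain ⟨h5, h6⟩ := farEvent_inter_noIsolated_bounds (r := 1 / (n : ℝ)) hc (V S hS)
      (a := Real.log n) (d := C / b) (u := u n) x h4 (ENNReal.toReal_mono hUt.ne hUn) (by
        refine hCS.trans ?_
        rw [div_mul_eq_mul_div, le_div_iff₀ hb]
        exact mul_le_mul_of_nonneg_left hbS hC)
    have hE := Real.exp_pos (-(1 / (n : ℝ) * (Real.log n - α) * (touchingEdges S).card))
    set E := Real.exp (-(1 / (n : ℝ) * (Real.log n - α) * (touchingEdges S).card))
    refine ⟨mul_pos hE (hb.trans_le hbS), ?_, ?_⟩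
    · have := mul_le_mul_of_nonneg_left h5 hE.le
      linarith
    · have := mul_le_mul_of_nonneg_left h6 hE.le
      linarith
  have hm1 := measureReal_card_slowVertices_eq α m (D := Set.univ)
    (fun S _ ↦ by simpa using measurableSet_slowVertices_eq hn2 α S) π
  have hm2 := measureReal_card_slowVertices_eq α m (D := D)
    (fun S hS ↦ by
      rw [e1 S hS]
      exact (measurableSet_le_weightedDist _ _).inter (measurableSet_slowVertices_eq hn2 α S)) π
  have e2 : {w : Sym2 (Fin n) → ℝ | (slowVertices α w).card = m ∧ w ∈ Set.univ}
      = {w | (slowVertices α w).card = m} := by ext w; simp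
  have e3 : {w : Sym2 (Fin n) → ℝ | (slowVertices α w).card = m ∧ w ∈ D}
      = {w | (slowVertices α w).card = m ∧ ∀ p, x p ≤ recenteredDistances α V w p} := rfl
  rw [e2] at hm1
  rw [e3] at hm2
  rw [hm1, hm2]
  refine ⟨Finset.sum_pos (fun S hS ↦ (key S (Finset.mem_powersetCard_univ.1 hS)).1) ?_, ?_, ?_⟩
  · rw [Finset.powersetCard_nonempty]
    simpa using hnm
  · rw [Finset.mul_sum]
    exact Finset.sum_le_sum fun S hS ↦ (key S (Finset.mem_powersetCard_univ.1 hS)).2.1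
  · rw [Finset.mul_sum]
    exact Finset.sum_le_sum fun S hS ↦ (key S (Finset.mem_powersetCard_univ.1 hS)).2.2

/-! ### Gumbel variables and the limiting orthant probabilities. -/

section

/-- The standard Gumbel distribution. -/
noncomputable def gumbelMeasure : Measure ℝ := (expMeasure 1).map fun y ↦ -Real.log y

instance isProbabilityMeasure_gumbelMeasure : IsProbabilityMeasure gumbelMeasure := by
  have := isProbabilityMeasure_expMeasure (r := 1) one_pos
  exact Measure.isProbabilityMeasure_map (by fun_prop)

lemma gumbelMeasure_Iic (x : ℝ) :
    gumbelMeasure (Set.Iic x) = ENNReal.ofReal (Real.exp (-Real.exp (-x))) := by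
  have := nullSingletonClass_expMeasure (r := 1)
  rw [gumbelMeasure, Measure.map_apply (by fun_prop) measurableSet_Iic]
  have h : ((fun y ↦ -Real.log y) ⁻¹' Set.Iic x : Set ℝ) =ᵐ[expMeasure 1]
      Set.Ici (Real.exp (-x)) := by
    filter_upwards [expMeasure_ae_nonneg one_pos, measure_eq_zero_iff_ae_notMem.1
      (measure_singleton (μ := expMeasure 1) 0)] with y hy hy'
    have hy0 : 0 < y := lt_of_le_of_ne hy (Ne.symm hy')
    refine propext ?_
    change -Real.log y ≤ x ↔ Real.exp (-x) ≤ y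
    rw [← Real.le_log_iff_exp_le hy0]
    constructor <;> intro h <;> linarith
  rw [measure_congr h, expMeasure_Ici one_pos, max_eq_left (Real.exp_pos _).le, one_mul]

lemma IsStdGumbel.map_eq {Ω : Type*} [MeasurableSpace Ω] {X : Ω → ℝ} {μ : Measure Ω}
    [IsProbabilityMeasure μ] (h : IsStdGumbel X μ) : μ.map X = gumbelMeasure := by
  have := Measure.isProbabilityMeasure_map h.1
  refine Measure.eq_of_cdf _ _ ?_
  ext x
  rw [h.2 x, cdf_eq_real, Measure.real, gumbelMeasure_Iic,
    ENNReal.toReal_ofReal (Real.exp_pos _).le]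

lemma pi_gumbelMeasure (ι : Type*) [Fintype ι] :
    Measure.pi (fun _ : ι ↦ gumbelMeasure)
      = (iidExp ι 1).map fun y i ↦ -Real.log (y i) := by
  have := isProbabilityMeasure_expMeasure (r := 1) one_pos
  have : ∀ _ : ι, SigmaFinite ((expMeasure 1).map fun y : ℝ ↦ -Real.log y) := fun _ ↦ by
    have := isProbabilityMeasure_gumbelMeasure
    rw [gumbelMeasure] at this
    infer_instance
  exact (Measure.pi_map_pi (μ := fun _ : ι ↦ expMeasure 1) (f := fun _ y ↦ -Real.log y)
    fun _ ↦ by fun_prop).symm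

variable {m : ℕ}

lemma farKernel_symmExt (x : OrderedPairs m → ℝ) (y : Fin m → ℝ) :
    farKernel (symmExt x) y
      = ∏ p : OrderedPairs m, Real.exp (-(Real.exp (x p) * y p.1.1 * y p.1.2)) := by
  have h1 : farKernel (symmExt x) y = ∏ p ∈ (Finset.univ : Finset (Fin m × Fin m)).filter
      (fun p ↦ p.1 < p.2), Real.exp (-(Real.exp (symmExt x p.1 p.2) * y p.1 * y p.2)) := by
    rw [Finset.prod_filter, ← Finset.univ_product_univ, Finset.prod_product_right, farKernel]
    refine Finset.prod_congr rfl fun k _ ↦ ?_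
    rw [Finset.prod_filter]
    refine Finset.prod_congr rfl fun j _ ↦ ?_
    simp only
    rw [symmExt_symm x k j, mul_right_comm]
  rw [h1, Finset.prod_subtype _ (p := fun p : Fin m × Fin m ↦ p.1 < p.2) (by simp)]
  exact Finset.prod_congr rfl fun p _ ↦ by rw [symmExt_apply]

/-- Condition on `Λ_i = -log y_i`. The constraints then become independent upper bounds on the
`Λ_ij`, and the Gumbel distribution function turns each into `exp(-exp(x_ij) y_i y_j)`. -/
lemma measure_le_gumbel_eq_farLimit {Ω' : Type*} [MeasurableSpace Ω'] (Q : Measure Ω')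
    [IsProbabilityMeasure Q] (L : Fin m → Ω' → ℝ) (L₂ : OrderedPairs m → Ω' → ℝ)
    (hL_indep : iIndepFun (Sum.elim L L₂) Q)
    (hL : ∀ i, IsStdGumbel (L i) Q) (hL₂ : ∀ p, IsStdGumbel (L₂ p) Q) (x : OrderedPairs m → ℝ) :
    Q {ω | ∀ p, x p ≤ L p.1.1 ω + L p.1.2 ω - L₂ p ω} = farLimit (symmExt x) := by
  have hlaw : ∀ i, IsStdGumbel (Sum.elim L L₂ i) Q := by
    rintro (i | p)
    · exact hL i
    · exact hL₂ p
  have h1 := (iIndepFun_iff_map_fun_eq_pi_map fun i ↦ (hlaw i).1).1 hL_indep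
  simp_rw [fun i ↦ (hlaw i).map_eq] at h1
  set A : Set (Fin m ⊕ OrderedPairs m → ℝ) :=
    {z | ∀ p : OrderedPairs m, x p ≤ z (.inl p.1.1) + z (.inl p.1.2) - z (.inr p)} with hA
  set A' : Set ((Fin m → ℝ) × (OrderedPairs m → ℝ)) :=
    {z | ∀ p : OrderedPairs m, x p ≤ z.1 p.1.1 + z.1 p.1.2 - z.2 p} with hA'
  have hAm : MeasurableSet A := by
    rw [hA, Set.ofPred_forall]
    exact MeasurableSet.iInter fun p ↦ measurableSet_le measurable_const (by fun_prop)
  have hAm' : MeasurableSet A' := by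
    rw [hA', Set.ofPred_forall]
    exact MeasurableSet.iInter fun p ↦ measurableSet_le measurable_const (by fun_prop)
  have h2 : Q {ω | ∀ p, x p ≤ L p.1.1 ω + L p.1.2 ω - L₂ p ω}
      = Measure.pi (fun _ : Fin m ⊕ OrderedPairs m ↦ gumbelMeasure) A := by
    rw [← h1, Measure.map_apply_of_aemeasurable (aemeasurable_pi_lambda _ fun i ↦ (hlaw i).1) hAm]
    rfl
  have h3 := (measurePreserving_sumPiEquivProdPi
    (fun _ : Fin m ⊕ OrderedPairs m ↦ gumbelMeasure)).measure_preimage hAm'.nullMeasurableSet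
  have h4 : (MeasurableEquiv.sumPiEquivProdPi fun _ : Fin m ⊕ OrderedPairs m ↦ ℝ) ⁻¹' A' = A := rfl
  rw [h4] at h3
  rw [h2, h3, Measure.prod_apply hAm', pi_gumbelMeasure (Fin m), lintegral_map
    (measurable_measure_prodMk_left hAm') (by fun_prop), farLimit]
  refine lintegral_congr_ae ?_
  filter_upwards [iidExp_ae_pos (κ := Fin m)] with y hy
  have h5 : (Prod.mk (fun i ↦ -Real.log (y i)) ⁻¹' A' : Set (OrderedPairs m → ℝ))
      = Set.univ.pi fun p ↦ Set.Iic (-Real.log (y p.1.1) + -Real.log (y p.1.2) - x p) := by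
    ext z
    simp only [hA', Set.mem_preimage, Set.mem_ofPred_eq, Set.mem_univ_pi, Set.mem_Iic]
    refine forall_congr' fun p ↦ ?_
    constructor <;> intro h <;> linarith
  rw [h5, Measure.pi_pi]
  simp_rw [gumbelMeasure_Iic]
  rw [farKernel_symmExt, ENNReal.ofReal_prod_of_nonneg fun _ _ ↦ (Real.exp_pos _).le]
  refine Finset.prod_congr rfl fun p _ ↦ ?_
  congr 3
  rw [show -(-Real.log (y p.1.1) + -Real.log (y p.1.2) - x p)
    = x p + Real.log (y p.1.1) + Real.log (y p.1.2) by ring, exp_log_add (hy _) (hy _)]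

end

/-! ### Weak convergence from upper orthant probabilities. -/

section WeakConvergence
variable {ι : Type*} [Fintype ι]

/-- The maximum with `a i` makes the difference vanish when the interval is empty, so no ordering of
the corners is needed. -/
lemma indicator_box (a b z : ι → ℝ) :
    Set.indicator {z : ι → ℝ | ∀ i, a i ≤ z i ∧ z i < b i} (1 : (ι → ℝ) → ℝ) z
      = ∏ i, (Set.indicator (Set.Ici (a i)) (1 : ℝ → ℝ) (z i)
        - Set.indicator (Set.Ici (max (a i) (b i))) (1 : ℝ → ℝ) (z i)) := by
  have h : ∀ i, Set.indicator (Set.Ici (a i)) (1 : ℝ → ℝ) (z i)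
        - Set.indicator (Set.Ici (max (a i) (b i))) (1 : ℝ → ℝ) (z i)
      = if a i ≤ z i ∧ z i < b i then 1 else 0 := by
    intro i
    simp only [Set.indicator_apply, Set.mem_Ici, max_le_iff, Pi.one_apply]
    by_cases h1 : a i ≤ z i <;> by_cases h2 : b i ≤ z i <;> simp [h1, h2, not_lt.2, not_le.1]
  simp_rw [h]
  rw [Finset.prod_ite_zero]
  simp [Set.indicator_apply]

lemma prod_indicator_Ici (a z : ι → ℝ) :
    ∏ i, Set.indicator (Set.Ici (a i)) (1 : ℝ → ℝ) (z i)
      = Set.indicator {z : ι → ℝ | ∀ i, a i ≤ z i} (1 : (ι → ℝ) → ℝ) z := by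
  simp only [Set.indicator_apply, Set.mem_Ici, Pi.one_apply]
  rw [Finset.prod_ite_zero]
  simp

lemma measurableSet_forall_le (a : ι → ℝ) : MeasurableSet {z : ι → ℝ | ∀ i, a i ≤ z i} := by
  rw [Set.ofPred_forall]
  exact MeasurableSet.iInter fun p ↦ measurableSet_le measurable_const (by fun_prop)

lemma measurableSet_box (a b : ι → ℝ) : MeasurableSet {z : ι → ℝ | ∀ i, a i ≤ z i ∧ z i < b i} := by
  rw [Set.ofPred_forall]
  exact MeasurableSet.iInter fun p ↦ (measurableSet_le (f := fun _ : ι → ℝ ↦ a p)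
    (g := fun z ↦ z p) measurable_const (by fun_prop)).inter
    (measurableSet_lt (f := fun z : ι → ℝ ↦ z p) (by fun_prop) measurable_const)

/-- Inclusion-exclusion over the coordinates whose upper constraint is subtracted. Half-open boxes
match closed orthants, so no boundary terms arise. -/
lemma exists_box_eq_sum [DecidableEq ι] (a b : ι → ℝ) (μ : Measure (ι → ℝ))
    [IsFiniteMeasure μ] :
    μ.real {z : ι → ℝ | ∀ i, a i ≤ z i ∧ z i < b i}
      = ∑ s ∈ (Finset.univ : Finset ι).powerset, (-1) ^ s.card *
        μ.real {z : ι → ℝ | ∀ i, (if i ∈ s then max (a i) (b i) else a i) ≤ z i} := by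
  have h0 : ∀ z : ι → ℝ, Set.indicator {z : ι → ℝ | ∀ i, a i ≤ z i ∧ z i < b i}
      (1 : (ι → ℝ) → ℝ) z
      = ∑ s ∈ (Finset.univ : Finset ι).powerset, (-1) ^ s.card *
        Set.indicator {z : ι → ℝ | ∀ i, (if i ∈ s then max (a i) (b i) else a i) ≤ z i}
          (1 : (ι → ℝ) → ℝ) z := by
    intro z
    rw [indicator_box]
    have h1 : ∀ i, Set.indicator (Set.Ici (a i)) (1 : ℝ → ℝ) (z i)
        - Set.indicator (Set.Ici (max (a i) (b i))) (1 : ℝ → ℝ) (z i)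
        = -Set.indicator (Set.Ici (max (a i) (b i))) (1 : ℝ → ℝ) (z i)
          + Set.indicator (Set.Ici (a i)) (1 : ℝ → ℝ) (z i) := fun i ↦ by ring
    simp_rw [h1]
    rw [Finset.prod_add]
    refine Finset.sum_congr rfl fun s _ ↦ ?_
    rw [Finset.prod_neg, mul_assoc, ← prod_indicator_Ici,
      ← Finset.prod_mul_prod_compl s (fun i ↦ Set.indicator
        (Set.Ici (if i ∈ s then max (a i) (b i) else a i)) (1 : ℝ → ℝ) (z i)),
      Finset.compl_eq_univ_sdiff]
    congr 2
    · exact Finset.prod_congr rfl fun i hi ↦ by rw [if_pos hi]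
    · exact Finset.prod_congr rfl fun i hi ↦ by rw [if_neg (Finset.mem_sdiff.1 hi).2]
  rw [← integral_indicator_one (measurableSet_box a b)]
  simp_rw [h0]
  rw [integral_finsetSum]
  · refine Finset.sum_congr rfl fun s _ ↦ ?_
    rw [integral_const_mul, integral_indicator_one (measurableSet_forall_le _)]
  · intro s _
    exact ((integrable_const (1 : ℝ)).indicator (measurableSet_forall_le _)).const_mul _

/-- Half-open boxes form a π-system containing arbitrarily small neighbourhoods of each point, and
their probabilities are finite signed sums of orthant probabilities. -/
lemma tendsto_probabilityMeasure_of_tendsto_forall_le {μ : ℕ → ProbabilityMeasure (ι → ℝ)}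
    {ν : ProbabilityMeasure (ι → ℝ)}
    (h : ∀ x : ι → ℝ, Tendsto (fun k ↦ (μ k : Measure (ι → ℝ)).real {z | ∀ i, x i ≤ z i}) atTop
      (𝓝 ((ν : Measure (ι → ℝ)).real {z | ∀ i, x i ≤ z i}))) :
    Tendsto μ atTop (𝓝 ν) := by
  classical
  have hpi : IsPiSystem {s : Set (ι → ℝ) | ∃ a b : ι → ℝ, s = {z : ι → ℝ | ∀ i, a i ≤ z i ∧ z i < b i}} := by
    rintro - ⟨a, b, rfl⟩ - ⟨a', b', rfl⟩ -
    refine ⟨a ⊔ a', b ⊓ b', ?_⟩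
    ext z
    simp only [Set.mem_inter_iff, Set.mem_ofPred_eq, Pi.sup_apply, Pi.inf_apply, sup_le_iff,
      lt_inf_iff, ← forall_and]
    exact forall_congr' fun i ↦ by tauto
  refine hpi.tendsto_probabilityMeasure_of_tendsto_of_mem ?_ ?_ ?_
  · rintro - ⟨a, b, rfl⟩
    exact measurableSet_box a b
  · intro u hu z hz
    obtain ⟨ε, hε, hball⟩ := Metric.isOpen_iff.1 hu z hz
    refine ⟨_, ⟨fun i ↦ z i - ε / 2, fun i ↦ z i + ε / 2, rfl⟩, ?_, ?_⟩
    · have : Set.univ.pi (fun i ↦ Set.Ioo (z i - ε / 2) (z i + ε / 2))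
          ⊆ {y : ι → ℝ | ∀ i, z i - ε / 2 ≤ y i ∧ y i < z i + ε / 2} := fun y hy i ↦
        ⟨(hy i trivial).1.le, (hy i trivial).2⟩
      refine mem_of_superset ((isOpen_set_pi Set.finite_univ fun i _ ↦ isOpen_Ioo).mem_nhds
        fun i _ ↦ ?_) this
      constructor <;> linarith
    · intro y hy
      refine hball ?_
      rw [Metric.mem_ball]
      refine lt_of_le_of_lt ((dist_pi_le_iff (half_pos hε).le).2 fun i ↦ ?_) (half_lt_self hε)
      have := hy i
      rw [Real.dist_eq, abs_le]
      constructor <;> linarith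
  · rintro - ⟨a, b, rfl⟩
    rw [← NNReal.tendsto_coe]
    have h1 := fun s : Finset ι ↦
      h fun i ↦ if i ∈ s then max (a i) (b i) else a i
    have h2 := tendsto_finsetSum (Finset.univ : Finset ι).powerset fun s _ ↦
      (h1 s).const_mul ((-1 : ℝ) ^ s.card)
    simp_rw [← exists_box_eq_sum a b] at h2
    exact h2

end WeakConvergence

/-! ### Transfer from the given edge lengths to the product model. -/

section
variable {n m : ℕ}

/-- Replace the lengths of the loops by `0`. -/
noncomputable def extendEdges (z : (⊤ : SimpleGraph (Fin n)).edgeSet → ℝ) (e : Sym2 (Fin n)) : ℝ :=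
  open Classical in if h : e ∈ (⊤ : SimpleGraph (Fin n)).edgeSet then z ⟨e, h⟩ else 0

lemma measurable_extendEdges : Measurable (extendEdges (n := n)) := by
  refine measurable_pi_lambda _ fun e ↦ ?_
  unfold extendEdges
  by_cases h : e ∈ (⊤ : SimpleGraph (Fin n)).edgeSet
  · simp only [h, dif_pos]
    exact measurable_pi_apply _
  · simp only [h, dif_neg, not_false_eq_true]
    exact measurable_const

variable {w w' : Sym2 (Fin n) → ℝ}

lemma slowVertices_congr (h : ∀ e ∈ (⊤ : SimpleGraph (Fin n)).edgeSet, w e = w' e) (α : ℝ) :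
    slowVertices α w = slowVertices α w' := by
  have h1 : ∀ i, minIncidentWeight w i = minIncidentWeight w' i := fun i ↦ by
    unfold minIncidentWeight
    congr 1
    ext j
    exact h _ (by simpa using j.2.symm)
  unfold slowVertices
  simp_rw [h1]

lemma weightedDist_congr (h : ∀ e ∈ (⊤ : SimpleGraph (Fin n)).edgeSet, w e = w' e)
    (i j : Fin n) : weightedDist w i j = weightedDist w' i j := by
  unfold weightedDist pathLength
  congr 1
  ext p
  congr 1
  exact List.map_congr_left fun e he ↦ h e (p.1.edges_subset_edgeSet he)

lemma recenteredDistances_congr (h : ∀ e ∈ (⊤ : SimpleGraph (Fin n)).edgeSet, w e = w' e) (α : ℝ)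
    (V : (S : Finset (Fin n)) → S.card = m → (Fin m ≃ S)) :
    recenteredDistances α V w = recenteredDistances α V w' := by
  ext p
  unfold recenteredDistances
  simp_rw [weightedDist_congr h]
  have h1 := slowVertices_congr h α
  by_cases hm : (slowVertices α w).card = m
  · rw [dif_pos hm, dif_pos (h1 ▸ hm)]
    congr 3 <;> congr!
  · rw [dif_neg hm, dif_neg (h1 ▸ hm)]

/-- The product model also assigns independent lengths to loops; overwriting them by `0` amounts to
integrating them out. -/
lemma map_extendEdges_pi {r : ℝ} [hr : Fact (0 < r)] :
    (Measure.pi fun _ : (⊤ : SimpleGraph (Fin n)).edgeSet ↦ expMeasure r).map extendEdges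
      = (iidExp (Sym2 (Fin n)) r).map fun w ↦ extendEdges fun e ↦ w e.1 := by
  classical
  have h1 := (measurePreserving_fst (μ := Measure.pi fun _ : {e //
    e ∈ (⊤ : SimpleGraph (Fin n)).edgeSet} ↦ expMeasure r)
    (ν := Measure.pi fun _ : {e // ¬ e ∈ (⊤ : SimpleGraph (Fin n)).edgeSet} ↦ expMeasure r)).comp
    (measurePreserving_piEquivPiSubtypeProd (fun _ : Sym2 (Fin n) ↦ expMeasure r)
      fun e ↦ e ∈ (⊤ : SimpleGraph (Fin n)).edgeSet)
  have h2 := h1.map_eq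
  rw [← Function.comp_def extendEdges fun (w : Sym2 (Fin n) → ℝ)
    (e : (⊤ : SimpleGraph (Fin n)).edgeSet) ↦ w e.1,
    ← Measure.map_map measurable_extendEdges (by fun_prop)]
  congr 1
  convert h2.symm using 1
  rfl

lemma measurable_recenteredDistances (hn : 2 ≤ n) (α : ℝ)
    (V : (S : Finset (Fin n)) → S.card = m → (Fin m ≃ S)) :
    Measurable (recenteredDistances α V) := by
  classical
  refine measurable_pi_lambda _ fun p ↦ ?_
  have h : ∀ w, recenteredDistances α V w p = ∑ S : Finset (Fin n),
      Set.indicator {w | slowVertices α w = S} (fun w ↦ if h : S.card = m then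
        weightedDist w (V S h p.1.1 : Fin n) (V S h p.1.2 : Fin n) - 3 * Real.log n + 2 * α
        else 0) w := by
    intro w
    rw [Finset.sum_eq_single (slowVertices α w)]
    · rw [Set.indicator_of_mem (by simp)]
      rfl
    · intro S _ hS
      exact Set.indicator_of_notMem (fun h ↦ hS h.symm) _
    · simp
  rw [funext h]
  refine Finset.measurable_fun_sum _ fun S _ ↦ Measurable.indicator ?_
    (measurableSet_slowVertices_eq hn α S)
  by_cases hS : S.card = m
  · simp only [hS, dif_pos]
    exact ((measurable_weightedDist (Equiv.coe_ne_coe p.2.ne)).sub_const _).add_const _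
  · simp only [hS, dif_neg, not_false_eq_true]
    exact measurable_const

lemma measurableSet_card_slowVertices (hn : 2 ≤ n) (α : ℝ) (m : ℕ) :
    MeasurableSet {w : Sym2 (Fin n) → ℝ | (slowVertices α w).card = m} := by
  have : {w : Sym2 (Fin n) → ℝ | (slowVertices α w).card = m}
      = ⋃ S ∈ {S : Finset (Fin n) | S.card = m}, {w | slowVertices α w = S} := by
    ext w; simp
  rw [this]
  exact MeasurableSet.biUnion (Set.to_countable _) fun S _ ↦ measurableSet_slowVertices_eq hn α S

variable {Ω : Type*} [MeasurableSpace Ω] {P : Measure Ω} [IsProbabilityMeasure P]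
  {E : Sym2 (Fin n) → Ω → ℝ}

lemma aemeasurable_extendEdges {r : ℝ}
    (hE : ∀ e ∈ (⊤ : SimpleGraph (Fin n)).edgeSet, HasLaw (E e) (expMeasure r) P) :
    AEMeasurable (fun ω ↦ extendEdges fun e ↦ E e.1 ω) P :=
  measurable_extendEdges.comp_aemeasurable
    (aemeasurable_pi_lambda _ fun e ↦ (hE e.1 e.2).aemeasurable)

lemma extendEdges_apply_of_mem (z : (⊤ : SimpleGraph (Fin n)).edgeSet → ℝ) {e : Sym2 (Fin n)}
    (he : e ∈ (⊤ : SimpleGraph (Fin n)).edgeSet) : extendEdges z e = z ⟨e, he⟩ := by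
  rw [extendEdges, dif_pos he]

/-- Only the nonloop coordinates of `E` have a prescribed law. An event that ignores loops has the
same probability as in the full product model. -/
lemma measure_preimage_eq_iidExp {r : ℝ} [hr : Fact (0 < r)]
    (hE_indep : iIndepFun (fun e : (⊤ : SimpleGraph (Fin n)).edgeSet ↦ E e.1) P)
    (hE : ∀ e ∈ (⊤ : SimpleGraph (Fin n)).edgeSet, HasLaw (E e) (expMeasure r) P)
    {A : Set (Sym2 (Fin n) → ℝ)} (hA : MeasurableSet A)
    (hcongr : ∀ w w' : Sym2 (Fin n) → ℝ, (∀ e ∈ (⊤ : SimpleGraph (Fin n)).edgeSet, w e = w' e) →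
      (w ∈ A ↔ w' ∈ A)) :
    P {ω | (fun e ↦ E e ω) ∈ A} = iidExp (Sym2 (Fin n)) r A := by
  have hm := aemeasurable_extendEdges hE
  have h1 : P.map (fun ω (e : (⊤ : SimpleGraph (Fin n)).edgeSet) ↦ E e.1 ω)
      = Measure.pi fun _ ↦ expMeasure r := by
    rw [(iIndepFun_iff_map_fun_eq_pi_map fun e : (⊤ : SimpleGraph (Fin n)).edgeSet ↦
      (hE e.1 e.2).aemeasurable).1 hE_indep]
    congr 1
    ext1 e
    exact (hE e.1 e.2).map_eq
  have h2 : P.map (fun ω ↦ extendEdges fun e ↦ E e.1 ω)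
      = (iidExp (Sym2 (Fin n)) r).map fun w ↦ extendEdges fun e ↦ w e.1 := by
    rw [← map_extendEdges_pi, ← h1, AEMeasurable.map_map_of_aemeasurable
      measurable_extendEdges.aemeasurable
      (aemeasurable_pi_lambda _ fun e ↦ (hE e.1 e.2).aemeasurable)]
    rfl
  have h3 := congrArg (fun μ ↦ μ A) h2
  rw [Measure.map_apply_of_aemeasurable hm hA, Measure.map_apply
    (f := fun w : Sym2 (Fin n) → ℝ ↦ extendEdges fun e ↦ w e.1)
    (measurable_extendEdges.comp (by fun_prop)) hA] at h3
  have e1 : (fun ω ↦ extendEdges fun e ↦ E e.1 ω) ⁻¹' A = {ω | (fun e ↦ E e ω) ∈ A} := by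
    ext ω
    exact hcongr _ _ fun e he ↦ extendEdges_apply_of_mem _ he
  have e2 : (fun w : Sym2 (Fin n) → ℝ ↦ extendEdges fun e ↦ w e.1) ⁻¹' A = A := by
    ext w
    exact hcongr _ _ fun e he ↦ extendEdges_apply_of_mem _ he
  rwa [e1, e2] at h3

end

theorem proposition4p7 (α : ℝ) (m : ℕ) (hm : 2 ≤ m)
    -- for each `n`, the i.i.d. exponential edge lengths with mean `n` on the complete graph
    {Ω : ℕ → Type*} [∀ n, MeasurableSpace (Ω n)]
    (P : (n : ℕ) → Measure (Ω n)) [∀ n, IsProbabilityMeasure (P n)]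
    (E : (n : ℕ) → Sym2 (Fin n) → Ω n → ℝ)
    (hE_indep : ∀ n, iIndepFun
      (fun e : (⊤ : SimpleGraph (Fin n)).edgeSet ↦ E n e.1) (P n))
    (hE_law : ∀ n, ∀ e ∈ (⊤ : SimpleGraph (Fin n)).edgeSet,
      HasLaw (E n e) (expMeasure (1 / (n : ℝ))) (P n))
    -- the labelling `V_1, …, V_m` of the vertices in a set of size `m`
    (V : (n : ℕ) → (S : Finset (Fin n)) → S.card = m → (Fin m ≃ S))
    -- the independent standard Gumbel variables `Λ_i` and `Λ_ij`, `i < j`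
    {Ω' : Type*} [MeasurableSpace Ω'] (Q : Measure Ω') [IsProbabilityMeasure Q]
    (L : Fin m → Ω' → ℝ) (L₂ : OrderedPairs m → Ω' → ℝ)
    (hL_indep : iIndepFun (Sum.elim L L₂) Q)
    (hL : ∀ i, IsStdGumbel (L i) Q) (hL₂ : ∀ p, IsStdGumbel (L₂ p) Q) :
    -- for `n ≥ n₀` the event `N_n(α) = m` has positive probability, and the conditional laws
    -- given this event converge weakly as `n → ∞`
    ∃ n₀ : ℕ,
      ∃ _ : ∀ k, IsProbabilityMeasure
        (cond (P (n₀ + k)) {ω | (slowVertices α (fun e ↦ E (n₀ + k) e ω)).card = m}),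
      TendstoInDistribution
        (fun k ω ↦ recenteredDistances α (V (n₀ + k)) (fun e ↦ E (n₀ + k) e ω))
        atTop
        (fun ω p ↦ L p.1.1 ω + L p.1.2 ω - L₂ p ω)
        (fun k ↦ cond (P (n₀ + k)) {ω | (slowVertices α (fun e ↦ E (n₀ + k) e ω)).card = m})
        Q := by
  have hpos : ∀ᶠ n : ℕ in atTop, 2 ≤ n ∧
      0 < (iidExp (Sym2 (Fin n)) (1 / (n : ℝ))).real {w | (slowVertices α w).card = m} := by
    -- Positivity of the conditioning event does not involve the thresholds, so `x = 0` serves as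
    -- well as any.
    obtain ⟨l, u, -, -, h⟩ := exists_conditional_bounds α m 0
    filter_upwards [h, eventually_ge_atTop 2] with n h hn
    exact ⟨hn, (h (V n)).1⟩
  obtain ⟨n₀, hn₀⟩ := eventually_atTop.1 hpos
  have hn2 : ∀ k, 2 ≤ n₀ + k := fun k ↦ (hn₀ _ (Nat.le_add_right _ _)).1
  have hfact : ∀ k, Fact (0 < 1 / ((n₀ + k : ℕ) : ℝ)) := fun k ↦
    ⟨by have : 0 < n₀ + k := by have := hn2 k; omega
        positivity⟩
  set S : (k : ℕ) → Set (Ω (n₀ + k)) := fun k ↦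
    {ω | (slowVertices α (fun e ↦ E (n₀ + k) e ω)).card = m} with hS
  have hSm : ∀ k, P (n₀ + k) (S k) = iidExp (Sym2 (Fin (n₀ + k))) (1 / ((n₀ + k : ℕ) : ℝ))
      {w | (slowVertices α w).card = m} := fun k ↦
    measure_preimage_eq_iidExp (hE_indep _) (hE_law _)
      (measurableSet_card_slowVertices (hn2 k) α m) fun w w' h ↦ by
        simp only [Set.mem_ofPred_eq, slowVertices_congr h α]
  -- The lengths are only almost everywhere measurable, so the conditioning event is null
  -- measurable; this is enough to evaluate the restricted measure.
  have hSnull : ∀ k, NullMeasurableSet (S k) (P (n₀ + k)) := fun k ↦ by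
    have h1 := (aemeasurable_extendEdges (hE_law (n₀ + k))).nullMeasurableSet_preimage
      (measurableSet_card_slowVertices (hn2 k) α m)
    convert h1 using 1
    ext ω
    simp only [hS, Set.mem_ofPred_eq, Set.mem_preimage]
    rw [slowVertices_congr fun e he ↦ (extendEdges_apply_of_mem
      (fun e ↦ E (n₀ + k) e.1 ω) he).symm]
  have hS0 : ∀ k, P (n₀ + k) (S k) ≠ 0 := fun k h ↦ by
    have h1 := (hn₀ (n₀ + k) (Nat.le_add_right _ _)).2
    rw [Measure.real, ← hSm k, h] at h1
    simp at h1
  have hprob : ∀ k, IsProbabilityMeasure (cond (P (n₀ + k)) (S k)) := fun k ↦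
    cond_isProbabilityMeasure (hS0 k)
  have hXm : ∀ k, AEMeasurable (fun ω ↦ recenteredDistances α (V (n₀ + k))
      (fun e ↦ E (n₀ + k) e ω)) (P (n₀ + k)) := fun k ↦ by
    have h1 := (measurable_recenteredDistances (hn2 k) α (V (n₀ + k))).comp_aemeasurable
      (aemeasurable_extendEdges (hE_law (n₀ + k)))
    refine h1.congr (Eventually.of_forall fun ω ↦ ?_)
    exact recenteredDistances_congr (fun e he ↦ extendEdges_apply_of_mem _ he) α _
  have hXm' : ∀ k, AEMeasurable (fun ω ↦ recenteredDistances α (V (n₀ + k))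
      (fun e ↦ E (n₀ + k) e ω)) (cond (P (n₀ + k)) (S k)) := fun k ↦
    (hXm k).mono_ac cond_absolutelyContinuous
  have hZm : AEMeasurable (fun ω (p : OrderedPairs m) ↦ L p.1.1 ω + L p.1.2 ω - L₂ p ω) Q :=
    aemeasurable_pi_lambda _ fun p ↦ ((hL _).1.add (hL _).1).sub (hL₂ p).1
  refine ⟨n₀, hprob, hXm', hZm, ?_⟩
  refine tendsto_probabilityMeasure_of_tendsto_forall_le fun x ↦ ?_
  obtain ⟨l, u, hl, hu, hlu⟩ := exists_conditional_bounds α m x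
  have hlim : (Q.map fun ω (p : OrderedPairs m) ↦ L p.1.1 ω + L p.1.2 ω - L₂ p ω).real
      {z | ∀ p, x p ≤ z p} = (farLimit (symmExt x)).toReal := by
    rw [Measure.real, Measure.map_apply_of_aemeasurable hZm (measurableSet_forall_le x),
      ← measure_le_gumbel_eq_farLimit Q L L₂ hL_indep hL hL₂ x]
    rfl
  have hval : ∀ k, ((cond (P (n₀ + k)) (S k)).map fun ω ↦ recenteredDistances α (V (n₀ + k))
      (fun e ↦ E (n₀ + k) e ω)).real {z | ∀ p, x p ≤ z p}
      = ((iidExp (Sym2 (Fin (n₀ + k))) (1 / ((n₀ + k : ℕ) : ℝ))).real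
          {w | (slowVertices α w).card = m})⁻¹ *
        (iidExp (Sym2 (Fin (n₀ + k))) (1 / ((n₀ + k : ℕ) : ℝ))).real
          {w | (slowVertices α w).card = m ∧ ∀ p, x p ≤ recenteredDistances α (V (n₀ + k)) w p} := by
    intro k
    have h1 : P (n₀ + k) {ω | (fun e ↦ E (n₀ + k) e ω) ∈ {w : Sym2 (Fin (n₀ + k)) → ℝ |
          (slowVertices α w).card = m ∧ ∀ p, x p ≤ recenteredDistances α (V (n₀ + k)) w p}}
        = _ := measure_preimage_eq_iidExp (hE_indep (n₀ + k)) (hE_law (n₀ + k))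
      ((measurableSet_card_slowVertices (hn2 k) α m).inter
        (measurable_recenteredDistances (hn2 k) α (V (n₀ + k)) (measurableSet_forall_le x)))
      fun w w' h ↦ by
        simp only [Set.mem_ofPred_eq,
          slowVertices_congr h α, recenteredDistances_congr h α]
    rw [Measure.real, Measure.map_apply_of_aemeasurable (hXm' k) (measurableSet_forall_le x),
      ProbabilityTheory.cond, Measure.smul_apply, smul_eq_mul,
      Measure.restrict_apply₀' (hSnull k), Set.inter_comm, ENNReal.toReal_mul, ENNReal.toReal_inv, hSm k]
    congr 1
    exact congrArg ENNReal.toReal h1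
  change Tendsto (fun k ↦ ((cond (P (n₀ + k)) (S k)).map fun ω ↦
    recenteredDistances α (V (n₀ + k)) (fun e ↦ E (n₀ + k) e ω)).real {z | ∀ p, x p ≤ z p}) atTop
    (𝓝 ((Q.map fun ω (p : OrderedPairs m) ↦ L p.1.1 ω + L p.1.2 ω - L₂ p ω).real
      {z | ∀ p, x p ≤ z p}))
  simp_rw [hval, hlim]
  have hshift : Tendsto (fun k ↦ n₀ + k) atTop atTop :=
    tendsto_atTop_mono (fun k ↦ Nat.le_add_left k n₀) tendsto_id
  refine tendsto_of_tendsto_of_tendsto_of_le_of_le' (hl.comp hshift) (hu.comp hshift) ?_ ?_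
  · filter_upwards [hshift.eventually hlu] with k hk
    obtain ⟨h1, h2, -⟩ := hk (V (n₀ + k))
    rw [inv_mul_eq_div, le_div_iff₀ h1]
    exact h2
  · filter_upwards [hshift.eventually hlu] with k hk
    obtain ⟨h1, -, h3⟩ := hk (V (n₀ + k))
    rw [inv_mul_eq_div, div_le_iff₀ h1]
    exact h3
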